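/- Let $d>0$. Let $\mathbb H_1$ be the set of unit quaternions, seen as the unit sphere of the Euclidean space $\mathbb H\cong\mathbb R^4$ with dot product $p\cdot q$ and surface measure $dq$; let $\nabla$ and $\nabla\cdot$ be the gradient and the divergence on this sphere. $H^1(\mathbb H_1)$ is the space of functions in $L^2(\mathbb H_1)$ whose weak gradient is in $L^2$. For $\bar q\in\mathbb H_1$ put $$M_{\bar q}(q)=\frac1Z\exp\Big(\frac2d\big((\bar q\cdot q)^2-\tfrac14\big)\Big),\qquad \int_{\mathbb H_1}M_{\bar q}\,dq=1,\qquad C(f,\bar q)=\nabla\cdot\Big(M_{\bar q}\nabla\Big(\frac{f}{M_{\bar q}}\Big)\Big).$$ A function $\psi\in H^1(\mathbb H_1)$ is a generalized collision invariant (GCI) associated with $\bar q$ if $\int_{\mathbb H_1}C(f,\bar q)\,\psi\,dq=0$ for all smooth $f:\mathbb H_1\to\mathbb R$ such that $P_{\bar q^\perp}\big[\big(\int_{\mathbb H_1}(q\otimes q) f(q)\,dq\big)\bar q\big]=0$, where $P_{\bar q^\perp}$ is the orthogonal projection onto $\bar q^\perp=\{\beta\in\mathbb H:\beta\cdot\bar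 q=0\}$. Functions are identified when they agree almost everywhere, and $GCI(\bar q)\subset L^2(\mathbb H_1)$ is the set of GCI associated with $\bar q$. Let $H_{(-1,1)}$ be the space of functions $h$ on $(-1,1)$, with a (locally integrable) weak derivative $h'$, such that $$\int_{-1}^1(1-r^2)^{3/2}h(r)^2\,dr<\infty\quad\text{and}\quad\int_{-1}^1(1-r^2)^{5/2}h'(r)^2\,dr<\infty,$$ and consider on $(-1,1)$ the equation $$(1-r^2)^{3/2}e^{2r^2/d}\Big(-\frac4dr^2-3\Big)h(r)+\frac{d}{dr}\Big[(1-r^2)^{5/2}e^{2r^2/d}\,h'(r)\Big]=r\,(1-r^2)^{3/2}e^{2r^2/d}.\tag{1}$$ For $\beta\in\bar q^\perp$ consider on $\mathbb H_1$ the equation $$\nabla\cdot(M_{\bar q}\nabla\psi)=(\beta\cdot q)(\bar q\cdot q)\,M_{\bar q},\tag{2}$$ understood for $\psi\in H^1(\mathbb H_1)$ in the weak sense: $\int M_{\bar q}\nabla\psi\cdot\nabla\varphi\,dq=-\int(\beta\cdot q)(\bar q\cdot q)\,\varphi\,M_{\bar q}\,dq$ for all $\varphi\in H^1(\mathbb H_1)$.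 Then (1) has a solution $h\in H_{(-1,1)}$, which is unique (almost everywhere) among all distributional solutions of (1) in $H_{(-1,1)}$. It is of class $C^2$ on $(-1,1)$ and solves (1) pointwise, it is odd, and $h(r)\le0$ for all $r\in[0,1)$. Moreover, for every $\bar q\in\mathbb H_1$: 1. A function $\psi:\mathbb H_1\to\mathbb R$ is a GCI associated with $\bar q$ if and only if $\psi\in H^1(\mathbb H_1)$ and there is a $\beta\in\bar q^\perp$ such that $\psi$ solves (2). 2. For every $\beta\in\bar q^\perp$, equation (2) has a solution in $H^1(\mathbb H_1)$, and the solution is unique up to an additive constant. 3. For every nonzero $\beta\in\bar q^\perp$ and every $C^2$ function $k$ on $(-1,1)$, the function $q\mapsto(\beta\cdot q)\,k(q\cdot\bar q)$ has mean zero, is in $H^1(\mathbb H_1)$ and solves (2) if and only if $k\in H_{(-1,1)}$ and $k$ solves (1). 4. With $\psi^\beta(q):=(\beta\cdot q)\,h(q\cdot\bar q)$, each $\psi^\beta$, $\beta\in\bar q^\perp$, is in $L^2(\mathbb H_1)$, $$GCI(\bar q)=\operatorname{span}\Big(\{1\}\cup\{\psi^\beta:\beta\in\bar q^\perp\}\Big),$$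 and this vector space has dimension $4$. -/

import Mathlib

open MeasureTheory Set Module
open scoped Quaternion Manifold ContDiff

noncomputable section

namespace GCIQuat

/-! ### The unit quaternions as a Riemannian 3-sphere -/

instance instMeasurableSpaceQuaternion : MeasurableSpace ℍ[ℝ] := borel ℍ[ℝ]

instance instBorelSpaceQuaternion : BorelSpace ℍ[ℝ] := ⟨rfl⟩

instance instFactFinrankQuaternion : Fact (finrank ℝ ℍ[ℝ] = 3 + 1) :=
  ⟨Quaternion.finrank_eq_four⟩

/-- The unit quaternions, i.e. the unit sphere of the Euclidean space of quaternions.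
Mathlib provides the smooth structure modelled on `𝓡 3`. -/
abbrev H1 : Type := Metric.sphere (0 : ℍ[ℝ]) 1

/-- The Lebesgue (surface) measure on the unit quaternions. -/
def sigma : Measure H1 := (volume : Measure ℍ[ℝ]).toSphere

instance instIsFiniteMeasureSigma : IsFiniteMeasure sigma := by
  unfold sigma; infer_instance

/-- The dot product of quaternions. -/
def dot (p q : ℍ[ℝ]) : ℝ := inner ℝ p q

/-- The space `q^⊥` of quaternions orthogonal to `q`. -/
def perp (q : ℍ[ℝ]) : Submodule ℝ ℍ[ℝ] := (Submodule.span ℝ {q})ᗮ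

open Classical in
/-- The extension `x ↦ F (x / |x|)` of a function on the sphere, constant along rays
(the value at the origin is never used). -/
def radialExt {V : Type} [Zero V] (F : H1 → V) (x : ℍ[ℝ]) : V :=
  if hx : x = 0 then 0 else
    F ⟨‖x‖⁻¹ • x, by
      rw [mem_sphere_zero_iff_norm, norm_smul, norm_inv, norm_norm,
        inv_mul_cancel₀ (norm_ne_zero_iff.mpr hx)]⟩

/-- The gradient on the sphere of a scalar function: the Euclidean gradient of its extension
constant along rays, which is a tangent vector. -/
def sphereGrad (f : H1 → ℝ) (q : H1) : ℍ[ℝ] := gradient (radialExt f) (q : ℍ[ℝ])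

/-- The divergence on the sphere of a tangent vector field `X` (that is, `X q ⊥ q`): the
Euclidean divergence of its extension constant along rays. -/
def sphereDiv (X : H1 → ℍ[ℝ]) (q : H1) : ℝ :=
  LinearMap.trace ℝ ℍ[ℝ] (fderiv ℝ (radialExt X) (q : ℍ[ℝ]) : ℍ[ℝ] →ₗ[ℝ] ℍ[ℝ])

/-- Smooth scalar functions on the unit quaternions. -/
def SmoothFun (f : H1 → ℝ) : Prop := ContMDiff (𝓡 3) 𝓘(ℝ, ℝ) ∞ f

/-- Smooth tangent vector fields on the unit quaternions. -/
def SmoothTangentField (X : H1 → ℍ[ℝ]) : Prop :=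
  ContMDiff (𝓡 3) 𝓘(ℝ, ℍ[ℝ]) ∞ X ∧ ∀ q : H1, dot (q : ℍ[ℝ]) (X q) = 0

/-! ### The Sobolev space `H¹` of the unit quaternions -/

/-- `ψ` is square integrable and has the square integrable tangent vector field `G` as its weak
gradient. -/
structure HasWeakGradient (ψ : H1 → ℝ) (G : H1 → ℍ[ℝ]) : Prop where
  memLp : MemLp ψ 2 sigma
  memLp_grad : MemLp G 2 sigma
  tangent : ∀ᵐ q : H1 ∂sigma, dot (q : ℍ[ℝ]) (G q) = 0
  integral_eq : ∀ X : H1 → ℍ[ℝ], SmoothTangentField X →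
    ∫ q, ψ q * sphereDiv X q ∂sigma = - ∫ q, dot (G q) (X q) ∂sigma

/-- Membership in `H¹`. -/
def MemH1 (ψ : H1 → ℝ) : Prop := ∃ G : H1 → ℍ[ℝ], HasWeakGradient ψ G

/-! ### Equilibria, the linearised operator and generalised collision invariants -/

/-- The normalising constant of the equilibrium. -/
def partitionZ (d : ℝ) (qbar : H1) : ℝ :=
  ∫ q : H1, Real.exp (2 / d * (dot (qbar : ℍ[ℝ]) (q : ℍ[ℝ]) ^ 2 - 1 / 4)) ∂sigma

/-- The von Mises-like equilibrium centred at `qbar`. -/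
def vonMises (d : ℝ) (qbar q : H1) : ℝ :=
  Real.exp (2 / d * (dot (qbar : ℍ[ℝ]) (q : ℍ[ℝ]) ^ 2 - 1 / 4)) / partitionZ d qbar

/-- `C(f, qbar) = ∇ · (M ∇ (f / M))`, for `M` the equilibrium centred at `qbar`. -/
def collisionC (d : ℝ) (qbar : H1) (f : H1 → ℝ) : H1 → ℝ :=
  sphereDiv fun q => vonMises d qbar q • sphereGrad (fun q' => f q' / vonMises d qbar q') q

/-- The operator `∫ (q ⊗ q) f(q) dq` on quaternions. -/
def secondMoment (f : H1 → ℝ) : ℍ[ℝ] →L[ℝ] ℍ[ℝ] :=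
  ∫ q : H1, f q • InnerProductSpace.rankOne ℝ (q : ℍ[ℝ]) (q : ℍ[ℝ]) ∂sigma

/-- Generalised collision invariants associated with `qbar`. -/
def IsGCI (d : ℝ) (qbar : H1) (ψ : H1 → ℝ) : Prop :=
  MemH1 ψ ∧ ∀ f : H1 → ℝ, SmoothFun f →
    (Submodule.span ℝ {(qbar : ℍ[ℝ])})ᗮ.starProjection (secondMoment f (qbar : ℍ[ℝ])) = 0 →
    ∫ q, collisionC d qbar f q * ψ q ∂sigma = 0

/-- The set of generalised collision invariants, functions being identified when they agree
almost everywhere. -/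
def GCI (d : ℝ) (qbar : H1) : Set (Lp ℝ 2 sigma) := {u | IsGCI d qbar u}

/-- `ψ ∈ H¹` solves `∇ · (M ∇ψ) = (β · q) (qbar · q) M` on the unit quaternions (weak form,
tested against all of `H¹`). -/
def SolvesSphereEq (d : ℝ) (qbar : H1) (β : ℍ[ℝ]) (ψ : H1 → ℝ) : Prop :=
  ∃ G : H1 → ℍ[ℝ], HasWeakGradient ψ G ∧
    ∀ (φ : H1 → ℝ) (Gφ : H1 → ℍ[ℝ]), HasWeakGradient φ Gφ →
      ∫ q, vonMises d qbar q * dot (G q) (Gφ q) ∂sigma =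
        - ∫ q : H1, dot β (q : ℍ[ℝ]) * dot (qbar : ℍ[ℝ]) (q : ℍ[ℝ]) * φ q
            * vonMises d qbar q ∂sigma

/-- The function `q ↦ (β · q) h(q · qbar)`. -/
def psiFun (h : ℝ → ℝ) (qbar : H1) (β : ℍ[ℝ]) (q : H1) : ℝ :=
  dot β (q : ℍ[ℝ]) * h (dot (q : ℍ[ℝ]) (qbar : ℍ[ℝ]))

/-! ### The differential equation on `(-1,1)`

Functions on `(-1,1)` are represented by functions on `ℝ`, of which only the values on `(-1,1)`
are used. -/

/-- Test functions: smooth with compact support in `(-1,1)`. -/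
def IsTestFun (φ : ℝ → ℝ) : Prop :=
  ContDiff ℝ ∞ φ ∧ HasCompactSupport φ ∧ tsupport φ ⊆ Ioo (-1) 1

/-- `g` is the weak derivative of `h` on `(-1,1)`. -/
def HasWeakDeriv (h g : ℝ → ℝ) : Prop :=
  LocallyIntegrableOn h (Ioo (-1) 1) ∧ LocallyIntegrableOn g (Ioo (-1) 1) ∧
    ∀ φ : ℝ → ℝ, IsTestFun φ →
      ∫ r in Ioo (-1 : ℝ) 1, h r * deriv φ r = - ∫ r in Ioo (-1 : ℝ) 1, g r * φ r

/-- `h` belongs to the weighted space `H_{(-1,1)}` and `g` is its weak derivative. -/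
def MemWeighted (h g : ℝ → ℝ) : Prop :=
  HasWeakDeriv h g ∧
    IntegrableOn (fun r => (1 - r ^ 2) ^ (3 / 2 : ℝ) * h r ^ 2) (Ioo (-1) 1) ∧
    IntegrableOn (fun r => (1 - r ^ 2) ^ (5 / 2 : ℝ) * g r ^ 2) (Ioo (-1) 1)

/-- The weight `(1 - r²)^a exp(2 r² / d)`. -/
def weight (d a r : ℝ) : ℝ := (1 - r ^ 2) ^ a * Real.exp (2 * r ^ 2 / d)

/-- `h` is a weak (distributional) solution in the weighted space of
`w₃ (-4 r² / d - 3) h + (w₅ h')' = r w₃` on `(-1,1)`, with `w₃`, `w₅` the weights of exponents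
`3/2`, `5/2`. -/
def IsWeakODESolution (d : ℝ) (h : ℝ → ℝ) : Prop :=
  ∃ g : ℝ → ℝ, MemWeighted h g ∧ ∀ φ : ℝ → ℝ, IsTestFun φ →
    (∫ r in Ioo (-1 : ℝ) 1, weight d (3 / 2) r * (-4 / d * r ^ 2 - 3) * h r * φ r)
        - ∫ r in Ioo (-1 : ℝ) 1, weight d (5 / 2) r * g r * deriv φ r
      = ∫ r in Ioo (-1 : ℝ) 1, r * weight d (3 / 2) r * φ r

/-- `h` is a `C²` function in the weighted space that solves the same equation pointwise. -/
def IsODESolution (d : ℝ) (h : ℝ → ℝ) : Prop :=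
  ContDiffOn ℝ 2 h (Ioo (-1) 1) ∧ (∃ g : ℝ → ℝ, MemWeighted h g) ∧
    ∀ r ∈ Ioo (-1 : ℝ) 1,
      weight d (3 / 2) r * (-4 / d * r ^ 2 - 3) * h r
          + deriv (fun s => weight d (5 / 2) s * deriv h s) r
        = r * weight d (3 / 2) r

end GCIQuat

end

open GCIQuat

/-!
The equilibrium depends on `q` through `r = q̄ · q` only, so the elliptic equation
`∇ · (M ∇ψ) = (β · q) r M` separates: `ψ = (β · q) h(r)` solves it as soon as `h` solves the radial
equation `(1 - r²) h'' + (-5 r + (4/d) r (1 - r²)) h' - ((4/d) r² + 3) h = r`, which is the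
equation in divergence form divided by `(1 - r²)^(3/2) exp(2 r² / d)` (`sphereDiv_psiFun`).

*The radial equation.* The point `r = 1` is a regular singular point. In the variable `1 - r` the
recursion for a power series solution determines all coefficients from the value at `r = 1`, and the
series converges well beyond `r = 0` (`exists_isRadialSolution_endpoint`). By a maximum principle,
based on the sign of the zeroth order term, a regular homogeneous solution that does not vanish at
`r = 1` does not vanish at `r = 0` either. So one can subtract a multiple of it from a regular
particular solution to obtain a solution with value `0` at `r = 0`, whose odd extension is a smooth
solution on a neighbourhood of `[-1, 1]` (`exists_odd_isRadialSolution`). The maximum principle also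
gives its sign. Smoothness up to the endpoints is what makes `ψ` smooth on the whole sphere. The
difference `V` of two solutions in the weighted space is a classical homogeneous solution of finite
energy with flux `P`. The function `P V` is nondecreasing, and it is nonpositive on `(-1, 1)`, since
a positive value would force infinite energy near `r = 1`. By reflection it is nonnegative as well,
so its derivative, a sum of two squares with positive weights, vanishes, and `V = 0`
(`IsWeakODESolution.ae_eq`).

*Analysis on the sphere.* The unit quaternions are a group, and the left-invariant fields
`q ↦ q i`, `q ↦ q j`, `q ↦ q k` form an orthonormal frame. They are divergence free, as the surface
measure is invariant under right translations. Gradient, divergence and weak gradient are expressed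
through this frame (`sphereDiv_eq_sum`, `HasWeakGradient.integral_mul_frameDeriv`). Convolution with
zonal kernels `ρ(p · q)` commutes with the frame derivatives (`frameDeriv_moll`), so smooth
functions are weakly dense in `H¹` and functions with vanishing weak gradient are constant
(`HasWeakGradient.sum_integral_eq_zero`, `HasWeakGradient.ae_eq_const`). The second fact gives
uniqueness up to constants for the elliptic equation.

*Generalised collision invariants.* With `f = M φ` the condition on a generalised collision
invariant `ψ` says that the linear functional `φ ↦ ∫ M ∇ψ · ∇φ` vanishes whenever all functionals
`φ ↦ ∫ (β · q) r φ M`, `β ⊥ q̄`, vanish. These form a finite-dimensional space, so the first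
functional is one of them, and `ψ` solves the elliptic equation for some `β` (`isGCI_iff`).
Therefore the invariants are the functions `c + ψ^β`. As `ψ^β` has mean zero by a reflection and
`h ≠ 0`, the map `(c, β) ↦ c + ψ^β` is injective, and the dimension is `1 + 3`.
-/

namespace GCIQuat

open Filter Topology

/-! ### Solutions of the radial equation that are analytic at the endpoint -/

section PowerSeries

/-- Termwise differentiation of a real power series inside its disc of convergence. -/
theorem hasDerivAt_tsum_mul_pow {a : ℕ → ℝ} {R : ℝ}
    (h : ∀ t, 0 ≤ t → t < R → Summable fun n => |a n| * t ^ n) :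
    (∀ t, 0 ≤ t → t < R → Summable fun n : ℕ => |(n + 1) * a (n + 1)| * t ^ n) ∧
    ∀ s, |s| < R → HasDerivAt (fun s => ∑' n, a n * s ^ n)
      (∑' n : ℕ, ((n + 1) * a (n + 1)) * s ^ n) s := by
  have key : ∀ t, 0 ≤ t → t < R → Summable fun n : ℕ => |a n| * (n * t ^ (n - 1)) := by
    intro t ht htR
    obtain ⟨t', h1, h2⟩ := exists_between htR
    have ht' : 0 < t' := ht.trans_lt h1
    have hq : ‖t / t'‖ < 1 := by
      rw [Real.norm_eq_abs, abs_of_nonneg (by positivity), div_lt_one ht']; exact h1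
    have hlim := (summable_pow_mul_geometric_of_norm_lt_one 1 hq).tendsto_atTop_zero
    obtain ⟨C, hC⟩ := hlim.bddAbove_range
    have hC' : ∀ n : ℕ, (n : ℝ) * t ^ n ≤ C * t' ^ n := by
      intro n
      have := hC ⟨n, rfl⟩
      simp only [pow_one, div_pow] at this
      rw [← mul_div_assoc, div_le_iff₀ (by positivity)] at this
      exact this
    rcases ht.eq_or_lt with rfl | ht0
    · refine summable_of_ne_finset_zero (s := {1}) fun n hn => ?_
      rcases n with _ | _ | n
      · simp
      · simp at hn
      · simp
    · refine Summable.of_nonneg_of_le (fun n => by positivity) (fun n => ?_)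
        ((h t' ht'.le h2).mul_left (C / t))
      have h3 : (n : ℝ) * t ^ (n - 1) ≤ C / t * t' ^ n := by
        rw [div_mul_eq_mul_div, le_div_iff₀ ht0]
        rcases n with _ | n
        · have := hC' 0
          simpa using this
        · have := hC' (n + 1)
          rw [pow_succ t] at this
          simpa [mul_assoc] using this
      calc |a n| * (n * t ^ (n - 1)) ≤ |a n| * (C / t * t' ^ n) := by gcongr
        _ = C / t * (|a n| * t' ^ n) := by ring
  have key2 : ∀ t, 0 ≤ t → t < R → Summable fun n : ℕ => |(n + 1) * a (n + 1)| * t ^ n := by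
    intro t ht htR
    refine ((summable_nat_add_iff 1).2 (key t ht htR)).congr fun n => ?_
    rw [abs_mul, abs_of_nonneg (by positivity : (0 : ℝ) ≤ n + 1)]
    push_cast
    ring
  refine ⟨key2, fun s hs => ?_⟩
  obtain ⟨t, h1, h2⟩ := exists_between hs
  have ht : 0 < t := (abs_nonneg s).trans_lt h1
  have := hasDerivAt_tsum_of_isPreconnected (g := fun (n : ℕ) (x : ℝ) => a n * x ^ n)
    (g' := fun n x => a n * (n * x ^ (n - 1))) (t := Metric.ball (0 : ℝ) t) (y₀ := 0) (y := s)
    (key t ht.le h2) Metric.isOpen_ball (convex_ball _ _).isPreconnected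
    (fun n y _ => (hasDerivAt_pow n y).const_mul _)
    (fun n y hy => ?_) (by simpa using ht) ?_ (by simpa using h1)
  · refine this.congr_deriv ?_
    have hsum : Summable fun n : ℕ => a n * (n * s ^ (n - 1)) := by
      refine .of_norm ((key |s| (abs_nonneg s) hs).congr fun n => ?_)
      simp
    rw [hsum.tsum_eq_zero_add]
    simp only [Nat.cast_zero, zero_mul, mul_zero, zero_add, Nat.add_sub_cancel]
    refine tsum_congr fun n => by push_cast; ring
  · have hy' : |y| ≤ t := by simpa using (mem_ball_zero_iff.1 hy).le
    simp only [norm_mul, Real.norm_eq_abs, norm_pow, Nat.abs_cast]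
    gcongr
  · exact summable_of_ne_finset_zero (s := {0}) fun n hn => by
      have : n ≠ 0 := by simpa using hn
      simp [this]

theorem contDiffOn_tsum_mul_pow {R : ℝ} (k : ℕ) : ∀ {a : ℕ → ℝ},
    (∀ t, 0 ≤ t → t < R → Summable fun n => |a n| * t ^ n) →
    ContDiffOn ℝ k (fun s => ∑' n, a n * s ^ n) (Ioo (-R) R) := by
  induction k with
  | zero =>
    intro a h
    refine contDiffOn_zero.2 fun s hs => ?_
    exact ((hasDerivAt_tsum_mul_pow h).2 s (abs_lt.2 hs)).continuousAt.continuousWithinAt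
  | succ k ih =>
    intro a h
    obtain ⟨h1, h2⟩ := hasDerivAt_tsum_mul_pow h
    push_cast
    rw [contDiffOn_succ_iff_deriv_of_isOpen isOpen_Ioo]
    refine ⟨fun s hs => (h2 s (abs_lt.2 hs)).differentiableAt.differentiableWithinAt, by simp, ?_⟩
    exact (ih h1).congr fun s hs => (h2 s (abs_lt.2 hs)).deriv

theorem hasSum_mul_pow_shift {u v : ℕ → ℝ} {s U : ℝ} (h : HasSum (fun n => u n * s ^ n) U)
    (h0 : v 0 = 0) (hv : ∀ n, v (n + 1) = u n) : HasSum (fun n => v n * s ^ n) (s * U) := by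
  have h1 : HasSum (fun n => v (n + 1) * s ^ (n + 1)) (s * U) :=
    (h.mul_left s).congr_fun fun n => by rw [hv, pow_succ]; ring
  have := (hasSum_nat_add_iff (f := fun n => v n * s ^ n) 1).1 h1
  simpa [h0] using this

end PowerSeries

/-- Coefficients of the power series in `s = 1 - r`, delayed by two indices (so that the recurrence
has no exceptional cases), of the solution with value `c` at `r = 1` of the radial equation with
right-hand side `ε r`; here `κ = 4 / d`. -/
noncomputable def endpointCoeff (κ ε c : ℝ) : ℕ → ℝ
  | 0 => 0
  | 1 => 0
  | 2 => c
  | n + 3 => (((n : ℝ) ^ 2 + 4 * n + 3 + κ * (2 * n + 1)) * endpointCoeff κ ε c (n + 2)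
      - κ * (3 * n - 1) * endpointCoeff κ ε c (n + 1) + κ * (n - 1) * endpointCoeff κ ε c n
      + (if n = 0 then ε else if n = 1 then -ε else 0)) / ((n + 1) * (2 * n + 5))

/-- A recurrence of order three whose coefficients are at most `3/5 + 1/20`, `1/20` and `1/20` has
solutions decaying like `(4/5)^n`, as `13/20 (4/5)² + 1/20 (4/5) + 1/20 ≤ (4/5)³`. -/
theorem exists_geometric_bound {b : ℕ → ℝ} {N : ℕ}
    (h : ∀ n, N ≤ n → |b (n + 3)| ≤
      3 / 5 * |b (n + 2)| + 1 / 20 * (|b (n + 2)| + |b (n + 1)| + |b n|)) :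
    ∃ C, ∀ n, |b n| ≤ C * (4 / 5) ^ n := by
  set C := ∑ i ∈ Finset.range (N + 3), |b i| * (5 / 4) ^ i with hC
  have hC0 : 0 ≤ C := Finset.sum_nonneg fun i _ => by positivity
  refine ⟨C, fun n => ?_⟩
  induction n using Nat.strong_induction_on with
  | _ n ih =>
    by_cases hn : n < N + 3
    · have h1 : |b n| * (5 / 4) ^ n ≤ C :=
        Finset.single_le_sum (f := fun i => |b i| * (5 / 4 : ℝ) ^ i)
          (fun i _ => by positivity) (Finset.mem_range.2 hn)
      calc |b n| = |b n| * (5 / 4) ^ n * (4 / 5) ^ n := by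
            rw [mul_assoc, ← mul_pow]; norm_num
        _ ≤ C * (4 / 5) ^ n := by gcongr
    · obtain ⟨m, rfl⟩ : ∃ m, n = m + 3 := ⟨n - 3, by omega⟩
      have h0 := ih m (by omega)
      have h1 := ih (m + 1) (by omega)
      have h2 := ih (m + 2) (by omega)
      have h3 := h m (by omega)
      have hp : 0 ≤ C * (4 / 5) ^ m := by positivity
      rw [pow_succ, ← mul_assoc] at h1
      rw [pow_add, ← mul_assoc] at h2 ⊢
      norm_num at h2 h1 ⊢
      linarith

theorem exists_endpointCoeff_bound (κ ε c : ℝ) :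
    ∃ C, ∀ n, |endpointCoeff κ ε c n| ≤ C * (4 / 5) ^ n := by
  obtain ⟨N, hN⟩ := exists_nat_gt (40 * |κ|)
  refine exists_geometric_bound (N := N + 2) fun n hn => ?_
  obtain ⟨m, rfl⟩ : ∃ m, n = m + 2 := ⟨n - 2, by omega⟩
  have hm : 40 * |κ| ≤ (m : ℝ) := hN.le.trans (by exact_mod_cast (by omega : N ≤ m))
  rw [endpointCoeff]
  set x := endpointCoeff κ ε c (m + 2 + 2)
  set y := endpointCoeff κ ε c (m + 2 + 1)
  set z := endpointCoeff κ ε c (m + 2)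
  have hm0 : (0 : ℝ) ≤ m := Nat.cast_nonneg m
  have hD : (0 : ℝ) < ((m + 2 : ℕ) + 1) * (2 * (m + 2 : ℕ) + 5) := by positivity
  rw [abs_div, abs_of_pos hD, div_le_iff₀ hD]
  simp only [Nat.add_eq_zero_iff, OfNat.ofNat_ne_zero, and_false, if_false,
    show m + 2 ≠ 1 by omega, add_zero]
  push_cast
  have hκ := abs_nonneg κ
  have e1 : |((m + 2 : ℝ) ^ 2 + 4 * (m + 2) + 3 + κ * (2 * (m + 2) + 1)) * x
      - κ * (3 * (m + 2) - 1) * y + κ * ((m + 2) - 1) * z| ≤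
      ((m + 2 : ℝ) ^ 2 + 4 * (m + 2) + 3 + |κ| * (2 * (m + 2) + 1)) * |x|
      + |κ| * (3 * (m + 2) - 1) * |y| + |κ| * ((m + 2) - 1) * |z| := by
    refine (abs_add_le _ _).trans (add_le_add ((abs_sub _ _).trans (add_le_add ?_ ?_)) ?_)
    · rw [abs_mul]
      gcongr
      refine (abs_add_le _ _).trans (add_le_add (abs_of_nonneg (by positivity)).le ?_)
      rw [abs_mul, abs_of_nonneg (by positivity : (0 : ℝ) ≤ 2 * (m + 2) + 1)]
    · rw [abs_mul, abs_mul, abs_of_nonneg (by linarith : (0 : ℝ) ≤ 3 * (m + 2) - 1)]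
    · rw [abs_mul, abs_mul, abs_of_nonneg (by linarith : (0 : ℝ) ≤ (m + 2) - 1)]
  refine e1.trans ?_
  -- The quotient of the leading coefficients tends to `1/2 < 3/5`, and the terms with `κ` are of
  -- lower order.
  have f1 : (m + 2 : ℝ) ^ 2 + 4 * (m + 2) + 3 + |κ| * (2 * (m + 2) + 1) ≤
      (3 / 5 + 1 / 20) * ((m + 2 + 1) * (2 * (m + 2) + 5)) := by nlinarith
  have f2 : |κ| * (3 * (m + 2) - 1) ≤ 1 / 20 * ((m + 2 + 1) * (2 * (m + 2) + 5) : ℝ) := by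
    nlinarith
  have f3 : |κ| * ((m + 2) - 1) ≤ 1 / 20 * ((m + 2 + 1) * (2 * (m + 2) + 5) : ℝ) := by
    nlinarith
  have g1 := mul_le_mul_of_nonneg_right f1 (abs_nonneg x)
  have g2 := mul_le_mul_of_nonneg_right f2 (abs_nonneg y)
  have g3 := mul_le_mul_of_nonneg_right f3 (abs_nonneg z)
  linarith

/-- `y`, with first and second derivatives `y'` and `y''`, solves on `s` the radial equation in
non-divergence form with right-hand side `ε r`; here `κ = 4 / d`. -/
structure IsRadialSolution (κ ε : ℝ) (s : Set ℝ) (y y' y'' : ℝ → ℝ) : Prop where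
  hasDerivAt : ∀ r ∈ s, HasDerivAt y (y' r) r
  hasDerivAt' : ∀ r ∈ s, HasDerivAt y' (y'' r) r
  eq : ∀ r ∈ s, (1 - r ^ 2) * y'' r + (-5 * r + κ * r * (1 - r ^ 2)) * y' r
    - (κ * r ^ 2 + 3) * y r = ε * r

/-- The radial equation has a solution with prescribed value at `r = 1` that is smooth in a
neighbourhood of `[0, 1]`: the coefficients of its power series at the regular singular point
`r = 1` are `O((4/5)^n)`. -/
theorem exists_isRadialSolution_endpoint (κ ε c : ℝ) :
    ∃ y y' y'' : ℝ → ℝ, ContDiffOn ℝ ∞ y (Ioo (-1 / 4) (9 / 4)) ∧ y 1 = c ∧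
      IsRadialSolution κ ε (Ioo (-1 / 4) (9 / 4)) y y' y'' := by
  set b := endpointCoeff κ ε c with hb
  obtain ⟨C, hC⟩ := exists_endpointCoeff_bound κ ε c
  set a : ℕ → ℝ := fun n => b (n + 2) with ha
  have hsum : ∀ t, 0 ≤ t → t < 5 / 4 → Summable fun n => |a n| * t ^ n := by
    intro t ht htR
    have hg : Summable fun n : ℕ => (4 / 5 * t) ^ n :=
      summable_geometric_of_lt_one (by positivity) (by linarith)
    refine Summable.of_nonneg_of_le (fun n => by positivity) (fun n => ?_)
      (hg.mul_left (C * (4 / 5) ^ 2))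
    calc |a n| * t ^ n ≤ C * (4 / 5) ^ (n + 2) * t ^ n := by gcongr; exact hC _
      _ = C * (4 / 5) ^ 2 * (4 / 5 * t) ^ n := by rw [mul_pow]; ring
  obtain ⟨hsum1, hd1⟩ := hasDerivAt_tsum_mul_pow hsum
  obtain ⟨hsum2, hd2⟩ := hasDerivAt_tsum_mul_pow hsum1
  have habs : ∀ r ∈ Ioo (-1 / 4 : ℝ) (9 / 4), |1 - r| < 5 / 4 := fun r hr =>
    abs_lt.2 ⟨by linarith [hr.2], by linarith [hr.1]⟩
  have toHasSum : ∀ {u : ℕ → ℝ}, (∀ t, 0 ≤ t → t < 5 / 4 → Summable fun n => |u n| * t ^ n) →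
      ∀ s, |s| < 5 / 4 → HasSum (fun n => u n * s ^ n) (∑' n, u n * s ^ n) := by
    intro u hu s hs
    refine Summable.hasSum (.of_norm ((hu _ (abs_nonneg s) hs).congr fun n => ?_))
    simp
  refine ⟨fun r => ∑' n, a n * (1 - r) ^ n,
    fun r => -∑' n : ℕ, ((n + 1) * a (n + 1)) * (1 - r) ^ n,
    fun r => ∑' n : ℕ, ((n + 1) * (((n + 1 : ℕ) + 1) * a (n + 1 + 1))) * (1 - r) ^ n,
    ?_, ?_, ?_, ?_, ?_⟩
  · have : ContDiffOn ℝ ∞ (fun s => ∑' n, a n * s ^ n) (Ioo (-(5 / 4)) (5 / 4)) :=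
      contDiffOn_infty.2 fun k => contDiffOn_tsum_mul_pow k hsum
    exact this.comp (contDiff_const.sub contDiff_id).contDiffOn fun r hr => abs_lt.1 (habs r hr)
  · simp only [sub_self]
    rw [tsum_eq_single 0 fun n hn => by simp [hn]]
    simp [ha, hb, endpointCoeff]
  · intro r hr
    exact (hd1 _ (habs r hr)).comp_const_sub 1 r
  · intro r hr
    exact ((hd2 _ (habs r hr)).comp_const_sub 1 r).neg.congr_deriv (neg_neg _)
  · intro r hr
    have hs := habs r hr
    have hr' : r = 1 - (1 - r) := by ring
    generalize 1 - r = s at *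
    subst hr'
    have S0 := toHasSum hsum s hs
    have S1 := toHasSum hsum1 s hs
    have S2 := toHasSum hsum2 s hs
    generalize (∑' n, a n * s ^ n) = Y0 at *
    generalize (∑' n : ℕ, ((n + 1) * a (n + 1)) * s ^ n) = Y1 at *
    generalize (∑' n : ℕ, ((n + 1) * (((n + 1 : ℕ) + 1) * a (n + 1 + 1))) * s ^ n) = Y2 at *
    have b0 : b 0 = 0 := by simp [hb, endpointCoeff]
    have b1 : b 1 = 0 := by simp [hb, endpointCoeff]
    have S0s := hasSum_mul_pow_shift (v := fun n => b (n + 1)) S0 (by simp [b1]) (fun n => rfl)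
    have S0ss := hasSum_mul_pow_shift (v := fun n => b n) S0s (by simp [b0]) (fun n => rfl)
    have S1s := hasSum_mul_pow_shift (v := fun n => n * b (n + 2)) S1 (by simp)
      (fun n => by push_cast; rfl)
    have S1ss := hasSum_mul_pow_shift (v := fun n => (n - 1) * b (n + 1)) S1s (by simp [b1])
      (fun n => by push_cast; ring)
    have S1sss := hasSum_mul_pow_shift (v := fun n => (n - 2) * b n) S1ss (by simp [b0])
      (fun n => by push_cast; ring)
    have S2s := hasSum_mul_pow_shift (v := fun n => n * ((n + 1) * b (n + 3))) S2 (by simp)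
      (fun n => by push_cast; rfl)
    have S2ss := hasSum_mul_pow_shift (v := fun n => (n - 1) * (n * b (n + 2))) S2s (by simp)
      (fun n => by push_cast; ring)
    have E : HasSum (fun n : ℕ => (if n = 0 then ε else if n = 1 then -ε else 0) * s ^ n)
        (ε * (1 - s)) := by
      have : HasSum (fun n : ℕ => (if n = 0 then ε else if n = 1 then -ε else 0) * s ^ n) _ :=
        hasSum_sum_of_ne_finset_zero (s := Finset.range 2)
        (fun n hn => by
          have : 1 < n := by simpa using hn
          simp [show n ≠ 0 by omega, show n ≠ 1 by omega])
      have h2 : (∑ n ∈ Finset.range 2,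
          (if n = 0 then ε else if n = 1 then -ε else 0) * s ^ n) = ε * (1 - s) := by
        simp [Finset.sum_range_succ]
        ring
      rwa [h2] at this
    -- In `s = 1 - r`, with derivatives in `s`, the equation is
    -- `(2 s - s²) y'' + (5 - 5 s - κ (2 s - 3 s² + s³)) y' - κ (1 - 2 s + s²) y - 3 y = ε (1 - s)`.
    have T := ((((((S2s.mul_left 2).sub S2ss).add ((S1.mul_left 5).sub (S1s.mul_left 5))).sub
      (((S1s.mul_left 2).sub (S1ss.mul_left 3)).add S1sss |>.mul_left κ)).sub
      (((S0.sub (S0s.mul_left 2)).add S0ss).mul_left κ)).sub (S0.mul_left 3)).sub E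
    have Z : ∀ n : ℕ, b (n + 3) * ((n + 1) * (2 * n + 5)) =
        (((n : ℝ) ^ 2 + 4 * n + 3 + κ * (2 * n + 1)) * b (n + 2)
        - κ * (3 * n - 1) * b (n + 1) + κ * (n - 1) * b n
        + (if n = 0 then ε else if n = 1 then -ε else 0)) := by
      intro n
      rw [hb, endpointCoeff, div_mul_cancel₀]
      positivity
    have T0 := T.unique (hasSum_zero.congr_fun fun n => by
      have := Z n
      simp only [ha]
      rw [show n + 1 + 2 = n + 3 by ring]
      linear_combination s ^ n * this)
    linear_combination T0

namespace IsRadialSolution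

variable {κ ε ε' : ℝ} {s : Set ℝ} {y y' y'' z z' z'' : ℝ → ℝ}

theorem add_const_mul (hy : IsRadialSolution κ ε s y y' y'') (hz : IsRadialSolution κ ε' s z z' z'')
    (c : ℝ) : IsRadialSolution κ (ε + c * ε') s (fun r => y r + c * z r)
      (fun r => y' r + c * z' r) (fun r => y'' r + c * z'' r) where
  hasDerivAt r hr := (hy.hasDerivAt r hr).add ((hz.hasDerivAt r hr).const_mul c)
  hasDerivAt' r hr := (hy.hasDerivAt' r hr).add ((hz.hasDerivAt' r hr).const_mul c)
  eq r hr := by linear_combination hy.eq r hr + c * hz.eq r hr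

theorem neg_comp_neg (hy : IsRadialSolution κ ε s y y' y'') :
    IsRadialSolution κ ε (-s) (fun r => -y (-r)) (fun r => y' (-r)) (fun r => -y'' (-r)) where
  hasDerivAt r hr := by
    exact ((hy.hasDerivAt (-r) hr).comp r (hasDerivAt_neg r)).neg.congr_deriv (by ring)
  hasDerivAt' r hr := by
    exact ((hy.hasDerivAt' (-r) hr).comp r (hasDerivAt_neg r)).congr_deriv (by ring)
  eq r hr := by linear_combination -hy.eq (-r) hr

theorem congr (hy : IsRadialSolution κ ε s y y' y'') (hs : IsOpen s) (h : EqOn z y s) :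
    IsRadialSolution κ ε s z (deriv z) (deriv (deriv z)) := by
  have h1 : ∀ r ∈ s, z =ᶠ[𝓝 r] y := fun r hr => h.eventuallyEq_of_mem (hs.mem_nhds hr)
  have h2 : ∀ r ∈ s, HasDerivAt z (y' r) r := fun r hr =>
    (hy.hasDerivAt r hr).congr_of_eventuallyEq (h1 r hr)
  have h3 : EqOn (deriv z) y' s := fun r hr => (h2 r hr).deriv
  have h4 : ∀ r ∈ s, HasDerivAt (deriv z) (y'' r) r := fun r hr =>
    (hy.hasDerivAt' r hr).congr_of_eventuallyEq (h3.eventuallyEq_of_mem (hs.mem_nhds hr))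
  refine ⟨fun r hr => (h2 r hr).differentiableAt.hasDerivAt,
    fun r hr => (h4 r hr).differentiableAt.hasDerivAt, fun r hr => ?_⟩
  rw [(h4 r hr).deriv, h3 hr, h hr]
  exact hy.eq r hr

/-- Maximum principle for the radial equation. No condition is imposed at `r = 1`: there the
equation degenerates to a relation between `y` and `y'` which excludes a positive maximum. -/
theorem nonpos {a b : ℝ} (hy : IsRadialSolution κ ε (Ioo a b) y y' y'') (hκ : 0 ≤ κ) (hε : 0 ≤ ε)
    (ha : a < 0) (hb : 1 < b) (h0 : y 0 ≤ 0) : ∀ r ∈ Icc (0 : ℝ) 1, y r ≤ 0 := by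
  intro r₁ hr₁
  by_contra! hpos
  have hsub : Icc (0 : ℝ) 1 ⊆ Ioo a b := fun r hr => ⟨ha.trans_le hr.1, hr.2.trans_lt hb⟩
  have hcont : ContinuousOn y (Icc 0 1) := fun r hr =>
    (hy.hasDerivAt r (hsub hr)).continuousAt.continuousWithinAt
  obtain ⟨r, hr, hmax⟩ := isCompact_Icc.exists_isMaxOn ⟨r₁, hr₁⟩ hcont
  have hyr : 0 < y r := hpos.trans_le (hmax hr₁)
  have hr0 : r ≠ 0 := by rintro rfl; exact absurd h0 hyr.not_ge
  have heq := hy.eq r (hsub hr)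
  rcases hr.2.eq_or_lt with rfl | hr1
  · have h1 : y' 1 < 0 := by nlinarith
    have h2 := (hmax.localize).hasFDerivWithinAt_nonpos
      (hy.hasDerivAt 1 (hsub hr)).hasFDerivAt.hasFDerivWithinAt (y := (-1 : ℝ))
      (mem_posTangentConeAt_of_segment_subset (by
        rw [segment_symm, segment_eq_Icc (by norm_num)]
        exact Icc_subset_Icc (by norm_num) le_rfl))
    simp at h2
    linarith
  · have hr0' : 0 < r := hr.1.lt_of_ne' hr0
    have hlm : IsLocalMax y r := hmax.isLocalMax (Icc_mem_nhds hr0' hr1)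
    have hd0 := hlm.hasDerivAt_eq_zero (hy.hasDerivAt r (hsub hr))
    have hev : deriv y =ᶠ[𝓝 r] y' := by
      filter_upwards [isOpen_Ioo.mem_nhds (hsub hr)] with t ht using (hy.hasDerivAt t ht).deriv
    have hdd : deriv (deriv y) r = y'' r := by
      rw [hev.deriv_eq, (hy.hasDerivAt' r (hsub hr)).deriv]
    have hpos'' : 0 < y'' r := by
      have h1 : 0 < 1 - r ^ 2 := by nlinarith
      have h2 : 0 < (1 - r ^ 2) * y'' r := by
        rw [hd0] at heq
        have : 0 ≤ ε * r := by positivity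
        have : 0 < (κ * r ^ 2 + 3) * y r := by positivity
        linarith
      exact pos_of_mul_pos_right h2 h1.le
    have hmin : IsLocalMin y r := isLocalMin_of_deriv_deriv_pos (by rwa [hdd])
      (by rw [hev.eq_of_nhds, hd0]) (hy.hasDerivAt r (hsub hr)).continuousAt
    have hconst : y =ᶠ[𝓝 r] fun _ => y r := by
      filter_upwards [hlm, hmin] with t h1 h2 using le_antisymm h1 h2
    have h1 : deriv y =ᶠ[𝓝 r] fun _ => 0 := by
      simpa using hconst.deriv
    have h2 := h1.deriv_eq
    simp [hdd] at h2
    linarith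

/-- Uniqueness for the initial value problem at the regular point `r = 0`. -/
theorem eqOn (hy : IsRadialSolution κ ε (Ioo (-1 / 4) (1 / 4)) y y' y'')
    (hz : IsRadialSolution κ ε (Ioo (-1 / 4) (1 / 4)) z z' z'') (hκ : 0 ≤ κ)
    (h0 : y 0 = z 0) (h0' : y' 0 = z' 0) : EqOn y z (Ioo (-1 / 4) (1 / 4)) := by
  set v : ℝ → ℝ × ℝ → ℝ × ℝ := fun t w => (w.2,
    (ε * t - (-5 * t + κ * t * (1 - t ^ 2)) * w.2 + (κ * t ^ 2 + 3) * w.1) / (1 - t ^ 2)) with hv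
  have hlip : ∀ t ∈ Ioo (-1 / 4 : ℝ) (1 / 4),
      LipschitzOnWith (Real.toNNReal (20 + 20 * κ)) (v t) univ := by
    intro t ht
    have ht' : |t| ≤ 1 / 4 := (abs_lt.2 ⟨by linarith [ht.1], ht.2⟩).le
    have ht2 : t ^ 2 ≤ 1 / 16 := by nlinarith [ht.1, ht.2]
    have hden : (15 / 16 : ℝ) ≤ 1 - t ^ 2 := by linarith
    refine LipschitzOnWith.of_dist_le_mul fun p _ q _ => ?_
    rw [Real.coe_toNNReal _ (by positivity), dist_eq_norm, dist_eq_norm]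
    have hp1 : |p.1 - q.1| ≤ ‖p - q‖ := norm_fst_le (p - q)
    have hp2 : |p.2 - q.2| ≤ ‖p - q‖ := norm_snd_le (p - q)
    have hn := norm_nonneg (p - q)
    rw [hv, Prod.norm_def]
    refine max_le ?_ ?_
    · refine hp2.trans ?_
      nlinarith
    · have e : (ε * t - (-5 * t + κ * t * (1 - t ^ 2)) * p.2 + (κ * t ^ 2 + 3) * p.1) / (1 - t ^ 2)
          - (ε * t - (-5 * t + κ * t * (1 - t ^ 2)) * q.2 + (κ * t ^ 2 + 3) * q.1) / (1 - t ^ 2)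
          = (-(-5 * t + κ * t * (1 - t ^ 2)) * (p.2 - q.2) + (κ * t ^ 2 + 3) * (p.1 - q.1))
            / (1 - t ^ 2) := by ring
      simp only [Prod.snd_sub]
      rw [Real.norm_eq_abs, e, abs_div, abs_of_pos (by linarith : 0 < 1 - t ^ 2),
        div_le_iff₀ (by linarith)]
      have c1 : |-(-5 * t + κ * t * (1 - t ^ 2))| ≤ 5 + κ := by
        have : -(-5 * t + κ * t * (1 - t ^ 2)) = t * (5 - κ * (1 - t ^ 2)) := by ring
        rw [this, abs_mul]
        have h5 : |5 - κ * (1 - t ^ 2)| ≤ 5 + κ := abs_le.2 ⟨by nlinarith, by nlinarith⟩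
        nlinarith [abs_nonneg t, abs_nonneg (5 - κ * (1 - t ^ 2))]
      have c2 : |κ * t ^ 2 + 3| ≤ 5 + κ := abs_le.2 ⟨by nlinarith, by nlinarith⟩
      calc |-(-5 * t + κ * t * (1 - t ^ 2)) * (p.2 - q.2) + (κ * t ^ 2 + 3) * (p.1 - q.1)|
          ≤ (5 + κ) * ‖p - q‖ + (5 + κ) * ‖p - q‖ := by
            refine (abs_add_le _ _).trans (add_le_add ?_ ?_) <;> rw [abs_mul] <;> gcongr
        _ ≤ (20 + 20 * κ) * ‖p - q‖ * (15 / 16) := by nlinarith [mul_nonneg hκ hn]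
        _ ≤ (20 + 20 * κ) * ‖p - q‖ * (1 - t ^ 2) := by gcongr
  have hsol : ∀ {y y' y'' : ℝ → ℝ}, IsRadialSolution κ ε (Ioo (-1 / 4) (1 / 4)) y y' y'' →
      ∀ t ∈ Ioo (-1 / 4 : ℝ) (1 / 4),
        HasDerivAt (fun r => (y r, y' r)) (v t (y t, y' t)) t ∧ (y t, y' t) ∈ univ := by
    intro y y' y'' hy t ht
    refine ⟨((hy.hasDerivAt t ht).prodMk (hy.hasDerivAt' t ht)).congr_deriv ?_, mem_univ _⟩
    have hden : 1 - t ^ 2 ≠ 0 := by nlinarith [ht.1, ht.2]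
    rw [hv, Prod.mk.injEq]
    refine ⟨rfl, ?_⟩
    rw [eq_div_iff hden]
    linear_combination hy.eq t ht
  have := ODE_solution_unique_of_mem_Ioo hlip (t₀ := 0) (by norm_num) (hsol hy) (hsol hz)
    (by simp [h0, h0'])
  exact fun t ht => congrArg Prod.fst (this ht)

theorem mono {t : Set ℝ} (hy : IsRadialSolution κ ε s y y' y'') (h : t ⊆ s) :
    IsRadialSolution κ ε t y y' y'' :=
  ⟨fun r hr => hy.hasDerivAt r (h hr), fun r hr => hy.hasDerivAt' r (h hr),
    fun r hr => hy.eq r (h hr)⟩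

end IsRadialSolution

/-- The radial equation has an odd solution that is smooth in a neighbourhood of `[-1, 1]` and
nonpositive on `[0, 1]`. Among the solutions regular at `r = 1` the one vanishing at `r = 0` is
selected, and extended by oddness. -/
theorem exists_odd_isRadialSolution {κ : ℝ} (hκ : 0 ≤ κ) : ∃ h : ℝ → ℝ,
    ContDiffOn ℝ ∞ h (Ioo (-9 / 4) (9 / 4)) ∧
    IsRadialSolution κ 1 (Ioo (-9 / 4) (9 / 4)) h (deriv h) (deriv (deriv h)) ∧
    (∀ r, h (-r) = -h r) ∧ ∀ r ∈ Icc (0 : ℝ) 1, h r ≤ 0 := by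
  obtain ⟨p, p', p'', hpc, -, hp⟩ := exists_isRadialSolution_endpoint κ 1 0
  obtain ⟨z, z', z'', hzc, hz1, hz⟩ := exists_isRadialSolution_endpoint κ 0 1
  have hz0 : z 0 ≠ 0 := fun h => by
    have := hz.nonpos hκ le_rfl (by norm_num) (by norm_num) h.le 1 (by norm_num)
    linarith
  set c := -p 0 / z 0 with hc
  set y := fun r => p r + c * z r with hydef
  have hy : IsRadialSolution κ 1 (Ioo (-1 / 4) (9 / 4)) y
      (fun r => p' r + c * z' r) (fun r => p'' r + c * z'' r) := by
    simpa using hp.add_const_mul hz c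
  have hyc : ContDiffOn ℝ ∞ y (Ioo (-1 / 4) (9 / 4)) := hpc.add (contDiffOn_const.mul hzc)
  have hy0 : y 0 = 0 := by
    simp only [hydef, hc]
    field_simp
    ring
  have hn : IsRadialSolution κ 1 (Ioo (-9 / 4) (1 / 4)) (fun r => -y (-r)) _ _ :=
    hy.neg_comp_neg.mono fun r hr => ⟨by linarith [hr.2], by linarith [hr.1]⟩
  have heq : EqOn y (fun r => -y (-r)) (Ioo (-1 / 4) (1 / 4)) :=
    (hy.mono (Ioo_subset_Ioo le_rfl (by norm_num))).eqOn
      (hn.mono (Ioo_subset_Ioo (by norm_num) le_rfl)) hκ (by simp [hy0]) (by simp)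
  set h : ℝ → ℝ := fun r => if 0 ≤ r then y r else -y (-r) with hh
  have e1 : EqOn h y (Ioo (-1 / 4) (9 / 4)) := fun r hr => by
    by_cases h0 : 0 ≤ r
    · simp [hh, h0]
    · simp only [hh, h0, if_false]
      exact (heq ⟨hr.1, by linarith⟩).symm
  have e2 : EqOn h (fun r => -y (-r)) (Ioo (-9 / 4) (1 / 4)) := fun r hr => by
    by_cases h0 : 0 ≤ r
    · simp only [hh, h0, if_true]
      exact heq ⟨by linarith, hr.2⟩
    · simp [hh, h0]
  have hcover : ∀ r ∈ Ioo (-9 / 4 : ℝ) (9 / 4),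
      r ∈ Ioo (-1 / 4 : ℝ) (9 / 4) ∨ r ∈ Ioo (-9 / 4 : ℝ) (1 / 4) := fun r hr => by
    by_cases h0 : 0 ≤ r
    · exact Or.inl ⟨by linarith, hr.2⟩
    · exact Or.inr ⟨hr.1, by linarith⟩
  have s1 := hy.congr isOpen_Ioo e1
  have s2 := hn.congr isOpen_Ioo e2
  refine ⟨h, fun r hr => ContDiffAt.contDiffWithinAt ?_, ⟨fun r hr => ?_, fun r hr => ?_,
    fun r hr => ?_⟩, fun r => ?_, fun r hr => ?_⟩
  · rcases hcover r hr with h1 | h1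
    · exact ((hyc.congr e1).contDiffAt (isOpen_Ioo.mem_nhds h1))
    · have : ContDiffOn ℝ ∞ (fun r => -y (-r)) (Ioo (-9 / 4) (1 / 4)) :=
        (hyc.comp contDiff_neg.contDiffOn fun r hr =>
          ⟨by linarith [hr.2], by linarith [hr.1]⟩).neg
      exact ((this.congr e2).contDiffAt (isOpen_Ioo.mem_nhds h1))
  · exact (hcover r hr).elim (s1.hasDerivAt r) (s2.hasDerivAt r)
  · exact (hcover r hr).elim (s1.hasDerivAt' r) (s2.hasDerivAt' r)
  · exact (hcover r hr).elim (s1.eq r) (s2.eq r)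
  · rcases lt_trichotomy r 0 with h1 | rfl | h1
    · simp [hh, h1.not_ge, h1.le]
    · simp [hh, hy0]
    · simp [hh, h1.not_ge, h1.le]
  · rw [show h r = y r by simp [hh, hr.1]]
    exact hy.nonpos hκ zero_le_one (by norm_num) (by norm_num) hy0.le r hr

/-! ### Weak derivatives on an interval -/

theorem IsTestFun.exists_tsupport_subset {φ : ℝ → ℝ} (hφ : IsTestFun φ) :
    ∃ a b : ℝ, -1 < a ∧ a < b ∧ b < 1 ∧ tsupport φ ⊆ Ioo a b := by
  obtain ⟨-, hc, hs⟩ := hφ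
  rcases (tsupport φ).eq_empty_or_nonempty with h | h
  · exact ⟨-1 / 2, 1 / 2, by norm_num, by norm_num, by norm_num, by simp [h]⟩
  · have hc' : IsCompact (tsupport φ) := hc
    obtain ⟨x, hx, hxm⟩ := hc'.exists_isLeast h
    obtain ⟨y, hy, hym⟩ := hc'.exists_isGreatest h
    obtain ⟨a, ha1, ha2⟩ := exists_between (hs hx).1
    obtain ⟨b, hb1, hb2⟩ := exists_between (hs hy).2
    exact ⟨a, b, ha1, (ha2.trans_le (hxm hy)).trans hb1, hb2, fun z hz =>
      ⟨ha2.trans_le (hxm hz), (hym hz).trans_lt hb1⟩⟩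

theorem setIntegral_eq_intervalIntegral_of_support {f : ℝ → ℝ} {a b : ℝ} (ha : -1 < a) (hab : a < b)
    (hb : b < 1) (hf : ∀ x, x ∉ Ioo a b → f x = 0) :
    ∫ x in Ioo (-1 : ℝ) 1, f x = ∫ x in a..b, f x := by
  rw [intervalIntegral.integral_of_le hab.le, integral_Ioc_eq_integral_Ioo]
  exact (setIntegral_eq_of_subset_of_forall_sdiff_eq_zero measurableSet_Ioo
    (Ioo_subset_Ioo ha.le hb.le) fun x hx => hf x hx.2)

theorem IsTestFun.deriv_eq_zero {φ : ℝ → ℝ} {a b x : ℝ} (h : tsupport φ ⊆ Ioo a b)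
    (hx : x ∉ Ioo a b) : deriv φ x = 0 :=
  image_eq_zero_of_notMem_tsupport fun hx' => hx (h (tsupport_deriv_subset (𝕜 := ℝ) hx'))

theorem IsTestFun.eq_zero {φ : ℝ → ℝ} {a b x : ℝ} (h : tsupport φ ⊆ Ioo a b)
    (hx : x ∉ Ioo a b) : φ x = 0 :=
  image_eq_zero_of_notMem_tsupport fun hx' => hx (h hx')

theorem hasWeakDeriv_of_hasDerivAt {u u' : ℝ → ℝ}
    (h : ∀ r ∈ Ioo (-1 : ℝ) 1, HasDerivAt u (u' r) r) (hc : ContinuousOn u' (Ioo (-1) 1)) :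
    HasWeakDeriv u u' := by
  have hu : ContinuousOn u (Ioo (-1) 1) := fun r hr => (h r hr).continuousAt.continuousWithinAt
  refine ⟨hu.locallyIntegrableOn measurableSet_Ioo, hc.locallyIntegrableOn measurableSet_Ioo,
    fun φ hφ => ?_⟩
  obtain ⟨a, b, ha, hab, hb, hs⟩ := hφ.exists_tsupport_subset
  have hsub : uIcc a b ⊆ Ioo (-1) 1 := by
    rw [uIcc_of_le hab.le]; exact Icc_subset_Ioo ha hb
  rw [setIntegral_eq_intervalIntegral_of_support ha hab hb fun x hx => by
      rw [IsTestFun.deriv_eq_zero hs hx, mul_zero],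
    setIntegral_eq_intervalIntegral_of_support ha hab hb fun x hx => by
      rw [IsTestFun.eq_zero hs hx, mul_zero],
    intervalIntegral.integral_mul_deriv_eq_deriv_mul (fun x hx => h x (hsub hx))
      (fun x _ => (hφ.1.differentiable (by simp) x).hasDerivAt)
      (hc.mono hsub).intervalIntegrable
      (hφ.1.continuous_deriv (by simp)).continuousOn.intervalIntegrable,
    IsTestFun.eq_zero hs left_notMem_Ioo, IsTestFun.eq_zero hs right_notMem_Ioo]
  simp

theorem intervalIntegrable_of_locallyIntegrableOn {v : ℝ → ℝ}
    (hv : LocallyIntegrableOn v (Ioo (-1) 1)) {a b : ℝ} (ha : a ∈ Ioo (-1 : ℝ) 1)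
    (hb : b ∈ Ioo (-1 : ℝ) 1) : IntervalIntegrable v volume a b := by
  rw [intervalIntegrable_iff']
  exact hv.integrableOn_compact_subset (ordConnected_Ioo.uIcc_subset ha hb) isCompact_uIcc

/-- Integration by parts against test functions for a primitive of a locally integrable
function. -/
theorem integral_primitive_mul_deriv {v φ : ℝ → ℝ} (hv : LocallyIntegrableOn v (Ioo (-1) 1))
    (hφ : IsTestFun φ) :
    ∫ r in Ioo (-1 : ℝ) 1, (∫ t in (0 : ℝ)..r, v t) * deriv φ r
      = -∫ r in Ioo (-1 : ℝ) 1, v r * φ r := by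
  obtain ⟨a, b, ha, hab, hb, hs⟩ := hφ.exists_tsupport_subset
  have ha' : a ∈ Ioo (-1 : ℝ) 1 := ⟨ha, hab.trans hb⟩
  have hb' : b ∈ Ioo (-1 : ℝ) 1 := ⟨ha.trans hab, hb⟩
  have h0 : (0 : ℝ) ∈ Ioo (-1 : ℝ) 1 := by norm_num
  rw [setIntegral_eq_intervalIntegral_of_support ha hab hb fun x hx => by
      rw [IsTestFun.deriv_eq_zero hs hx, mul_zero],
    setIntegral_eq_intervalIntegral_of_support ha hab hb fun x hx => by
      rw [IsTestFun.eq_zero hs hx, mul_zero]]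
  have hvi := intervalIntegrable_of_locallyIntegrableOn hv ha' hb'
  have hac : AbsolutelyContinuousOnInterval (fun r => ∫ t in a..r, v t) a b :=
    hvi.absolutelyContinuousOnInterval_intervalIntegral (by simp)
  have hφac : AbsolutelyContinuousOnInterval φ a b :=
    (hφ.1.of_le (by simp)).contDiffOn.absolutelyContinuousOnInterval
  have key := hac.integral_mul_deriv_eq_deriv_mul hφac
  rw [IsTestFun.eq_zero hs left_notMem_Ioo, IsTestFun.eq_zero hs right_notMem_Ioo] at key
  have h1 : ∫ r in a..b, (∫ t in (0 : ℝ)..r, v t) * deriv φ r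
      = ∫ r in a..b, ((∫ t in a..r, v t) * deriv φ r + (∫ t in (0 : ℝ)..a, v t) * deriv φ r) := by
    refine intervalIntegral.integral_congr fun r hr => ?_
    have hr' : r ∈ Ioo (-1 : ℝ) 1 := ordConnected_Ioo.uIcc_subset ha' hb' hr
    rw [← intervalIntegral.integral_add_adjacent_intervals
      (intervalIntegrable_of_locallyIntegrableOn hv h0 ha')
      (intervalIntegrable_of_locallyIntegrableOn hv ha' hr')]
    ring
  have hφ' : IntervalIntegrable (deriv φ) volume a b :=
    (hφ.1.continuous_deriv (by simp)).continuousOn.intervalIntegrable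
  have h2 : ∫ r in a..b, deriv φ r = 0 := by
    rw [intervalIntegral.integral_deriv_eq_sub
      (fun x _ => hφ.1.differentiable (by simp) x) hφ',
      IsTestFun.eq_zero hs left_notMem_Ioo, IsTestFun.eq_zero hs right_notMem_Ioo, sub_zero]
  rw [h1, intervalIntegral.integral_add (hφ'.continuousOn_mul hac.continuousOn)
    (hφ'.const_mul _), intervalIntegral.integral_const_mul, h2, key]
  simp only [mul_zero, sub_zero, zero_sub, add_zero, neg_inj]
  refine intervalIntegral.integral_congr_ae ?_
  filter_upwards [hvi.ae_hasDerivAt_integral] with x hx hx'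
  rw [(hx (uIoc_subset_uIcc hx') a (by simp)).deriv]

theorem IsTestFun.integrableOn_mul {φ w : ℝ → ℝ} (hφ : IsTestFun φ)
    (hw : LocallyIntegrableOn w (Ioo (-1) 1)) :
    IntegrableOn (fun r => w r * φ r) (Ioo (-1) 1) := by
  obtain ⟨a, b, ha, hab, hb, hs⟩ := hφ.exists_tsupport_subset
  have h1 : IntegrableOn (fun r => w r * φ r) (Icc a b) :=
    (hw.integrableOn_compact_subset (Icc_subset_Ioo ha hb) isCompact_Icc).mul_continuousOn
      hφ.1.continuous.continuousOn isCompact_Icc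
  refine (integrableOn_iff_integrable_of_support_subset ?_).1 h1 |>.integrableOn
  intro x hx
  by_contra hx'
  exact hx (by simp [IsTestFun.eq_zero hs fun h => hx' (Ioo_subset_Icc_self h)])

theorem IsTestFun.deriv {φ : ℝ → ℝ} (hφ : IsTestFun φ) : IsTestFun (deriv φ) :=
  ⟨(contDiff_infty_iff_deriv.1 hφ.1).2, hφ.2.1.deriv,
    (tsupport_deriv_subset (𝕜 := ℝ)).trans hφ.2.2⟩

theorem IsTestFun.integrableOn_mul_deriv {φ w : ℝ → ℝ} (hφ : IsTestFun φ)
    (hw : LocallyIntegrableOn w (Ioo (-1) 1)) :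
    IntegrableOn (fun r => w r * _root_.deriv φ r) (Ioo (-1) 1) :=
  hφ.deriv.integrableOn_mul hw

/-- The lemma of du Bois-Reymond. -/
theorem ae_eq_const_of_integral_mul_deriv_eq_zero {u : ℝ → ℝ}
    (hu : LocallyIntegrableOn u (Ioo (-1) 1))
    (h : ∀ φ, IsTestFun φ → ∫ r in Ioo (-1 : ℝ) 1, u r * deriv φ r = 0) :
    ∃ c, u =ᵐ[volume.restrict (Ioo (-1) 1)] fun _ => c := by
  let B : ContDiffBump (0 : ℝ) := ⟨1 / 4, 1 / 2, by norm_num, by norm_num⟩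
  set φ₀ : ℝ → ℝ := B.normed volume with hφ₀
  have hφ₀t : IsTestFun φ₀ := by
    refine ⟨B.contDiff_normed, B.hasCompactSupport_normed, ?_⟩
    rw [B.tsupport_normed_eq, Real.closedBall_eq_Icc]
    exact Icc_subset_Ioo (by norm_num) (by norm_num)
  have hint : ∀ {η : ℝ → ℝ}, IsTestFun η → Integrable η := fun hη =>
    hη.1.continuous.integrable_of_hasCompactSupport hη.2.1
  have huint : ∀ {η : ℝ → ℝ}, IsTestFun η → IntegrableOn (fun r => u r * η r) (Ioo (-1) 1) :=
    fun hη => hη.integrableOn_mul hu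
  set c := ∫ r in Ioo (-1 : ℝ) 1, u r * φ₀ r with hc
  refine ⟨c, ?_⟩
  have key : ∀ η, IsTestFun η → ∫ r in Ioo (-1 : ℝ) 1, u r * η r = (∫ r, η r) * c := by
    intro η hη
    obtain ⟨a, b, ha, hab, hb, hs⟩ := hη.exists_tsupport_subset
    obtain ⟨a₀, b₀, ha₀, hab₀, hb₀, hs₀⟩ := hφ₀t.exists_tsupport_subset
    -- `χ` has integral zero, so it is the derivative of a test function.
    set χ : ℝ → ℝ := fun r => η r - (∫ r, η r) * φ₀ r with hχ
    have hχc : ContDiff ℝ ∞ χ := hη.1.sub (contDiff_const.mul hφ₀t.1)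
    have hχ0 : ∫ r, χ r = 0 := by
      rw [hχ, integral_sub (hint hη) ((hint hφ₀t).const_mul _), integral_const_mul,
        B.integral_normed]
      ring
    have hχs : ∀ x, x ∉ Ioo (min a a₀) (max b b₀) → χ x = 0 := by
      intro x hx
      have h1 : x ∉ Ioo a b := fun h => hx ⟨(min_le_left _ _).trans_lt h.1,
        h.2.trans_le (le_max_left _ _)⟩
      have h2 : x ∉ Ioo a₀ b₀ := fun h => hx ⟨(min_le_right _ _).trans_lt h.1,
        h.2.trans_le (le_max_right _ _)⟩
      simp [hχ, IsTestFun.eq_zero hs h1, IsTestFun.eq_zero hs₀ h2]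
    have hA : -1 < min a a₀ := lt_min ha ha₀
    have hB : max b b₀ < 1 := max_lt hb hb₀
    have hAB : min a a₀ < max b b₀ := (min_le_left _ _).trans_lt (hab.trans_le (le_max_left _ _))
    set A := min a a₀
    set Bm := max b b₀
    set φ : ℝ → ℝ := fun x => ∫ t in A..x, χ t with hφ
    have hd : ∀ x, HasDerivAt φ (χ x) x := fun x =>
      intervalIntegral.integral_hasDerivAt_right (hχc.continuous.intervalIntegrable _ _)
        (hχc.continuous.stronglyMeasurableAtFilter _ _) hχc.continuous.continuousAt
    have hderiv : deriv φ = χ := funext fun x => (hd x).deriv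
    have htot : ∫ t in A..Bm, χ t = 0 := by
      rw [← setIntegral_eq_intervalIntegral_of_support hA hAB hB hχs,
        setIntegral_eq_integral_of_forall_compl_eq_zero fun x hx => hχs x fun h =>
          hx (mem_Ioo.2 ⟨hA.trans h.1, h.2.trans hB⟩)]
      exact hχ0
    have hzero : ∀ x, x ∉ Icc A Bm → φ x = 0 := by
      intro x hx
      rcases lt_or_ge x A with h1 | h1
      · refine intervalIntegral.integral_zero_ae (ae_of_all _ fun t ht => hχs t fun h => ?_)
        rw [uIoc_of_ge h1.le] at ht
        exact absurd ht.2 h.1.not_ge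
      · have h2 : Bm < x := by by_contra h; exact hx ⟨h1, not_lt.1 h⟩
        rw [hφ]
        simp only
        rw [← intervalIntegral.integral_add_adjacent_intervals
          (hχc.continuous.intervalIntegrable A Bm) (hχc.continuous.intervalIntegrable Bm x), htot,
          zero_add]
        refine intervalIntegral.integral_zero_ae (ae_of_all _ fun t ht => hχs t fun h => ?_)
        rw [uIoc_of_le h2.le] at ht
        exact absurd ht.1 h.2.not_gt
    have hφt : IsTestFun φ := by
      have hts : tsupport φ ⊆ Icc A Bm := closure_minimal (fun x hx => by
        by_contra h; exact hx (hzero x h)) isClosed_Icc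
      refine ⟨?_, HasCompactSupport.of_support_subset_isCompact isCompact_Icc
        (subset_tsupport _ |>.trans hts), hts.trans (Icc_subset_Ioo hA hB)⟩
      rw [contDiff_infty_iff_deriv, hderiv]
      exact ⟨fun x => (hd x).differentiableAt, hχc⟩
    have h1 := h φ hφt
    rw [hderiv] at h1
    have h2 : ∀ r, u r * χ r = u r * η r - (∫ r, η r) * (u r * φ₀ r) := fun r => by
      rw [hχ]; ring
    simp_rw [h2] at h1
    rw [integral_sub (huint hη) ((huint hφ₀t).const_mul _), integral_const_mul] at h1
    linarith
  have := isOpen_Ioo.ae_eq_zero_of_integral_contDiff_smul_eq_zero (μ := volume)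
    (f := fun r => u r - c) (hu.sub (continuousOn_const.locallyIntegrableOn measurableSet_Ioo))
    (fun η h1 h2 h3 => by
      have hη : IsTestFun η := ⟨h1, h2, h3⟩
      have e : ∫ r, η r • (u r - c) = ∫ r in Ioo (-1 : ℝ) 1, (u r * η r - c * η r) := by
        rw [← setIntegral_eq_integral_of_forall_compl_eq_zero (s := Ioo (-1 : ℝ) 1) fun x hx => by
          rw [image_eq_zero_of_notMem_tsupport fun h => hx (h3 h), zero_smul]]
        refine integral_congr_ae (ae_of_all _ fun r => ?_)
        simp only [smul_eq_mul]
        ring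
      rw [e, integral_sub (huint hη) ((hint hη).integrableOn.const_mul _), key η hη,
        integral_const_mul, setIntegral_eq_integral_of_forall_compl_eq_zero fun x hx =>
          image_eq_zero_of_notMem_tsupport fun h => hx (h3 h)]
      ring)
  filter_upwards [ae_restrict_of_ae this, ae_restrict_mem measurableSet_Ioo] with x h1 h2
  linarith [h1 h2]

theorem continuousOn_primitive_of_locallyIntegrableOn {v : ℝ → ℝ}
    (hv : LocallyIntegrableOn v (Ioo (-1) 1)) :
    ContinuousOn (fun r => ∫ t in (0 : ℝ)..r, v t) (Ioo (-1) 1) := by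
  have h0 : (0 : ℝ) ∈ Ioo (-1 : ℝ) 1 := by norm_num
  intro r hr
  obtain ⟨a, ha1, ha2⟩ := exists_between (lt_min hr.1 h0.1)
  obtain ⟨b, hb1, hb2⟩ := exists_between (max_lt hr.2 h0.2)
  have h1 : a < r := ha2.trans_le (min_le_left _ _)
  have h2 : a < 0 := ha2.trans_le (min_le_right _ _)
  have h3 : r < b := (le_max_left _ _).trans_lt hb1
  have h4 : 0 < b := (le_max_right _ _).trans_lt hb1
  have hi := intervalIntegrable_of_locallyIntegrableOn hv (a := a) (b := b)
    ⟨ha1, h2.trans h0.2⟩ ⟨h0.1.trans h4, hb2⟩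
  have := hi.absolutelyContinuousOnInterval_intervalIntegral (c := 0)
    (by rw [uIcc_of_le (h2.trans h4).le]; exact ⟨h2.le, h4.le⟩)
  refine (this.continuousOn.continuousAt ?_).continuousWithinAt
  rw [uIcc_of_le (h2.trans h4).le]
  exact Icc_mem_nhds h1 h3

/-- A function with a weak derivative is almost everywhere a primitive of it. -/
theorem HasWeakDeriv.ae_eq_primitive {u v : ℝ → ℝ} (h : HasWeakDeriv u v) :
    ∃ c, u =ᵐ[volume.restrict (Ioo (-1) 1)] fun r => c + ∫ t in (0 : ℝ)..r, v t := by
  obtain ⟨hu, hv, hp⟩ := h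
  have hc := continuousOn_primitive_of_locallyIntegrableOn hv
  have hcl := hc.locallyIntegrableOn (μ := volume) measurableSet_Ioo
  obtain ⟨c, hc'⟩ := ae_eq_const_of_integral_mul_deriv_eq_zero (hu.sub hcl) (fun φ hφ => by
    simp only [Pi.sub_apply, sub_mul]
    rw [integral_sub (hφ.integrableOn_mul_deriv hu) (hφ.integrableOn_mul_deriv hcl), hp φ hφ,
      integral_primitive_mul_deriv hv hφ, sub_self])
  refine ⟨c, ?_⟩
  filter_upwards [hc'] with r hr
  simp only [Pi.sub_apply] at hr
  linarith

theorem hasDerivAt_primitive_of_ae_eq {v w : ℝ → ℝ} (hw : ContinuousOn w (Ioo (-1) 1))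
    (h : v =ᵐ[volume.restrict (Ioo (-1) 1)] w) (c : ℝ) {r : ℝ} (hr : r ∈ Ioo (-1 : ℝ) 1) :
    HasDerivAt (fun r => c + ∫ t in (0 : ℝ)..r, v t) (w r) r := by
  have h0 : (0 : ℝ) ∈ Ioo (-1 : ℝ) 1 := by norm_num
  have e : ∀ x ∈ Ioo (-1 : ℝ) 1, ∫ t in (0 : ℝ)..x, v t = ∫ t in (0 : ℝ)..x, w t := by
    intro x hx
    refine intervalIntegral.integral_congr_ae_restrict ?_
    exact ae_restrict_of_ae_restrict_of_subset
      (uIoc_subset_uIcc.trans (ordConnected_Ioo.uIcc_subset h0 hx)) h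
  have h1 : HasDerivAt (fun r => ∫ t in (0 : ℝ)..r, w t) (w r) r :=
    intervalIntegral.integral_hasDerivAt_right
      (hw.mono (ordConnected_Ioo.uIcc_subset h0 hr)).intervalIntegrable
      (hw.stronglyMeasurableAtFilter isOpen_Ioo r hr)
      (hw.continuousAt (isOpen_Ioo.mem_nhds hr))
  refine (h1.congr_of_eventuallyEq ?_).const_add c
  filter_upwards [isOpen_Ioo.mem_nhds hr] with x hx using e x hx

theorem HasWeakDeriv.ae_eq {u v v' : ℝ → ℝ} (h : HasWeakDeriv u v) (h' : HasWeakDeriv u v') :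
    v =ᵐ[volume.restrict (Ioo (-1) 1)] v' := by
  have := isOpen_Ioo.ae_eq_zero_of_integral_contDiff_smul_eq_zero (μ := volume)
    (h.2.1.sub h'.2.1) fun φ hφ hφc hφs => by
      have ht : IsTestFun φ := ⟨hφ, hφc, hφs⟩
      have e : ∫ r in Ioo (-1 : ℝ) 1, (v - v') r * φ r = 0 := by
        simp only [Pi.sub_apply, sub_mul]
        rw [integral_sub (ht.integrableOn_mul h.2.1) (ht.integrableOn_mul h'.2.1), sub_eq_zero,
          ← neg_inj, ← h.2.2 φ ht, h'.2.2 φ ht]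
      rw [← setIntegral_eq_integral_of_forall_compl_eq_zero (s := Ioo (-1) 1), ← e]
      · exact integral_congr_ae (ae_of_all _ fun r => mul_comm _ _)
      · intro r hr
        rw [IsTestFun.eq_zero hφs hr, zero_smul]
  rw [EventuallyEq, ae_restrict_iff' measurableSet_Ioo]
  filter_upwards [this] with r hr hr'
  exact sub_eq_zero.1 (hr hr')

/-! ### The radial equation in divergence form -/

theorem continuous_weight {d a : ℝ} (ha : 0 ≤ a) : Continuous (weight d a) := by
  unfold weight
  exact ((continuous_const.sub (continuous_id.pow 2)).rpow_const fun _ => Or.inr ha).mul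
    (Real.continuous_exp.comp (by fun_prop))

theorem one_sub_sq_pos {r : ℝ} (hr : r ∈ Ioo (-1 : ℝ) 1) : 0 < 1 - r ^ 2 := by
  nlinarith [hr.1, hr.2]

theorem weight_pos {d a r : ℝ} (hr : r ∈ Ioo (-1 : ℝ) 1) : 0 < weight d a r :=
  mul_pos (Real.rpow_pos_of_pos (one_sub_sq_pos hr) _) (Real.exp_pos _)

theorem weight_five_halves {d r : ℝ} (hr : r ∈ Ioo (-1 : ℝ) 1) :
    weight d (5 / 2) r = (1 - r ^ 2) * weight d (3 / 2) r := by
  have h := one_sub_sq_pos hr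
  rw [weight, weight, show (5 / 2 : ℝ) = 1 + 3 / 2 by norm_num, Real.rpow_add h, Real.rpow_one]
  ring

theorem hasDerivAt_weight {d r : ℝ} (hr : r ∈ Ioo (-1 : ℝ) 1) :
    HasDerivAt (weight d (5 / 2))
      (weight d (3 / 2) r * (-5 * r + 4 / d * r * (1 - r ^ 2))) r := by
  have h := one_sub_sq_pos hr
  have h1 : HasDerivAt (fun r : ℝ => 1 - r ^ 2) (-(2 * r)) r := by
    simpa using ((hasDerivAt_id r).pow 2).const_sub 1
  have h2 := h1.rpow_const (p := 5 / 2) (Or.inl h.ne')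
  have h3 : HasDerivAt (fun r : ℝ => 2 * r ^ 2 / d) (4 / d * r) r := by
    refine ((((hasDerivAt_id r).pow 2).const_mul 2).div_const d).congr_deriv ?_
    simp
    ring
  refine (h2.mul h3.exp).congr_deriv ?_
  rw [weight, show (5 / 2 : ℝ) = 1 + 3 / 2 by norm_num, Real.rpow_add h, Real.rpow_one,
    show (1 + 3 / 2 - 1 : ℝ) = 3 / 2 by norm_num]
  ring

theorem IsRadialSolution.hasDerivAt_flux {d ε : ℝ} {s : Set ℝ} {y y' y'' : ℝ → ℝ}
    (hy : IsRadialSolution (4 / d) ε s y y' y'') {r : ℝ} (hrs : r ∈ s)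
    (hr : r ∈ Ioo (-1 : ℝ) 1) :
    HasDerivAt (fun r => weight d (5 / 2) r * y' r)
      (weight d (3 / 2) r * (4 / d * r ^ 2 + 3) * y r + ε * r * weight d (3 / 2) r) r := by
  refine ((hasDerivAt_weight hr).mul (hy.hasDerivAt' r hrs)).congr_deriv ?_
  rw [weight_five_halves hr]
  linear_combination weight d (3 / 2) r * hy.eq r hrs

theorem integrableOn_Ioo_of_continuousOn {f : ℝ → ℝ} (hf : ContinuousOn f (Icc (-1) 1)) :
    IntegrableOn f (Ioo (-1) 1) :=
  (hf.integrableOn_compact isCompact_Icc).mono_set Ioo_subset_Icc_self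

theorem Icc_subset_Ioo_nine_fourths : Icc (-1 : ℝ) 1 ⊆ Ioo (-9 / 4) (9 / 4) :=
  Icc_subset_Ioo (by norm_num) (by norm_num)

theorem memWeighted_of_isRadialSolution {d : ℝ} {h : ℝ → ℝ}
    (hs : IsRadialSolution (4 / d) 1 (Ioo (-9 / 4) (9 / 4)) h (deriv h) (deriv (deriv h))) :
    MemWeighted h (deriv h) := by
  have hc : ContinuousOn h (Icc (-1) 1) := fun r hr =>
    (hs.hasDerivAt r (Icc_subset_Ioo_nine_fourths hr)).continuousAt.continuousWithinAt
  have hc' : ContinuousOn (deriv h) (Icc (-1) 1) := fun r hr =>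
    (hs.hasDerivAt' r (Icc_subset_Ioo_nine_fourths hr)).continuousAt.continuousWithinAt
  have hw : ∀ a : ℝ, 0 ≤ a → Continuous fun r : ℝ => (1 - r ^ 2) ^ a := fun a ha =>
    (continuous_const.sub (continuous_id.pow 2)).rpow_const fun _ => Or.inr ha
  refine ⟨hasWeakDeriv_of_hasDerivAt (fun r hr =>
      hs.hasDerivAt r (Icc_subset_Ioo_nine_fourths (Ioo_subset_Icc_self hr)))
    (hc'.mono Ioo_subset_Icc_self), ?_, ?_⟩
  · exact integrableOn_Ioo_of_continuousOn ((hw _ (by norm_num)).continuousOn.mul (hc.pow 2))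
  · exact integrableOn_Ioo_of_continuousOn ((hw _ (by norm_num)).continuousOn.mul (hc'.pow 2))

theorem isODESolution_of_isRadialSolution {d : ℝ} {h : ℝ → ℝ}
    (hs : IsRadialSolution (4 / d) 1 (Ioo (-9 / 4) (9 / 4)) h (deriv h) (deriv (deriv h)))
    (hsm : ContDiffOn ℝ ∞ h (Ioo (-9 / 4) (9 / 4))) :
    IsODESolution d h := by
  have hsub : Ioo (-1 : ℝ) 1 ⊆ Ioo (-9 / 4) (9 / 4) :=
    Ioo_subset_Icc_self.trans Icc_subset_Ioo_nine_fourths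
  refine ⟨contDiffOn_infty.1 (hsm.mono hsub) 2,
    ⟨_, memWeighted_of_isRadialSolution hs⟩, fun r hr => ?_⟩
  rw [(hs.hasDerivAt_flux (hsub hr) hr).deriv]
  ring

/-! ### Uniqueness in the weighted space -/

/-- For a solution `(V, P)` of the homogeneous first order system `V' = P / w₅`,
`P' = w₃ (4 r² / d + 3) V` of finite energy, the nondecreasing function `P V` is nonpositive:
otherwise it would be bounded below by some `c > 0` and above near `r = 1`, so that
`V² = O((1 - r)^(-3/2))`, and `P² / w₅ ≥ c² / (w₅ V²)` would not be integrable near `r = 1`. -/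
theorem flux_mul_nonpos {d : ℝ} (hd : 0 < d) {V P : ℝ → ℝ}
    (hV : ∀ r ∈ Ioo (-1 : ℝ) 1, HasDerivAt V (P r / weight d (5 / 2) r) r)
    (hP : ∀ r ∈ Ioo (-1 : ℝ) 1,
      HasDerivAt P (weight d (3 / 2) r * (4 / d * r ^ 2 + 3) * V r) r)
    (hi : IntegrableOn (fun r => P r ^ 2 / weight d (5 / 2) r
      + weight d (3 / 2) r * (4 / d * r ^ 2 + 3) * V r ^ 2) (Ioo (-1) 1)) :
    ∀ r ∈ Ioo (-1 : ℝ) 1, P r * V r ≤ 0 := by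
  intro r₀ hr₀
  by_contra! hpos
  set F : ℝ → ℝ := fun r => P r * V r with hF
  set F' : ℝ → ℝ := fun r => P r ^ 2 / weight d (5 / 2) r
      + weight d (3 / 2) r * (4 / d * r ^ 2 + 3) * V r ^ 2 with hF'
  have hFd : ∀ r ∈ Ioo (-1 : ℝ) 1, HasDerivAt F (F' r) r := fun r hr =>
    ((hP r hr).mul (hV r hr)).congr_deriv (by rw [hF']; ring)
  have hterm1 : ∀ r ∈ Ioo (-1 : ℝ) 1, 0 ≤ P r ^ 2 / weight d (5 / 2) r := fun r hr =>
    div_nonneg (sq_nonneg _) (weight_pos hr).le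
  have hterm2 : ∀ r ∈ Ioo (-1 : ℝ) 1,
      0 ≤ weight d (3 / 2) r * (4 / d * r ^ 2 + 3) * V r ^ 2 := fun r hr => by
    have := (weight_pos (d := d) (a := 3 / 2) hr).le
    positivity
  have hF'0 : ∀ r ∈ Ioo (-1 : ℝ) 1, 0 ≤ F' r := fun r hr => add_nonneg (hterm1 r hr) (hterm2 r hr)
  set r₁ := max r₀ 0 with hr₁
  have hr₁0 : 0 ≤ r₁ := le_max_right _ _
  have hr₁1 : r₁ < 1 := max_lt hr₀.2 one_pos
  have hmem : ∀ r ∈ Ico r₁ 1, r ∈ Ioo (-1 : ℝ) 1 := fun r hr => ⟨by linarith [hr.1], hr.2⟩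
  have hmono : MonotoneOn F (Ioo (-1) 1) :=
    monotoneOn_of_hasDerivWithinAt_nonneg (convex_Ioo _ _)
      (fun r hr => (hFd r hr).continuousAt.continuousWithinAt)
      (fun r hr => (hFd r (interior_subset hr)).hasDerivWithinAt)
      (fun r hr => hF'0 r (interior_subset hr))
  set c := F r₁ with hc
  have hc0 : 0 < c := hpos.trans_le (hmono hr₀ (hmem r₁ ⟨le_rfl, hr₁1⟩) (le_max_left _ _))
  have hlow : ∀ r ∈ Ico r₁ 1, c ≤ F r := fun r hr =>
    hmono (hmem r₁ ⟨le_rfl, hr₁1⟩) (hmem r hr) hr.1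
  -- `F'` is the energy density, so finite energy bounds `F` from above.
  set B := c + ∫ r in Ioo (-1 : ℝ) 1, F' r with hB
  have hup : ∀ r ∈ Ico r₁ 1, F r ≤ B := by
    intro r hr
    have hsub : Icc r₁ r ⊆ Ioo (-1) 1 := fun x hx => ⟨by linarith [hx.1], hx.2.trans_lt hr.2⟩
    have h1 : ∫ x in r₁..r, F' x = F r - F r₁ :=
      intervalIntegral.integral_eq_sub_of_hasDerivAt
        (fun x hx => hFd x (hsub (by rwa [uIcc_of_le hr.1] at hx)))
        (by rw [intervalIntegrable_iff', uIcc_of_le hr.1]; exact hi.mono_set hsub)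
    rw [intervalIntegral.integral_of_le hr.1] at h1
    have h2 : ∫ x in Ioc r₁ r, F' x ≤ ∫ x in Ioo (-1 : ℝ) 1, F' x :=
      setIntegral_mono_set hi ((ae_restrict_mem measurableSet_Ioo).mono fun x hx => hF'0 x hx)
        (Ioc_subset_Icc_self.trans hsub).eventuallyLE
    linarith
  have hB0 : 0 < B := hc0.trans_le ((hlow r₁ ⟨le_rfl, hr₁1⟩).trans (hup r₁ ⟨le_rfl, hr₁1⟩))
  -- two-sided bounds on the weight near `r = 1`
  have hwlow : ∀ r ∈ Ico r₁ 1, (1 - r) ^ (5 / 2 : ℝ) ≤ weight d (5 / 2) r := by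
    intro r hr
    have h0 : 0 ≤ r := hr₁0.trans hr.1
    have h1 : 1 - r ≤ 1 - r ^ 2 := by nlinarith [hr.2]
    have h2 : (1 - r) ^ (5 / 2 : ℝ) ≤ (1 - r ^ 2) ^ (5 / 2 : ℝ) :=
      Real.rpow_le_rpow (by linarith [hr.2]) h1 (by norm_num)
    have h3 : 1 ≤ Real.exp (2 * r ^ 2 / d) := Real.one_le_exp (by positivity)
    have h4 : 0 ≤ (1 - r ^ 2) ^ (5 / 2 : ℝ) := Real.rpow_nonneg (by nlinarith [hr.2]) _
    unfold weight
    nlinarith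
  set K := (2 : ℝ) ^ (5 / 2 : ℝ) * Real.exp (2 / d) with hK
  have hK0 : 0 < K := by positivity
  have hwup : ∀ r ∈ Ico r₁ 1, weight d (5 / 2) r ≤ K * (1 - r) ^ (5 / 2 : ℝ) := by
    intro r hr
    have h0 : 0 ≤ r := hr₁0.trans hr.1
    have h1 : 1 - r ^ 2 ≤ 2 * (1 - r) := by nlinarith [hr.2]
    have h2 : (1 - r ^ 2) ^ (5 / 2 : ℝ) ≤ 2 ^ (5 / 2 : ℝ) * (1 - r) ^ (5 / 2 : ℝ) := by
      rw [← Real.mul_rpow (by norm_num) (by linarith [hr.2])]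
      exact Real.rpow_le_rpow (by nlinarith [hr.2]) h1 (by norm_num)
    have h3 : Real.exp (2 * r ^ 2 / d) ≤ Real.exp (2 / d) := by
      apply Real.exp_le_exp.2
      gcongr
      nlinarith [hr.2]
    unfold weight
    calc _ ≤ 2 ^ (5 / 2 : ℝ) * (1 - r) ^ (5 / 2 : ℝ) * Real.exp (2 / d) := by
          gcongr
          exact mul_nonneg (by positivity) (Real.rpow_nonneg (by linarith [hr.2]) _)
      _ = _ := by rw [hK]; ring
  -- `(V²)' = 2 F / w₅ ≤ 2 B (1 - r)^(-5/2)`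
  have hVup : ∃ C, 0 < C ∧ ∀ r ∈ Ico r₁ 1, V r ^ 2 ≤ C * (1 - r) ^ (-(3 / 2) : ℝ) := by
    have hder : ∀ r ∈ Ico r₁ 1, HasDerivAt
        (fun r => V r ^ 2 - 4 * B / 3 * (1 - r) ^ (-(3 / 2) : ℝ))
        (2 * F r / weight d (5 / 2) r - 2 * B * (1 - r) ^ (-(5 / 2) : ℝ)) r := by
      intro r hr
      have h1 : HasDerivAt (fun r : ℝ => 1 - r) (-1) r := (hasDerivAt_id r).const_sub 1
      have h2 := h1.rpow_const (p := -(3 / 2)) (Or.inl (by linarith [hr.2]))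
      refine (((hV r (hmem r hr)).pow 2).sub (h2.const_mul (4 * B / 3))).congr_deriv ?_
      rw [show (-(3 / 2) - 1 : ℝ) = -(5 / 2) by norm_num, hF]
      simp
      ring
    have hanti : AntitoneOn (fun r => V r ^ 2 - 4 * B / 3 * (1 - r) ^ (-(3 / 2) : ℝ))
        (Ico r₁ 1) :=
      antitoneOn_of_hasDerivWithinAt_nonpos (convex_Ico _ _)
        (fun r hr => (hder r hr).continuousAt.continuousWithinAt)
        (fun r hr => (hder r (interior_subset hr)).hasDerivWithinAt) fun r hr => by
          have hr' := interior_subset hr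
          have h1 : 0 < 1 - r := by linarith [hr'.2]
          have h2 : 2 * F r / weight d (5 / 2) r ≤ 2 * B / (1 - r) ^ (5 / 2 : ℝ) := by
            have := Real.rpow_pos_of_pos h1 (5 / 2)
            gcongr
            · exact hup r hr'
            · exact hwlow r hr'
          rw [Real.rpow_neg h1.le, ← div_eq_mul_inv]
          linarith
    refine ⟨V r₁ ^ 2 + 4 * B / 3, by positivity, fun r hr => ?_⟩
    have h1 := hanti ⟨le_rfl, hr₁1⟩ hr hr.1
    simp only at h1
    have h2 : 0 < 1 - r := by linarith [hr.2]
    have h3 : 0 ≤ 4 * B / 3 * (1 - r₁) ^ (-(3 / 2) : ℝ) :=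
      mul_nonneg (by positivity) (Real.rpow_nonneg (by linarith) _)
    have h4 : 1 ≤ (1 - r) ^ (-(3 / 2) : ℝ) :=
      Real.one_le_rpow_of_pos_of_le_one_of_nonpos h2 (by linarith [hr.1]) (by norm_num)
    nlinarith [sq_nonneg (V r₁)]
  obtain ⟨C, hC, hVup⟩ := hVup
  have hbound : ∀ r ∈ Ico r₁ 1, (1 - r)⁻¹ ≤ K * C / c ^ 2 * F' r := by
    intro r hr
    have hr' := hmem r hr
    have h1 : 0 < 1 - r := by linarith [hr.2]
    have hw := weight_pos (d := d) (a := 5 / 2) hr'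
    have e : F r ^ 2 = P r ^ 2 / weight d (5 / 2) r * (weight d (5 / 2) r * V r ^ 2) := by
      rw [hF]; field_simp
    have h2 : weight d (5 / 2) r * V r ^ 2 ≤ K * C * (1 - r) := by
      calc weight d (5 / 2) r * V r ^ 2
          ≤ K * (1 - r) ^ (5 / 2 : ℝ) * (C * (1 - r) ^ (-(3 / 2) : ℝ)) := by
            gcongr
            · exact hwup r hr
            · exact hVup r hr
        _ = K * C * ((1 - r) ^ (5 / 2 : ℝ) * (1 - r) ^ (-(3 / 2) : ℝ)) := by ring
        _ = K * C * (1 - r) := by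
            rw [← Real.rpow_add h1, show (5 / 2 + -(3 / 2) : ℝ) = 1 by norm_num, Real.rpow_one]
    have h3 : c ^ 2 ≤ F r ^ 2 := by gcongr; exact hlow r hr
    have h4 : P r ^ 2 / weight d (5 / 2) r ≤ F' r := le_add_of_nonneg_right (hterm2 r hr')
    have h5 : c ^ 2 ≤ F' r * (K * C * (1 - r)) := by
      rw [e] at h3
      exact h3.trans (mul_le_mul h4 h2 (by positivity) (hF'0 r hr'))
    rw [inv_le_iff_one_le_mul₀ h1, div_mul_eq_mul_div, div_mul_eq_mul_div,
      le_div_iff₀ (by positivity)]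
    linarith
  -- The energy density dominates a multiple of `(1 - r)⁻¹`, which is not integrable.
  have hnot : ¬ IntervalIntegrable (fun r : ℝ => (r - 1)⁻¹) volume r₁ 1 := by
    rw [intervalIntegrable_sub_inv_iff]
    simp [hr₁1.ne]
  apply hnot
  rw [intervalIntegrable_iff_integrableOn_Ioo_of_le hr₁1.le]
  have hsub : Ioo r₁ 1 ⊆ Ioo (-1) 1 := fun x hx => hmem x ⟨hx.1.le, hx.2⟩
  refine Integrable.mono' ((hi.mono_set hsub).const_mul (K * C / c ^ 2))
    (by fun_prop) ?_
  filter_upwards [ae_restrict_mem measurableSet_Ioo] with r hr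
  have h1 : 0 < 1 - r := by linarith [hr.2]
  rw [Real.norm_eq_abs, abs_inv, abs_sub_comm, abs_of_pos h1]
  exact hbound r ⟨hr.1.le, hr.2⟩

/-- A solution of finite energy of the homogeneous radial equation, written as a first order
system, vanishes. -/
theorem eq_zero_of_finite_energy {d : ℝ} (hd : 0 < d) {V P : ℝ → ℝ}
    (hV : ∀ r ∈ Ioo (-1 : ℝ) 1, HasDerivAt V (P r / weight d (5 / 2) r) r)
    (hP : ∀ r ∈ Ioo (-1 : ℝ) 1,
      HasDerivAt P (weight d (3 / 2) r * (4 / d * r ^ 2 + 3) * V r) r)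
    (hi : IntegrableOn (fun r => P r ^ 2 / weight d (5 / 2) r
      + weight d (3 / 2) r * (4 / d * r ^ 2 + 3) * V r ^ 2) (Ioo (-1) 1)) :
    ∀ r ∈ Ioo (-1 : ℝ) 1, V r = 0 := by
  have hneg : ∀ {r : ℝ}, r ∈ Ioo (-1 : ℝ) 1 → -r ∈ Ioo (-1 : ℝ) 1 := fun hr =>
    ⟨by linarith [hr.2], by linarith [hr.1]⟩
  have hwe : ∀ a r, weight d a (-r) = weight d a r := fun a r => by simp [weight]
  have h1 := flux_mul_nonpos hd hV hP hi
  have h2 := flux_mul_nonpos hd (V := fun r => V (-r)) (P := fun r => -P (-r))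
    (fun r hr => ((hV (-r) (hneg hr)).comp r (hasDerivAt_neg r)).congr_deriv (by rw [hwe]; ring))
    (fun r hr => ((hP (-r) (hneg hr)).comp r (hasDerivAt_neg r)).neg.congr_deriv
      (by rw [hwe]; ring)) (by
      have := ((Measure.measurePreserving_neg volume).integrableOn_comp_preimage
        (Homeomorph.neg ℝ).measurableEmbedding).2 hi
      simpa [hwe, Function.comp_def] using this)
  have h0 : ∀ r ∈ Ioo (-1 : ℝ) 1, P r * V r = 0 := fun r hr => by
    have h3 := h2 (-r) (hneg hr)
    simp only [neg_neg] at h3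
    linarith [h1 r hr]
  intro r hr
  have hd1 := (hP r hr).mul (hV r hr)
  have hd2 : HasDerivAt (fun r => P r * V r) 0 r :=
    (hasDerivAt_const r (0 : ℝ)).congr_of_eventuallyEq
      (Filter.eventuallyEq_of_mem (isOpen_Ioo.mem_nhds hr) h0)
  have h3 := hd1.unique hd2
  have hw3 := weight_pos (d := d) (a := 3 / 2) hr
  have hw5 := weight_pos (d := d) (a := 5 / 2) hr
  have h4 : 0 ≤ P r * (P r / weight d (5 / 2) r) := by
    rw [← mul_div_assoc]; exact div_nonneg (mul_self_nonneg _) hw5.le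
  have h5 : weight d (3 / 2) r * (4 / d * r ^ 2 + 3) * (V r * V r) ≤ 0 := by linarith
  have h6 : 0 < weight d (3 / 2) r * (4 / d * r ^ 2 + 3) := by positivity
  have h7 : V r * V r ≤ 0 := by
    by_contra! h8
    exact absurd h5 (not_le.2 (mul_pos h6 h8))
  exact mul_self_eq_zero.1 (le_antisymm h7 (mul_self_nonneg _))

theorem MemWeighted.sub {h g h' g' : ℝ → ℝ} (H : MemWeighted h g) (H' : MemWeighted h' g') :
    MemWeighted (h - h') (g - g') := by
  obtain ⟨⟨a1, a2, a3⟩, b, c⟩ := H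
  obtain ⟨⟨a1', a2', a3'⟩, b', c'⟩ := H'
  have hsq : ∀ {u v w : ℝ → ℝ}, (∀ r ∈ Ioo (-1 : ℝ) 1, 0 ≤ w r) → ContinuousOn w (Ioo (-1) 1) →
      LocallyIntegrableOn u (Ioo (-1) 1) → LocallyIntegrableOn v (Ioo (-1) 1) →
      IntegrableOn (fun r => w r * u r ^ 2) (Ioo (-1) 1) →
      IntegrableOn (fun r => w r * v r ^ 2) (Ioo (-1) 1) →
      IntegrableOn (fun r => w r * (u - v) r ^ 2) (Ioo (-1) 1) := by
    intro u v w hw hwc hu hv hui hvi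
    refine Integrable.mono' ((hui.add hvi).const_mul 2) ?_ ?_
    · exact (hwc.aestronglyMeasurable measurableSet_Ioo).mul
        ((hu.aestronglyMeasurable.sub hv.aestronglyMeasurable).pow 2)
    · filter_upwards [ae_restrict_mem measurableSet_Ioo] with r hr
      have h1 := hw r hr
      rw [Real.norm_eq_abs, abs_of_nonneg (by positivity)]
      simp only [Pi.sub_apply, Pi.add_apply]
      nlinarith [mul_nonneg h1 (sq_nonneg (u r + v r))]
  have hw : ∀ a : ℝ, 0 ≤ a → Continuous fun r : ℝ => (1 - r ^ 2) ^ a := fun a ha =>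
    (continuous_const.sub (continuous_id.pow 2)).rpow_const fun _ => Or.inr ha
  have hw0 : ∀ a : ℝ, ∀ r ∈ Ioo (-1 : ℝ) 1, 0 ≤ (1 - r ^ 2) ^ a := fun a r hr =>
    Real.rpow_nonneg (one_sub_sq_pos hr).le _
  refine ⟨⟨a1.sub a1', a2.sub a2', fun φ hφ => ?_⟩,
    hsq (hw0 _) (hw _ (by norm_num)).continuousOn a1 a1' b b',
    hsq (hw0 _) (hw _ (by norm_num)).continuousOn a2 a2' c c'⟩
  simp only [Pi.sub_apply, sub_mul]
  rw [integral_sub (hφ.integrableOn_mul_deriv a1) (hφ.integrableOn_mul_deriv a1'),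
    integral_sub (hφ.integrableOn_mul a2) (hφ.integrableOn_mul a2'), a3 φ hφ, a3' φ hφ]
  ring

/-- Weak solutions of the radial equation in the weighted space are unique. -/
theorem IsWeakODESolution.ae_eq {d : ℝ} (hd : 0 < d) {h k : ℝ → ℝ} (hh : IsWeakODESolution d h)
    (hk : IsWeakODESolution d k) : k =ᵐ[volume.restrict (Ioo (-1 : ℝ) 1)] h := by
  obtain ⟨gh, Hh, eh⟩ := hh
  obtain ⟨gk, Hk, ek⟩ := hk
  set v := k - h with hv
  set g := gk - gh with hg
  have H : MemWeighted v g := Hk.sub Hh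
  set q : ℝ → ℝ := fun r => weight d (3 / 2) r * (4 / d * r ^ 2 + 3) with hq
  have hw3 : Continuous (weight d (3 / 2)) := continuous_weight (by norm_num)
  have hw5 : Continuous (weight d (5 / 2)) := continuous_weight (by norm_num)
  have hqc : Continuous q := by fun_prop
  have lmul : ∀ {c u : ℝ → ℝ}, Continuous c → LocallyIntegrableOn u (Ioo (-1) 1) →
      LocallyIntegrableOn (fun r => c r * u r) (Ioo (-1) 1) := fun hc hu =>
    hu.continuousOn_mul hc.continuousOn isOpen_Ioo.isLocallyClosed
  have hflux : HasWeakDeriv (fun r => weight d (5 / 2) r * g r) (fun r => q r * v r) := by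
    refine ⟨lmul hw5 H.1.2.1, lmul hqc H.1.1, fun φ hφ => ?_⟩
    have i1 : ∀ {u : ℝ → ℝ}, LocallyIntegrableOn u (Ioo (-1) 1) → IntegrableOn (fun r =>
        weight d (3 / 2) r * (-4 / d * r ^ 2 - 3) * u r * φ r) (Ioo (-1) 1) := fun hu =>
      hφ.integrableOn_mul (lmul (by fun_prop) hu)
    have i2 : ∀ {u : ℝ → ℝ}, LocallyIntegrableOn u (Ioo (-1) 1) → IntegrableOn (fun r =>
        weight d (5 / 2) r * u r * deriv φ r) (Ioo (-1) 1) := fun hu =>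
      hφ.integrableOn_mul_deriv (lmul hw5 hu)
    have e1 := eh φ hφ
    have e2 := ek φ hφ
    have s1 : ∫ r in Ioo (-1 : ℝ) 1, weight d (5 / 2) r * g r * deriv φ r
        = (∫ r in Ioo (-1 : ℝ) 1, weight d (5 / 2) r * gk r * deriv φ r)
          - ∫ r in Ioo (-1 : ℝ) 1, weight d (5 / 2) r * gh r * deriv φ r := by
      rw [← integral_sub (i2 Hk.1.2.1) (i2 Hh.1.2.1)]
      refine integral_congr_ae (ae_of_all _ fun r => ?_)
      simp only [hg, Pi.sub_apply]
      ring
    have s2 : ∫ r in Ioo (-1 : ℝ) 1, q r * v r * φ r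
        = (∫ r in Ioo (-1 : ℝ) 1, weight d (3 / 2) r * (-4 / d * r ^ 2 - 3) * h r * φ r)
          - ∫ r in Ioo (-1 : ℝ) 1, weight d (3 / 2) r * (-4 / d * r ^ 2 - 3) * k r * φ r := by
      rw [← integral_sub (i1 Hh.1.1) (i1 Hk.1.1)]
      refine integral_congr_ae (ae_of_all _ fun r => ?_)
      simp only [hv, hq, Pi.sub_apply]
      ring
    rw [s1, s2]
    linarith
  obtain ⟨c, hc⟩ := H.1.ae_eq_primitive
  obtain ⟨c', hc'⟩ := hflux.ae_eq_primitive
  -- `V` and `P` are the continuous representatives of `v` and of its flux `w₅ g`.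
  set V : ℝ → ℝ := fun r => c + ∫ t in (0 : ℝ)..r, g t with hV
  set P : ℝ → ℝ := fun r => c' + ∫ t in (0 : ℝ)..r, q t * v t with hP
  have hPc : ContinuousOn P (Ioo (-1) 1) :=
    continuousOn_const.add (continuousOn_primitive_of_locallyIntegrableOn hflux.2.1)
  have hVc : ContinuousOn V (Ioo (-1) 1) :=
    continuousOn_const.add (continuousOn_primitive_of_locallyIntegrableOn H.1.2.1)
  have hgP : g =ᵐ[volume.restrict (Ioo (-1) 1)] fun r => P r / weight d (5 / 2) r := by
    filter_upwards [hc', ae_restrict_mem measurableSet_Ioo] with r h1 h2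
    rw [eq_div_iff (weight_pos h2).ne', mul_comm]
    exact h1
  have hqV : (fun r => q r * v r) =ᵐ[volume.restrict (Ioo (-1) 1)] fun r => q r * V r := by
    filter_upwards [hc] with r h1
    rw [h1]
  have dV : ∀ r ∈ Ioo (-1 : ℝ) 1, HasDerivAt V (P r / weight d (5 / 2) r) r := fun r hr =>
    hasDerivAt_primitive_of_ae_eq
      (hPc.div hw5.continuousOn fun r hr => (weight_pos hr).ne') hgP c hr
  have dP : ∀ r ∈ Ioo (-1 : ℝ) 1, HasDerivAt P (q r * V r) r := fun r hr =>
    hasDerivAt_primitive_of_ae_eq (hqc.continuousOn.mul hVc) hqV c' hr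
  have hi : IntegrableOn (fun r => P r ^ 2 / weight d (5 / 2) r
      + weight d (3 / 2) r * (4 / d * r ^ 2 + 3) * V r ^ 2) (Ioo (-1) 1) := by
    have m5 : IntegrableOn (fun r => weight d (5 / 2) r * g r ^ 2) (Ioo (-1) 1) := by
      have := (H.2.2.mul_continuousOn_of_subset (K := Icc (-1) 1)
        (by fun_prop : Continuous fun r => Real.exp (2 * r ^ 2 / d)).continuousOn
        measurableSet_Ioo isCompact_Icc Ioo_subset_Icc_self)
      refine this.congr (ae_of_all _ fun r => ?_)
      simp only [weight]
      ring
    have m3 : IntegrableOn (fun r => q r * v r ^ 2) (Ioo (-1) 1) := by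
      have := (H.2.1.mul_continuousOn_of_subset (K := Icc (-1) 1)
        (by fun_prop : Continuous fun r =>
          Real.exp (2 * r ^ 2 / d) * (4 / d * r ^ 2 + 3)).continuousOn
        measurableSet_Ioo isCompact_Icc Ioo_subset_Icc_self)
      refine this.congr (ae_of_all _ fun r => ?_)
      simp only [hq, weight]
      ring
    refine (m5.add m3).congr ?_
    filter_upwards [hgP, hc, ae_restrict_mem measurableSet_Ioo] with r h1 h2 h3
    have := (weight_pos (d := d) (a := 5 / 2) h3).ne'
    simp only [Pi.add_apply, h1, h2, hq]
    field_simp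
  have h0 := eq_zero_of_finite_energy hd dV dP hi
  filter_upwards [hc, ae_restrict_mem measurableSet_Ioo] with r h1 h2
  have h3 : v r = 0 := h1.trans (h0 r h2)
  exact sub_eq_zero.1 h3

/-! ### Classical solutions of the radial equation -/

theorem IsODESolution.isWeakODESolution {d : ℝ} {k : ℝ → ℝ} (hk : IsODESolution d k) :
    IsWeakODESolution d k := by
  obtain ⟨hc, ⟨g, hkg, hi, hi'⟩, he⟩ := hk
  have hd : ∀ r ∈ Ioo (-1 : ℝ) 1, HasDerivAt k (deriv k r) r := fun r hr =>
    ((hc.contDiffAt (isOpen_Ioo.mem_nhds hr)).differentiableAt (by norm_num)).hasDerivAt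
  have hc' : ContDiffOn ℝ 1 (deriv k) (Ioo (-1) 1) := hc.deriv_of_isOpen isOpen_Ioo (by norm_num)
  have hwk := hasWeakDeriv_of_hasDerivAt hd hc'.continuousOn
  have hg := hkg.ae_eq hwk
  refine ⟨deriv k, ⟨hwk, hi, Integrable.congr hi' ?_⟩, fun φ hφ => ?_⟩
  · filter_upwards [hg] with r hr
    rw [hr]
  have hw : Continuous (weight d (3 / 2)) := continuous_weight (by norm_num)
  have hc1 : ContinuousOn (fun r => weight d (3 / 2) r * (-4 / d * r ^ 2 - 3) * k r)
      (Ioo (-1) 1) :=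
    (by fun_prop : Continuous fun r => weight d (3 / 2) r * (-4 / d * r ^ 2 - 3)).continuousOn.mul
      hc.continuousOn
  have hc2 : ContinuousOn (fun r => r * weight d (3 / 2) r) (Ioo (-1) 1) :=
    (by fun_prop : Continuous fun r => r * weight d (3 / 2) r).continuousOn
  have hc3 : ContinuousOn (fun r => r * weight d (3 / 2) r
      - weight d (3 / 2) r * (-4 / d * r ^ 2 - 3) * k r) (Ioo (-1) 1) := hc2.sub hc1
  have hflux := (hasWeakDeriv_of_hasDerivAt (u := fun s => weight d (5 / 2) s * deriv k s)
    (u' := fun r => r * weight d (3 / 2) r - weight d (3 / 2) r * (-4 / d * r ^ 2 - 3) * k r)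
    (fun r hr => by
      rw [← he r hr, add_sub_cancel_left]
      exact ((hasDerivAt_weight hr).differentiableAt.mul
        ((hc'.contDiffAt (isOpen_Ioo.mem_nhds hr)).differentiableAt (by norm_num))).hasDerivAt)
    hc3).2.2 φ hφ
  rw [hflux, sub_neg_eq_add, ← integral_add
    (hφ.integrableOn_mul (hc1.locallyIntegrableOn measurableSet_Ioo))
    (hφ.integrableOn_mul (hc3.locallyIntegrableOn measurableSet_Ioo))]
  refine integral_congr_ae (ae_of_all _ fun r => ?_)
  simp only
  ring

theorem IsODESolution.congr {d : ℝ} {h k : ℝ → ℝ} (hh : IsODESolution d h)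
    (e : EqOn k h (Ioo (-1) 1)) : IsODESolution d k := by
  obtain ⟨hc, ⟨g, ⟨-, hg, hp⟩, hi, hi'⟩, he⟩ := hh
  have hck := hc.congr e
  refine ⟨hck, ⟨g, ⟨hck.continuousOn.locallyIntegrableOn measurableSet_Ioo, hg, fun φ hφ => ?_⟩,
    ?_, hi'⟩, fun r hr => ?_⟩
  · rw [← hp φ hφ]
    exact setIntegral_congr_fun measurableSet_Ioo fun r hr => by simp only [e hr]
  · exact hi.congr_fun (fun r hr => by simp only [e hr]) measurableSet_Ioo
  · have e1 : deriv k =ᶠ[𝓝 r] deriv h :=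
      (e.eventuallyEq_of_mem (isOpen_Ioo.mem_nhds hr)).deriv
    have e2 : (fun s => weight d (5 / 2) s * deriv k s)
        =ᶠ[𝓝 r] fun s => weight d (5 / 2) s * deriv h s := by
      filter_upwards [e1] with s hs
      rw [hs]
    rw [e2.deriv_eq, e hr, he r hr]

theorem IsODESolution.not_eqOn_zero {d : ℝ} {h : ℝ → ℝ} (hh : IsODESolution d h) :
    ¬ EqOn 0 h (Ioo (-1) 1) := fun e => by
  have hr : (1 / 2 : ℝ) ∈ Ioo (-1 : ℝ) 1 := by norm_num
  have h1 := (hh.congr e).2.2 _ hr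
  have h2 : deriv (0 : ℝ → ℝ) = fun _ => 0 := deriv_const' 0
  rw [h2] at h1
  simp only [Pi.zero_apply, mul_zero, deriv_const, add_zero] at h1
  have := weight_pos (d := d) (a := 3 / 2) hr
  linarith

/-! ### The group of unit quaternions and its invariant measure -/

/-- The action of a linear isometry on the unit sphere. -/
noncomputable def sphereMap (L : ℍ[ℝ] ≃ₗᵢ[ℝ] ℍ[ℝ]) (q : H1) : H1 :=
  ⟨L q, by rw [mem_sphere_zero_iff_norm, L.norm_map, norm_eq_of_mem_sphere]⟩

open scoped Pointwise in
theorem measurePreserving_sphereMap (L : ℍ[ℝ] ≃ₗᵢ[ℝ] ℍ[ℝ]) :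
    MeasurePreserving (sphereMap L) sigma sigma := by
  have hm : Measurable (sphereMap L) :=
    ((L.continuous.comp continuous_subtype_val).subtype_mk _).measurable
  refine ⟨hm, ?_⟩
  ext s hs
  rw [Measure.map_apply hm hs, sigma, Measure.toSphere_apply' _ (hm hs),
    Measure.toSphere_apply' _ hs]
  congr 1
  rw [← (LinearIsometryEquiv.measurePreserving L).measure_preimage_emb
    L.toHomeomorph.measurableEmbedding (Ioo (0 : ℝ) 1 • (Subtype.val '' s))]
  congr 1
  ext x
  simp only [Set.mem_smul, mem_image, mem_preimage, exists_exists_and_eq_and]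
  constructor
  · rintro ⟨t, ht, q, hq, rfl⟩
    exact ⟨t, ht, sphereMap L q, hq, by simp [sphereMap]⟩
  · rintro ⟨t, ht, q, hq, h⟩
    refine ⟨t, ht, sphereMap L.symm q, ?_, ?_⟩
    · have : sphereMap L (sphereMap L.symm q) = q := by ext1; simp [sphereMap]
      rwa [this]
    · apply L.injective
      rw [← h, map_smul]
      simp [sphereMap]

/-- Left multiplication by a unit quaternion, as a linear isometry. -/
noncomputable def leftMul (a : H1) : ℍ[ℝ] ≃ₗᵢ[ℝ] ℍ[ℝ] :=
  LinearIsometry.toLinearIsometryEquiv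
    ⟨LinearMap.mulLeft ℝ (a : ℍ[ℝ]), fun x => by simp⟩ rfl

/-- Right multiplication by a unit quaternion, as a linear isometry. -/
noncomputable def rightMul (a : H1) : ℍ[ℝ] ≃ₗᵢ[ℝ] ℍ[ℝ] :=
  LinearIsometry.toLinearIsometryEquiv
    ⟨LinearMap.mulRight ℝ (a : ℍ[ℝ]), fun x => by simp⟩ rfl

@[simp] theorem leftMul_apply (a : H1) (x : ℍ[ℝ]) : leftMul a x = a * x := rfl

@[simp] theorem rightMul_apply (a : H1) (x : ℍ[ℝ]) : rightMul a x = x * a := rfl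

instance : sigma.IsMulLeftInvariant :=
  ⟨fun a => (measurePreserving_sphereMap (leftMul a)).map_eq⟩

instance : sigma.IsMulRightInvariant :=
  ⟨fun a => (measurePreserving_sphereMap (rightMul a)).map_eq⟩

instance : sigma.IsOpenPosMeasure := by
  unfold sigma; infer_instance

theorem sigma_real_univ_pos : 0 < sigma.real univ :=
  ENNReal.toReal_pos (isOpen_univ.measure_ne_zero _ univ_nonempty) (measure_ne_top _ _)

/-! ### Smooth functions on the sphere and their ambient extensions -/

theorem coe_ne_zero (q : H1) : (q : ℍ[ℝ]) ≠ 0 := ne_zero_of_mem_unit_sphere q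

theorem radialExt_smul {V : Type} [Zero V] (f : H1 → V) {c : ℝ} (hc : 0 < c) (x : ℍ[ℝ]) :
    radialExt f (c • x) = radialExt f x := by
  by_cases hx : x = 0
  · simp [hx]
  · have h1 : c • x ≠ 0 := smul_ne_zero hc.ne' hx
    rw [radialExt, dif_neg h1, radialExt, dif_neg hx]
    congr 2
    rw [norm_smul, Real.norm_eq_abs, abs_of_pos hc, smul_smul, mul_inv]
    field_simp

@[simp] theorem radialExt_coe {V : Type} [Zero V] (f : H1 → V) (q : H1) :
    radialExt f (q : ℍ[ℝ]) = f q := by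
  rw [radialExt, dif_neg (coe_ne_zero q)]
  congr 1
  ext1
  simp

section RadialExt

variable {V : Type} [NormedAddCommGroup V] [NormedSpace ℝ V]

theorem contMDiff_of_ambient {F : ℍ[ℝ] → V} (hF : ∀ q : H1, ContDiffAt ℝ ∞ F q) :
    ContMDiff (𝓡 3) 𝓘(ℝ, V) ∞ fun q : H1 => F q := fun q =>
  (hF q).contMDiffAt.comp q (contMDiff_coe_sphere q)

theorem contDiffAt_radialExt {f : H1 → V} (hf : ContMDiff (𝓡 3) 𝓘(ℝ, V) ∞ f) {x : ℍ[ℝ]}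
    (hx : x ≠ 0) : ContDiffAt ℝ ∞ (radialExt f) x := by
  let U : TopologicalSpace.Opens ℍ[ℝ] := ⟨{0}ᶜ, isOpen_compl_singleton⟩
  have hU : ∀ y : U, (y : ℍ[ℝ]) ≠ 0 := fun y => y.2
  have hN : ContMDiff 𝓘(ℝ, ℍ[ℝ]) 𝓘(ℝ, ℍ[ℝ]) ∞ fun y : U => ‖(y : ℍ[ℝ])‖⁻¹ • (y : ℍ[ℝ]) := by
    intro y
    have h1 : ContDiffAt ℝ ∞ (fun x : ℍ[ℝ] => ‖x‖⁻¹ • x) (y : ℍ[ℝ]) :=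
      ((contDiffAt_norm ℝ (hU y)).inv (norm_ne_zero_iff.2 (hU y))).smul contDiffAt_id
    exact h1.contMDiffAt.comp y contMDiff_subtype_val.contMDiffAt
  have hNs : ∀ y : U, ‖(y : ℍ[ℝ])‖⁻¹ • (y : ℍ[ℝ]) ∈ Metric.sphere (0 : ℍ[ℝ]) 1 := fun y => by
    rw [mem_sphere_zero_iff_norm, norm_smul, norm_inv, norm_norm,
      inv_mul_cancel₀ (norm_ne_zero_iff.2 (hU y))]
  have h2 := hf.comp (hN.codRestrict_sphere (n := 3) hNs)
  have h3 : ContMDiffAt 𝓘(ℝ, ℍ[ℝ]) 𝓘(ℝ, V) ∞ (fun y : U => radialExt f y) ⟨x, hx⟩ := by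
    refine (h2 ⟨x, hx⟩).congr_of_eventuallyEq (Eventually.of_forall fun y => ?_)
    simp only [radialExt, dif_neg (hU y), Function.comp]
    rfl
  exact (contMDiffAt_subtype_iff.1 h3).contDiffAt

end RadialExt

/-! ### The left-invariant frame -/

/-- The imaginary units `i`, `j`, `k`. The vector fields `q ↦ q * imUnit a` form an orthonormal
frame of the sphere. -/
noncomputable def imUnit : Fin 3 → ℍ[ℝ] := ![⟨0, 1, 0, 0⟩, ⟨0, 0, 1, 0⟩, ⟨0, 0, 0, 1⟩]

@[simp] theorem imUnit_re (a : Fin 3) : (imUnit a).re = 0 := by fin_cases a <;> rfl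

@[simp] theorem imUnit_imI (a : Fin 3) : (imUnit a).imI = if a = 0 then 1 else 0 := by
  fin_cases a <;> rfl

@[simp] theorem imUnit_imJ (a : Fin 3) : (imUnit a).imJ = if a = 1 then 1 else 0 := by
  fin_cases a <;> rfl

@[simp] theorem imUnit_imK (a : Fin 3) : (imUnit a).imK = if a = 2 then 1 else 0 := by
  fin_cases a <;> rfl

theorem imUnit_mul_self (a : Fin 3) : imUnit a * imUnit a = -1 := by
  ext <;> fin_cases a <;> simp

/-- The orthonormal basis `q, q i, q j, q k` of the space of quaternions. -/
theorem exists_orthonormalBasis (q : H1) : ∃ b : OrthonormalBasis (Fin 4) ℝ ℍ[ℝ],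
    b 0 = q ∧ ∀ a : Fin 3, b a.succ = q * imUnit a := by
  let b₀ : OrthonormalBasis (Fin 4) ℝ ℍ[ℝ] := OrthonormalBasis.ofRepr
    Quaternion.linearIsometryEquivTuple
  refine ⟨b₀.map (leftMul q), ?_, fun a => ?_⟩
  · have : b₀ 0 = 1 := by
      apply b₀.repr.injective
      rw [b₀.repr_self]
      change _ = !₂[(1 : ℍ[ℝ]).re, (1 : ℍ[ℝ]).imI, (1 : ℍ[ℝ]).imJ, (1 : ℍ[ℝ]).imK]
      ext i
      fin_cases i <;> simp
    simp [this]
  · have : b₀ a.succ = imUnit a := by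
      apply b₀.repr.injective
      rw [b₀.repr_self]
      change _ = !₂[(imUnit a).re, (imUnit a).imI, (imUnit a).imJ, (imUnit a).imK]
      ext i
      fin_cases i <;> fin_cases a <;> simp
    simp [this]

theorem inner_self_mul_imUnit (q : H1) (a : Fin 3) : inner ℝ (q : ℍ[ℝ]) (q * imUnit a) = 0 := by
  obtain ⟨b, h0, h1⟩ := exists_orthonormalBasis q
  have : inner ℝ (b 0) (b a.succ) = 0 := b.orthonormal.2 (Fin.succ_ne_zero a).symm
  rwa [h0, h1] at this

theorem inner_frame (q : H1) (a c : Fin 3) :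
    inner ℝ ((q : ℍ[ℝ]) * imUnit a) (q * imUnit c) = if a = c then 1 else 0 := by
  obtain ⟨b, h0, h1⟩ := exists_orthonormalBasis q
  rw [← h1, ← h1, orthonormal_iff_ite.1 b.orthonormal]
  simp

theorem inner_eq_sum_frame (q : H1) (x y : ℍ[ℝ]) : inner ℝ x y =
    inner ℝ x (q : ℍ[ℝ]) * inner ℝ y (q : ℍ[ℝ])
      + ∑ a, inner ℝ x (q * imUnit a) * inner ℝ y (q * imUnit a) := by
  obtain ⟨b, h0, h1⟩ := exists_orthonormalBasis q
  rw [← b.sum_inner_mul_inner x y, Fin.sum_univ_succ, h0, real_inner_comm]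
  simp_rw [h1]
  congr 1
  · rw [real_inner_comm x, real_inner_comm y]
  · exact Finset.sum_congr rfl fun a _ => by rw [real_inner_comm y]

/-- The one-parameter group `t ↦ exp (t u)`, for `u` an imaginary unit. -/
noncomputable def rot (a : Fin 3) (t : ℝ) : H1 :=
  ⟨(Real.cos t : ℍ[ℝ]) + Real.sin t • imUnit a, by
    rw [mem_sphere_zero_iff_norm, ← sq_eq_sq₀ (norm_nonneg _) zero_le_one, sq,
      ← Quaternion.normSq_eq_norm_mul_self, Quaternion.normSq_def']
    have := Real.sin_sq_add_cos_sq t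
    fin_cases a <;> simp⟩

theorem coe_rot (a : Fin 3) (t : ℝ) :
    (rot a t : ℍ[ℝ]) = (Real.cos t : ℍ[ℝ]) + Real.sin t • imUnit a := rfl

@[simp] theorem rot_zero (a : Fin 3) : rot a 0 = 1 := by
  ext1
  simp [coe_rot]

theorem hasDerivAt_coe_mul_rot (a : Fin 3) (q : H1) (t : ℝ) :
    HasDerivAt (fun t => ((q * rot a t : H1) : ℍ[ℝ])) ((q * rot a t : H1) * imUnit a) t := by
  have h1 : HasDerivAt (fun t : ℝ => (Real.cos t : ℍ[ℝ]) + Real.sin t • imUnit a)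
      (-Real.sin t • (1 : ℍ[ℝ]) + Real.cos t • imUnit a) t := by
    refine HasDerivAt.add ?_ ((Real.hasDerivAt_sin t).smul_const _)
    have := (Real.hasDerivAt_cos t).smul_const (1 : ℍ[ℝ])
    refine this.congr_of_eventuallyEq (Eventually.of_forall fun s => ?_)
    ext <;> simp
  have h2 := h1.const_mul (q : ℍ[ℝ])
  refine h2.congr_deriv ?_
  rw [Metric.unitSphere.coe_mul, mul_assoc, coe_rot, add_mul, smul_mul_assoc, imUnit_mul_self]
  congr 1
  ext <;> simp

/-- The derivative of `f` in the direction of the left-invariant vector field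
`q ↦ q * imUnit a`. -/
noncomputable def frameDeriv {V : Type} [NormedAddCommGroup V] [NormedSpace ℝ V] (a : Fin 3)
    (f : H1 → V) (q : H1) : V :=
  deriv (fun t => f (q * rot a t)) 0

section FrameDeriv

variable {V : Type} [NormedAddCommGroup V] [NormedSpace ℝ V]

theorem hasDerivAt_of_ambient {f : H1 → V} {F : ℍ[ℝ] → V} {F' : ℍ[ℝ] →L[ℝ] V} {q : H1}
    (a : Fin 3) {t : ℝ} (hF : HasFDerivAt F F' (q * rot a t : H1)) (hf : ∀ p : H1, f p = F p) :
    HasDerivAt (fun t => f (q * rot a t)) (F' ((q * rot a t : H1) * imUnit a)) t := by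
  simp_rw [hf]
  exact hF.comp_hasDerivAt t (hasDerivAt_coe_mul_rot a q t)

theorem frameDeriv_eq_of_ambient {f : H1 → V} {F : ℍ[ℝ] → V} {F' : ℍ[ℝ] →L[ℝ] V} {q : H1}
    (a : Fin 3) (hF : HasFDerivAt F F' q) (hf : ∀ p : H1, f p = F p) :
    frameDeriv a f q = F' (q * imUnit a) := by
  have := hasDerivAt_of_ambient (q := q) a (t := 0) (by simpa using hF) hf
  simpa [frameDeriv] using this.deriv

theorem hasFDerivAt_radialExt {f : H1 → V} (hf : ContMDiff (𝓡 3) 𝓘(ℝ, V) ∞ f) (q : H1) :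
    HasFDerivAt (radialExt f) (fderiv ℝ (radialExt f) q) q :=
  ((contDiffAt_radialExt hf (coe_ne_zero q)).differentiableAt (by simp)).hasFDerivAt

theorem frameDeriv_eq_fderiv {f : H1 → V} (hf : ContMDiff (𝓡 3) 𝓘(ℝ, V) ∞ f) (a : Fin 3)
    (q : H1) : frameDeriv a f q = fderiv ℝ (radialExt f) q (q * imUnit a) :=
  frameDeriv_eq_of_ambient a (hasFDerivAt_radialExt hf q) fun p => (radialExt_coe f p).symm

theorem hasDerivAt_mul_rot {f : H1 → V} (hf : ContMDiff (𝓡 3) 𝓘(ℝ, V) ∞ f) (a : Fin 3)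
    (q : H1) (t : ℝ) :
    HasDerivAt (fun t => f (q * rot a t)) (frameDeriv a f (q * rot a t)) t := by
  rw [frameDeriv_eq_fderiv hf]
  exact hasDerivAt_of_ambient (F := radialExt f) a (hasFDerivAt_radialExt hf _)
    fun p => (radialExt_coe f p).symm

theorem hasDerivAt_frameDeriv {f : H1 → V} (hf : ContMDiff (𝓡 3) 𝓘(ℝ, V) ∞ f) (a : Fin 3)
    (q : H1) : HasDerivAt (fun t => f (q * rot a t)) (frameDeriv a f q) 0 := by
  simpa using hasDerivAt_mul_rot hf a q 0

theorem contMDiff_frameDeriv {f : H1 → V} (hf : ContMDiff (𝓡 3) 𝓘(ℝ, V) ∞ f) (a : Fin 3) :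
    ContMDiff (𝓡 3) 𝓘(ℝ, V) ∞ (frameDeriv a f) := by
  have h : frameDeriv a f = fun q : H1 => fderiv ℝ (radialExt f) q (q * imUnit a) :=
    funext fun q => frameDeriv_eq_fderiv hf a q
  rw [h]
  refine contMDiff_of_ambient (F := fun x => fderiv ℝ (radialExt f) x (x * imUnit a)) fun q => ?_
  exact ((contDiffAt_radialExt hf (coe_ne_zero q)).fderiv_right (m := ∞) (by simp)).clm_apply
    (contDiffAt_id.mul contDiffAt_const)

/-- The extension along rays is constant in the radial direction. -/
theorem fderiv_radialExt_self {f : H1 → V} (hf : ContMDiff (𝓡 3) 𝓘(ℝ, V) ∞ f) (q : H1) :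
    fderiv ℝ (radialExt f) q (q : ℍ[ℝ]) = 0 := by
  have h1 : HasDerivAt (fun t : ℝ => (1 + t) • (q : ℍ[ℝ])) (q : ℍ[ℝ]) 0 := by
    simpa using ((hasDerivAt_id (0 : ℝ)).const_add 1).smul_const (q : ℍ[ℝ])
  have h2 : HasFDerivAt (radialExt f) (fderiv ℝ (radialExt f) q)
      ((fun t : ℝ => (1 + t) • (q : ℍ[ℝ])) 0) := by
    simpa using hasFDerivAt_radialExt hf q
  have h3 := h2.comp_hasDerivAt 0 h1
  have h4 : HasDerivAt (fun _ : ℝ => radialExt f (q : ℍ[ℝ])) (0 : V) 0 := hasDerivAt_const _ _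
  refine h3.unique (h4.congr_of_eventuallyEq ?_)
  filter_upwards [Ioi_mem_nhds (show (-1 : ℝ) < 0 by norm_num)] with t ht
  exact radialExt_smul f (by linarith [mem_Ioi.1 ht]) _

end FrameDeriv

theorem inner_sphereGrad {f : H1 → ℝ} (q : H1) (v : ℍ[ℝ]) :
    inner ℝ (sphereGrad f q) v = fderiv ℝ (radialExt f) q v := by
  simp [sphereGrad, gradient]

theorem inner_sphereGrad_frame {f : H1 → ℝ} (hf : SmoothFun f) (q : H1) (a : Fin 3) :
    inner ℝ (sphereGrad f q) (q * imUnit a) = frameDeriv a f q := by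
  rw [inner_sphereGrad, frameDeriv_eq_fderiv hf]

theorem inner_sphereGrad_self {f : H1 → ℝ} (hf : SmoothFun f) (q : H1) :
    inner ℝ (q : ℍ[ℝ]) (sphereGrad f q) = 0 := by
  rw [real_inner_comm, inner_sphereGrad, fderiv_radialExt_self hf]

theorem contMDiff_sphereGrad {f : H1 → ℝ} (hf : SmoothFun f) :
    ContMDiff (𝓡 3) 𝓘(ℝ, ℍ[ℝ]) ∞ (sphereGrad f) := by
  refine contMDiff_of_ambient (F := gradient (radialExt f)) fun q => ?_
  exact (InnerProductSpace.toDual ℝ ℍ[ℝ]).symm.contDiff.contDiffAt.comp _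
    ((contDiffAt_radialExt hf (coe_ne_zero q)).fderiv_right (m := ∞) (by simp))

/-- The divergence in terms of the frame. The frame fields being divergence free, no zeroth order
term occurs. -/
theorem sphereDiv_eq_sum {X : H1 → ℍ[ℝ]} (hX : SmoothTangentField X) (q : H1) :
    sphereDiv X q = ∑ a, frameDeriv a (fun p => inner ℝ (X p) ((p : ℍ[ℝ]) * imUnit a)) q := by
  obtain ⟨b, h0, h1⟩ := exists_orthonormalBasis q
  rw [sphereDiv, LinearMap.trace_eq_sum_inner _ b, Fin.sum_univ_succ, h0]
  simp only [ContinuousLinearMap.coe_coe, h1]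
  rw [fderiv_radialExt_self hX.1, inner_zero_right, zero_add]
  refine Finset.sum_congr rfl fun a _ => ?_
  have d1 := hasDerivAt_frameDeriv hX.1 a q
  have d2 := (hasDerivAt_coe_mul_rot a q 0).mul_const (imUnit a)
  have d3 := d1.inner ℝ d2
  rw [frameDeriv, d3.deriv, ← frameDeriv_eq_fderiv hX.1]
  simp only [rot_zero, mul_one]
  rw [mul_assoc, imUnit_mul_self, mul_neg, mul_one, inner_neg_right, real_inner_comm _ (X q),
    show inner ℝ (q : ℍ[ℝ]) (X q) = 0 from hX.2 q, neg_zero, zero_add, real_inner_comm]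

/-! ### Integration by parts and weak gradients -/

theorem memLp_of_continuous {V : Type} [NormedAddCommGroup V] {f : H1 → V} (hf : Continuous f)
    (p : ENNReal) [SecondCountableTopologyEither H1 V] : MemLp f p sigma :=
  hf.memLp_of_hasCompactSupport (HasCompactSupport.of_compactSpace f)

theorem integrable_of_continuous {f : H1 → ℝ} (hf : Continuous f) : Integrable f sigma :=
  memLp_one_iff_integrable.1 (memLp_of_continuous hf 1)

/-- The left-invariant vector fields are divergence free, because the surface measure is invariant
under right translations. -/
theorem integral_frameDeriv {f : H1 → ℝ} (hf : SmoothFun f) (a : Fin 3) :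
    ∫ q, frameDeriv a f q ∂sigma = 0 := by
  have hc : Continuous (frameDeriv a f) := (contMDiff_frameDeriv hf a).continuous
  obtain ⟨C, hC⟩ := (isCompact_range hc).isBounded.exists_norm_le
  have h1 := (hasDerivAt_integral_of_dominated_loc_of_deriv_le (μ := sigma) (𝕜 := ℝ)
    (F := fun t q => f (q * rot a t)) (F' := fun t q => frameDeriv a f (q * rot a t)) (x₀ := 0)
    (s := univ) (bound := fun _ => C) univ_mem
    (Eventually.of_forall fun t =>
      ((hf.continuous.comp (continuous_mul_const _)).aestronglyMeasurable))
    (by simpa using integrable_of_continuous hf.continuous)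
    ((hc.comp (continuous_mul_const _)).aestronglyMeasurable)
    (ae_of_all _ fun q t _ => hC _ ⟨_, rfl⟩) (integrable_const C)
    (ae_of_all _ fun q t _ => hasDerivAt_mul_rot hf a q t)).2
  have h2 : (fun t => ∫ q, f (q * rot a t) ∂sigma) = fun _ => ∫ q, f q ∂sigma :=
    funext fun t => integral_mul_right_eq_self f (rot a t)
  rw [h2] at h1
  simpa using h1.unique (hasDerivAt_const _ _)

theorem SmoothFun.mul {f g : H1 → ℝ} (hf : SmoothFun f) (hg : SmoothFun g) :
    SmoothFun fun q => f q * g q := ContMDiff.mul hf hg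

theorem frameDeriv_mul {f g : H1 → ℝ} (hf : SmoothFun f) (hg : SmoothFun g) (a : Fin 3) (q : H1) :
    frameDeriv a (fun q => f q * g q) q = frameDeriv a f q * g q + f q * frameDeriv a g q := by
  have : HasDerivAt (fun t => f (q * rot a t) * g (q * rot a t)) _ 0 :=
    (hasDerivAt_frameDeriv hf a q).mul (hasDerivAt_frameDeriv hg a q)
  simpa [frameDeriv] using this.deriv

theorem integral_mul_frameDeriv {f g : H1 → ℝ} (hf : SmoothFun f) (hg : SmoothFun g)
    (a : Fin 3) :
    ∫ q, f q * frameDeriv a g q ∂sigma = -∫ q, frameDeriv a f q * g q ∂sigma := by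
  have h := integral_frameDeriv (hf.mul hg) a
  simp_rw [frameDeriv_mul hf hg] at h
  rw [integral_add] at h
  · linarith
  · exact integrable_of_continuous ((contMDiff_frameDeriv hf a).continuous.mul hg.continuous)
  · exact integrable_of_continuous (hf.continuous.mul (contMDiff_frameDeriv hg a).continuous)

theorem contMDiff_frame (a : Fin 3) :
    ContMDiff (𝓡 3) 𝓘(ℝ, ℍ[ℝ]) ∞ fun q : H1 => (q : ℍ[ℝ]) * imUnit a :=
  contMDiff_of_ambient (F := fun x => x * imUnit a) fun _ => contDiffAt_id.mul contDiffAt_const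

theorem contMDiff_inner {X Y : H1 → ℍ[ℝ]} (hX : ContMDiff (𝓡 3) 𝓘(ℝ, ℍ[ℝ]) ∞ X)
    (hY : ContMDiff (𝓡 3) 𝓘(ℝ, ℍ[ℝ]) ∞ Y) : SmoothFun fun q => inner ℝ (X q) (Y q) :=
  (contDiff_inner (𝕜 := ℝ)).contMDiff.comp (hX.prodMk_space hY)

theorem smoothTangentField_frame {f : H1 → ℝ} (hf : SmoothFun f) (a : Fin 3) :
    SmoothTangentField fun q => f q • ((q : ℍ[ℝ]) * imUnit a) := by
  refine ⟨ContMDiff.smul hf (contMDiff_frame a), fun q => ?_⟩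
  rw [dot, inner_smul_right, inner_self_mul_imUnit, mul_zero]

theorem sphereDiv_frame {f : H1 → ℝ} (hf : SmoothFun f) (a : Fin 3) (q : H1) :
    sphereDiv (fun q => f q • ((q : ℍ[ℝ]) * imUnit a)) q = frameDeriv a f q := by
  rw [sphereDiv_eq_sum (smoothTangentField_frame hf a), Finset.sum_eq_single a]
  · congr 1
    ext p
    rw [real_inner_smul_left, inner_frame, if_pos rfl, mul_one]
  · intro c _ hca
    have : (fun p : H1 => inner ℝ (f p • ((p : ℍ[ℝ]) * imUnit a)) ((p : ℍ[ℝ]) * imUnit c))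
        = fun _ => 0 := by
      ext p
      rw [real_inner_smul_left, inner_frame, if_neg hca.symm, mul_zero]
    rw [this, frameDeriv, deriv_const]
  · simp

/-- The weak gradient tested against a multiple of a frame field. -/
theorem HasWeakGradient.integral_mul_frameDeriv {ψ : H1 → ℝ} {G : H1 → ℍ[ℝ]}
    (h : HasWeakGradient ψ G) {f : H1 → ℝ} (hf : SmoothFun f) (a : Fin 3) :
    ∫ q, ψ q * frameDeriv a f q ∂sigma
      = -∫ q, inner ℝ (G q) ((q : ℍ[ℝ]) * imUnit a) * f q ∂sigma := by
  have := h.integral_eq _ (smoothTangentField_frame hf a)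
  simp_rw [sphereDiv_frame hf, dot, inner_smul_right] at this
  rw [this]
  congr 2
  ext q
  ring

theorem hasWeakGradient_sphereGrad {f : H1 → ℝ} (hf : SmoothFun f) :
    HasWeakGradient f (sphereGrad f) where
  memLp := memLp_of_continuous hf.continuous 2
  memLp_grad := memLp_of_continuous (contMDiff_sphereGrad hf).continuous 2
  tangent := ae_of_all _ fun q => inner_sphereGrad_self hf q
  integral_eq X hX := by
    have hXa : ∀ a, SmoothFun fun q => inner ℝ (X q) ((q : ℍ[ℝ]) * imUnit a) := fun a =>
      contMDiff_inner hX.1 (contMDiff_frame a)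
    have h1 : ∀ q, f q * sphereDiv X q = ∑ a, f q *
        frameDeriv a (fun q => inner ℝ (X q) ((q : ℍ[ℝ]) * imUnit a)) q := fun q => by
      rw [sphereDiv_eq_sum hX, Finset.mul_sum]
    have h2 : ∀ q, dot (sphereGrad f q) (X q) = ∑ a, frameDeriv a f q *
        inner ℝ (X q) ((q : ℍ[ℝ]) * imUnit a) := fun q => by
      rw [dot, inner_eq_sum_frame q, real_inner_comm, inner_sphereGrad_self hf, zero_mul, zero_add]
      simp_rw [inner_sphereGrad_frame hf]
    have i1 : ∀ a, Integrable (fun q => f q *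
        frameDeriv a (fun q => inner ℝ (X q) ((q : ℍ[ℝ]) * imUnit a)) q) sigma := fun a =>
      integrable_of_continuous (hf.continuous.mul (contMDiff_frameDeriv (hXa a) a).continuous)
    have i2 : ∀ a, Integrable (fun q => frameDeriv a f q *
        inner ℝ (X q) ((q : ℍ[ℝ]) * imUnit a)) sigma := fun a =>
      integrable_of_continuous ((contMDiff_frameDeriv hf a).continuous.mul (hXa a).continuous)
    simp_rw [h1, h2]
    rw [integral_finsetSum _ fun a _ => i1 a, integral_finsetSum _ fun a _ => i2 a,
      ← Finset.sum_neg_distrib]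
    exact Finset.sum_congr rfl fun a _ => GCIQuat.integral_mul_frameDeriv hf (hXa a) a

theorem memLp_inner {X Y : H1 → ℍ[ℝ]} (hX : MemLp X 2 sigma) (hY : Continuous Y) :
    MemLp (fun q => inner ℝ (X q) (Y q)) 2 sigma := by
  obtain ⟨C, hC⟩ := (isCompact_range hY).isBounded.exists_norm_le
  refine (hX.norm.const_mul C).mono (hX.1.inner hY.aestronglyMeasurable) (ae_of_all _ fun q => ?_)
  rw [Real.norm_eq_abs, Real.norm_eq_abs, abs_mul, abs_norm]
  calc _ ≤ ‖X q‖ * ‖Y q‖ := abs_real_inner_le_norm _ _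
    _ ≤ |C| * ‖X q‖ := by
      rw [mul_comm]
      gcongr
      exact (hC _ ⟨q, rfl⟩).trans (le_abs_self C)

theorem memLp_frame {G : H1 → ℍ[ℝ]} (hG : MemLp G 2 sigma) (a : Fin 3) :
    MemLp (fun q : H1 => inner ℝ (G q) ((q : ℍ[ℝ]) * imUnit a)) 2 sigma :=
  memLp_inner hG (contMDiff_frame a).continuous

theorem memLp_continuous_mul {f g : H1 → ℝ} (hf : Continuous f) (hg : MemLp g 2 sigma) :
    MemLp (fun q => f q * g q) 2 sigma := by
  obtain ⟨C, hC⟩ := (isCompact_range hf).isBounded.exists_norm_le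
  refine hg.of_le_mul (c := C) (hf.aestronglyMeasurable.mul hg.1) (ae_of_all _ fun q => ?_)
  rw [norm_mul]
  gcongr
  exact hC _ ⟨q, rfl⟩

theorem integrable_mul_of_memLp {f g : H1 → ℝ} (hf : MemLp f 2 sigma) (hg : MemLp g 2 sigma) :
    Integrable (fun q => f q * g q) sigma := hf.integrable_mul hg

theorem HasWeakGradient.congr_ae {ψ ψ' : H1 → ℝ} {G : H1 → ℍ[ℝ]} (h : HasWeakGradient ψ G)
    (he : ψ' =ᵐ[sigma] ψ) : HasWeakGradient ψ' G where
  memLp := h.memLp.ae_eq he.symm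
  memLp_grad := h.memLp_grad
  tangent := h.tangent
  integral_eq X hX := by
    rw [← h.integral_eq X hX]
    refine integral_congr_ae ?_
    filter_upwards [he] with q hq
    rw [hq]

theorem continuous_sphereDiv {X : H1 → ℍ[ℝ]} (hX : SmoothTangentField X) :
    Continuous (sphereDiv X) := by
  have h1 : ∀ q, sphereDiv X q = _ := sphereDiv_eq_sum hX
  rw [show sphereDiv X = _ from funext h1]
  exact continuous_finsetSum _ fun a _ =>
    (contMDiff_frameDeriv (contMDiff_inner hX.1 (contMDiff_frame a)) a).continuous

theorem HasWeakGradient.add_const_mul {ψ ψ' : H1 → ℝ} {G G' : H1 → ℍ[ℝ]}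
    (h : HasWeakGradient ψ G) (h' : HasWeakGradient ψ' G') (c : ℝ) :
    HasWeakGradient (fun q => ψ q + c * ψ' q) (fun q => G q + c • G' q) where
  memLp := h.memLp.add (h'.memLp.const_mul c)
  memLp_grad := h.memLp_grad.add (h'.memLp_grad.const_smul c)
  tangent := by
    filter_upwards [h.tangent, h'.tangent] with q h1 h2
    rw [dot] at *
    rw [inner_add_right, inner_smul_right, h1, h2]
    simp
  integral_eq X hX := by
    have hd := memLp_of_continuous (continuous_sphereDiv hX) 2
    have i1 := integrable_mul_of_memLp h.memLp hd
    have i2 := (integrable_mul_of_memLp h'.memLp hd).const_mul c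
    have j1 := (memLp_inner h.memLp_grad hX.1.continuous).integrable (by norm_num)
    have j2 := ((memLp_inner h'.memLp_grad hX.1.continuous).integrable (by norm_num)).const_mul c
    have e1 : ∀ q, (ψ q + c * ψ' q) * sphereDiv X q
        = ψ q * sphereDiv X q + c * (ψ' q * sphereDiv X q) := fun q => by ring
    have e2 : ∀ q, dot (G q + c • G' q) (X q)
        = inner ℝ (G q) (X q) + c * inner ℝ (G' q) (X q) := fun q => by
      rw [dot, inner_add_left, real_inner_smul_left]
    simp_rw [e1, e2]
    rw [integral_add i1 i2, integral_add j1 j2, integral_const_mul, integral_const_mul,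
      h.integral_eq X hX, h'.integral_eq X hX]
    simp only [dot]
    ring

/-! ### Mollification on the group of unit quaternions -/

section Parametric

variable {F : Type} [NormedAddCommGroup F] [NormedSpace ℝ F]

theorem integrable_smul_comp {Φ : ℍ[ℝ] × ℍ[ℝ] → F} (hΦ : Continuous Φ) {g : H1 → ℝ}
    (hg : Integrable g sigma) (x : ℍ[ℝ]) : Integrable (fun p : H1 => g p • Φ (x, p)) sigma := by
  have hc : Continuous fun p : H1 => Φ (x, p) := by fun_prop
  obtain ⟨C, hC⟩ := (isCompact_range hc).isBounded.exists_norm_le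
  exact hg.smul_bdd C (hc.stronglyMeasurable_of_hasCompactSupport
    (HasCompactSupport.of_compactSpace _)).aestronglyMeasurable
    (ae_of_all _ fun p => hC _ ⟨p, rfl⟩)

theorem hasFDerivAt_integral_smul [CompleteSpace F] {Φ : ℍ[ℝ] × ℍ[ℝ] → F}
    (hΦ : ContDiff ℝ ∞ Φ) {g : H1 → ℝ} (hg : Integrable g sigma) (x : ℍ[ℝ]) :
    HasFDerivAt (fun x => ∫ p : H1, g p • Φ (x, p) ∂sigma)
      (∫ p : H1, g p • (fderiv ℝ Φ (x, p)).comp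
        (ContinuousLinearMap.inl ℝ ℍ[ℝ] ℍ[ℝ]) ∂sigma) x := by
  set Φ' : ℍ[ℝ] × ℍ[ℝ] → ℍ[ℝ] →L[ℝ] F := fun z =>
    (fderiv ℝ Φ z).comp (ContinuousLinearMap.inl ℝ ℍ[ℝ] ℍ[ℝ]) with hΦ'
  have hΦ'c : Continuous Φ' := (hΦ.continuous_fderiv (by simp)).clm_comp continuous_const
  obtain ⟨C, hC⟩ := ((isCompact_closedBall x 1).prod
    (isCompact_sphere (0 : ℍ[ℝ]) 1)).exists_bound_of_continuousOn
    (E := ℍ[ℝ] →L[ℝ] F) (f := Φ') hΦ'c.continuousOn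
  refine hasFDerivAt_integral_of_dominated_of_fderiv_le (𝕜 := ℝ)
    (F' := fun x (p : H1) => g p • Φ' (x, p)) (s := Metric.ball x 1)
    (bound := fun p => |g p| * C) (Metric.ball_mem_nhds x one_pos)
    (Eventually.of_forall fun y => (integrable_smul_comp hΦ.continuous hg y).1)
    (integrable_smul_comp hΦ.continuous hg x) (integrable_smul_comp hΦ'c hg x).1
    (ae_of_all _ fun p y hy => ?_) (hg.abs.mul_const C) (ae_of_all _ fun p y _ => ?_)
  · rw [norm_smul, Real.norm_eq_abs]
    gcongr
    exact hC (y, p) ⟨Metric.ball_subset_closedBall hy, p.2⟩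
  · have h1 : HasFDerivAt Φ (fderiv ℝ Φ (y, p)) (y, (p : ℍ[ℝ])) :=
      (hΦ.differentiable (by simp) _).hasFDerivAt
    exact (h1.comp y (hasFDerivAt_prodMk_left y (p : ℍ[ℝ]))).const_smul (g p)

end Parametric

theorem contDiff_integral_smul (n : ℕ) : ∀ {F : Type} [NormedAddCommGroup F] [NormedSpace ℝ F]
    [CompleteSpace F] {Φ : ℍ[ℝ] × ℍ[ℝ] → F}, ContDiff ℝ ∞ Φ → ∀ {g : H1 → ℝ},
    Integrable g sigma → ContDiff ℝ n fun x => ∫ p : H1, g p • Φ (x, p) ∂sigma := by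
  induction n with
  | zero =>
    intro F _ _ _ Φ hΦ g hg
    exact contDiff_zero.2 (continuous_iff_continuousAt.2 fun x =>
      (hasFDerivAt_integral_smul hΦ hg x).continuousAt)
  | succ n ih =>
    intro F _ _ _ Φ hΦ g hg
    push_cast
    rw [contDiff_succ_iff_hasFDerivAt]
    refine ⟨_, ih (Φ := fun z => (fderiv ℝ Φ z).comp (ContinuousLinearMap.inl ℝ ℍ[ℝ] ℍ[ℝ])) ?_ hg,
      fun x => hasFDerivAt_integral_smul hΦ hg x⟩
    exact (hΦ.fderiv_right (m := ∞) (by simp)).clm_comp contDiff_const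

/-- The zonal mollification `q ↦ ∫ ρ(p · q) ψ(p) dp`. It is a convolution on the group of unit
quaternions, as `p · q` is the real part of `p q⁻¹`. -/
noncomputable def moll (ρ : ℝ → ℝ) (ψ : H1 → ℝ) (q : H1) : ℝ :=
  ∫ p : H1, ψ p * ρ (inner ℝ (q : ℍ[ℝ]) (p : ℍ[ℝ])) ∂sigma

theorem smoothFun_moll {ρ : ℝ → ℝ} (hρ : ContDiff ℝ ∞ ρ) {ψ : H1 → ℝ} (hψ : Integrable ψ sigma) :
    SmoothFun (moll ρ ψ) := by
  have h : ContDiff ℝ ∞ fun x : ℍ[ℝ] => ∫ p : H1, ψ p • ρ (inner ℝ x (p : ℍ[ℝ])) ∂sigma :=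
    contDiff_infty.2 fun n => contDiff_integral_smul n
      (Φ := fun z : ℍ[ℝ] × ℍ[ℝ] => ρ (inner ℝ z.1 z.2)) (hρ.comp contDiff_inner) hψ
  exact contMDiff_of_ambient fun q => h.contDiffAt

theorem inner_mul_imUnit (x y : ℍ[ℝ]) (a : Fin 3) :
    inner ℝ (x * imUnit a) y = -inner ℝ x (y * imUnit a) := by
  simp only [Quaternion.inner_def, Quaternion.re_mul, Quaternion.imI_mul, Quaternion.imJ_mul,
    Quaternion.imK_mul, Quaternion.re_star, Quaternion.imI_star, Quaternion.imJ_star,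
    Quaternion.imK_star, star_mul]
  fin_cases a <;> simp <;> ring

theorem hasFDerivAt_comp_inner {ρ : ℝ → ℝ} (hρ : ContDiff ℝ ∞ ρ) (y x : ℍ[ℝ]) :
    HasFDerivAt (fun x => ρ (inner ℝ y x)) (deriv ρ (inner ℝ y x) • innerSL ℝ y) x :=
  ((hρ.differentiable (by simp) _).hasDerivAt).comp_hasFDerivAt x (innerSL ℝ y).hasFDerivAt

theorem smoothFun_comp_inner {ρ : ℝ → ℝ} (hρ : ContDiff ℝ ∞ ρ) (y : ℍ[ℝ]) :
    SmoothFun fun p : H1 => ρ (inner ℝ y (p : ℍ[ℝ])) :=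
  contMDiff_of_ambient (F := fun x => ρ (inner ℝ y x)) fun _ =>
    (hρ.comp (innerSL ℝ y).contDiff).contDiffAt

/-- Mollification commutes with the frame derivatives, because `(q u) · p = -q · (p u)` for an
imaginary unit `u`. -/
theorem frameDeriv_moll {ρ : ℝ → ℝ} (hρ : ContDiff ℝ ∞ ρ) {ψ : H1 → ℝ} {G : H1 → ℍ[ℝ]}
    (h : HasWeakGradient ψ G) (a : Fin 3) (q : H1) :
    frameDeriv a (moll ρ ψ) q
      = moll ρ (fun p => inner ℝ (G p) ((p : ℍ[ℝ]) * imUnit a)) q := by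
  have hψ : Integrable ψ sigma := h.memLp.integrable (by norm_num)
  have hΦ : ContDiff ℝ ∞ fun z : ℍ[ℝ] × ℍ[ℝ] => ρ (inner ℝ z.1 z.2) := hρ.comp contDiff_inner
  have h1 := frameDeriv_eq_of_ambient (f := moll ρ ψ) (q := q) a
    (hasFDerivAt_integral_smul hΦ hψ q) fun p => rfl
  have hint := integrable_smul_comp (Φ := fun z =>
    (fderiv ℝ (fun z : ℍ[ℝ] × ℍ[ℝ] => ρ (inner ℝ z.1 z.2)) z).comp
      (ContinuousLinearMap.inl ℝ ℍ[ℝ] ℍ[ℝ]))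
      ((hΦ.continuous_fderiv (by simp)).clm_comp continuous_const) hψ q
  rw [h1, ContinuousLinearMap.integral_apply hint]
  have h2 : ∀ p : H1, frameDeriv a (fun p : H1 => ρ (inner ℝ (q : ℍ[ℝ]) (p : ℍ[ℝ]))) p
      = deriv ρ (inner ℝ (q : ℍ[ℝ]) (p : ℍ[ℝ])) * inner ℝ (q : ℍ[ℝ]) (p * imUnit a) := fun p => by
    rw [frameDeriv_eq_of_ambient a (hasFDerivAt_comp_inner hρ (q : ℍ[ℝ]) p) fun _ => rfl]
    simp
  have h3 : ∀ p : H1, (ψ p • (fderiv ℝ (fun z : ℍ[ℝ] × ℍ[ℝ] => ρ (inner ℝ z.1 z.2))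
      ((q : ℍ[ℝ]), (p : ℍ[ℝ]))).comp (ContinuousLinearMap.inl ℝ ℍ[ℝ] ℍ[ℝ])) (q * imUnit a)
      = -(ψ p * frameDeriv a (fun p : H1 => ρ (inner ℝ (q : ℍ[ℝ]) (p : ℍ[ℝ]))) p) := fun p => by
    have e1 : HasFDerivAt (fun x : ℍ[ℝ] => ρ (inner ℝ x (p : ℍ[ℝ])))
        ((fderiv ℝ (fun z : ℍ[ℝ] × ℍ[ℝ] => ρ (inner ℝ z.1 z.2))
          ((q : ℍ[ℝ]), (p : ℍ[ℝ]))).comp (ContinuousLinearMap.inl ℝ ℍ[ℝ] ℍ[ℝ])) q :=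
      ((hΦ.differentiable (by simp) _).hasFDerivAt).comp (q : ℍ[ℝ])
        (hasFDerivAt_prodMk_left (q : ℍ[ℝ]) (p : ℍ[ℝ]))
    have e2 : HasFDerivAt (fun x : ℍ[ℝ] => ρ (inner ℝ x (p : ℍ[ℝ]))) _ (q : ℍ[ℝ]) :=
      (hasFDerivAt_comp_inner hρ (p : ℍ[ℝ]) q).congr_of_eventuallyEq
        (Eventually.of_forall fun x => by simp only [real_inner_comm])
    rw [e1.unique e2, h2]
    simp only [smul_apply, innerSL_apply_apply, smul_eq_mul]
    rw [real_inner_comm _ (p : ℍ[ℝ]), real_inner_comm ((q : ℍ[ℝ]) * imUnit a), inner_mul_imUnit]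
    ring
  simp_rw [h3]
  rw [integral_neg, h.integral_mul_frameDeriv (smoothFun_comp_inner hρ q), neg_neg, moll]

/-- Pairing with a mollification is an average over the group of pairings with translates. -/
theorem integral_mul_moll {ρ : ℝ → ℝ} (hρ : Continuous ρ) {a b : H1 → ℝ}
    (ha : Integrable a sigma) (hb : Integrable b sigma) :
    ∫ q, a q * moll ρ b q ∂sigma
      = ∫ g : H1, ρ (inner ℝ (1 : ℍ[ℝ]) (g : ℍ[ℝ])) * ∫ q, a q * b (g * q) ∂sigma ∂sigma := by
  have hρc : Continuous fun g : H1 => ρ (inner ℝ (1 : ℍ[ℝ]) (g : ℍ[ℝ])) := by fun_prop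
  obtain ⟨C, hC⟩ := (isCompact_range hρc).isBounded.exists_norm_le
  have hin : ∀ q g : H1, inner ℝ (q : ℍ[ℝ]) ((g * q : H1) : ℍ[ℝ])
      = inner ℝ (1 : ℍ[ℝ]) (g : ℍ[ℝ]) := fun q g => by
    have := (rightMul q).inner_map_map 1 (g : ℍ[ℝ])
    simpa using this
  have hm : MeasurePreserving (fun z : H1 × H1 => (z.1, z.2 * z.1)) (sigma.prod sigma)
      (sigma.prod sigma) := measurePreserving_prod_mul_right sigma sigma
  have h1 : Integrable (fun z : H1 × H1 => a z.1 * b (z.2 * z.1)) (sigma.prod sigma) :=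
    hm.integrable_comp_of_integrable (ha.mul_prod hb)
  have h2 : Integrable (fun z : H1 × H1 =>
      ρ (inner ℝ (1 : ℍ[ℝ]) (z.2 : ℍ[ℝ])) * (a z.1 * b (z.2 * z.1))) (sigma.prod sigma) :=
    h1.bdd_mul (c := C) (hρc.comp continuous_snd).aestronglyMeasurable
      (ae_of_all _ fun z => hC _ ⟨z.2, rfl⟩)
  calc ∫ q, a q * moll ρ b q ∂sigma
      = ∫ q, ∫ g : H1, ρ (inner ℝ (1 : ℍ[ℝ]) (g : ℍ[ℝ])) * (a q * b (g * q)) ∂sigma ∂sigma := by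
        refine integral_congr_ae (ae_of_all _ fun q => ?_)
        simp only
        rw [moll, ← integral_mul_right_eq_self _ q, ← integral_const_mul]
        refine integral_congr_ae (ae_of_all _ fun g => ?_)
        simp only [hin]
        ring
    _ = _ := by
        rw [integral_integral_swap h2]
        simp_rw [integral_const_mul]

theorem continuous_integral_mul_translate {a b : H1 → ℝ} (ha : MemLp a 2 sigma)
    (hb : MemLp b 2 sigma) : Continuous fun g : H1 => ∫ q, a q * b (g * q) ∂sigma := by
  let c : H1 → C(H1, H1) := fun g => ⟨fun q => g * q, continuous_const_mul g⟩
  have hcont : Continuous c :=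
    (ContinuousMap.curry ⟨fun z : H1 × H1 => z.1 * z.2, continuous_mul⟩).continuous
  have hmp : ∀ g, MeasurePreserving (c g) sigma sigma := fun g => measurePreserving_mul_left sigma g
  have h1 : Continuous fun g => Lp.compMeasurePreserving (c g) (hmp g) (hb.toLp b) :=
    continuous_const.compMeasurePreservingLp hcont hmp (by norm_num)
  have h2 : Continuous fun g => inner ℝ (ha.toLp a)
      (Lp.compMeasurePreserving (c g) (hmp g) (hb.toLp b)) := continuous_const.inner h1
  refine h2.congr fun g => ?_
  rw [L2.inner_def]
  refine integral_congr_ae ?_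
  filter_upwards [ha.coeFn_toLp, Lp.coeFn_compMeasurePreserving (hb.toLp b) (hmp g),
    (hmp g).quasiMeasurePreserving.ae_eq_comp hb.coeFn_toLp] with q e1 e2 e3
  rw [e1, e2, e3]
  simp [c, mul_comm]

/-- There are smooth zonal kernels whose mollifications converge weakly to the identity. -/
theorem exists_mollifier : ∃ ρ : ℕ → ℝ → ℝ, (∀ n, ContDiff ℝ ∞ (ρ n)) ∧
    ∀ a b : H1 → ℝ, MemLp a 2 sigma → MemLp b 2 sigma →
      Tendsto (fun n => ∫ q, a q * moll (ρ n) b q ∂sigma) atTop (𝓝 (∫ q, a q * b q ∂sigma)) := by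
  -- As `‖g - 1‖² = 2 - 2 (1 · g)`, the kernel `η n (1 · g)` is supported near `g = 1`.
  set η : ℕ → ℝ → ℝ := fun n t => expNegInvGlue (t - (1 - 1 / (n + 1))) with hη
  have hηs : ∀ n, ContDiff ℝ ∞ (η n) := fun n =>
    expNegInvGlue.contDiff.comp (contDiff_id.sub contDiff_const)
  have hη0 : ∀ n t, 0 ≤ η n t := fun n t => expNegInvGlue.nonneg _
  have hηc : ∀ n, Continuous fun g : H1 => η n (inner ℝ (1 : ℍ[ℝ]) (g : ℍ[ℝ])) := fun n =>
    (hηs n).continuous.comp (by fun_prop)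
  have hηi : ∀ n, Integrable (fun g : H1 => η n (inner ℝ (1 : ℍ[ℝ]) (g : ℍ[ℝ]))) sigma := fun n =>
    integrable_of_continuous (hηc n)
  set c : ℕ → ℝ := fun n => ∫ g : H1, η n (inner ℝ (1 : ℍ[ℝ]) (g : ℍ[ℝ])) ∂sigma with hc
  have hc0 : ∀ n, 0 < c n := fun n =>
    (hηc n).integral_pos_of_hasCompactSupport_nonneg_nonzero
      (HasCompactSupport.of_compactSpace _) (fun g => hη0 n _) (x := 1) (by
        have : 0 < 1 - (1 - 1 / ((n : ℝ) + 1)) := by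
          have : 0 < 1 / ((n : ℝ) + 1) := by positivity
          linarith
        simpa [hη] using (expNegInvGlue.pos_of_pos this).ne')
  refine ⟨fun n t => (c n)⁻¹ * η n t, fun n => contDiff_const.mul (hηs n), fun a b ha hb => ?_⟩
  set Θ : H1 → ℝ := fun g => ∫ q, a q * b (g * q) ∂sigma with hΘ
  have hΘc : Continuous Θ := continuous_integral_mul_translate ha hb
  have hΘ1 : ∫ q, a q * b q ∂sigma = Θ 1 := by simp [hΘ]
  rw [hΘ1, Metric.tendsto_atTop]
  intro ε hε
  obtain ⟨δ, hδ, hδε⟩ := Metric.continuousAt_iff.1 (hΘc.continuousAt (x := 1)) (ε / 2) (half_pos hε)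
  obtain ⟨N, hN⟩ := exists_nat_one_div_lt (show (0 : ℝ) < δ ^ 2 / 2 by positivity)
  refine ⟨N, fun n hn => ?_⟩
  rw [integral_mul_moll (ρ := fun t => (c n)⁻¹ * η n t)
    (continuous_const.mul (hηs n).continuous) (ha.integrable (by norm_num))
    (hb.integrable (by norm_num))]
  have e1 : (∫ g : H1, (c n)⁻¹ * η n (inner ℝ (1 : ℍ[ℝ]) (g : ℍ[ℝ])) * Θ g ∂sigma) - Θ 1
      = (c n)⁻¹ * ∫ g : H1, η n (inner ℝ (1 : ℍ[ℝ]) (g : ℍ[ℝ])) * (Θ g - Θ 1) ∂sigma := by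
    simp_rw [mul_sub, mul_assoc]
    have hi : Integrable (fun g : H1 => η n (inner ℝ (1 : ℍ[ℝ]) (g : ℍ[ℝ])) * Θ g) sigma :=
      integrable_of_continuous ((hηc n).mul hΘc)
    rw [integral_sub hi ((hηi n).mul_const _),
      integral_const_mul, integral_mul_const, mul_sub, ← mul_assoc (c n)⁻¹ (∫ _, _ ∂sigma) (Θ 1)]
    change _ = _ - (c n)⁻¹ * c n * Θ 1
    rw [inv_mul_cancel₀ (hc0 n).ne', one_mul]
  rw [Real.dist_eq, e1, abs_mul, abs_of_pos (inv_pos.2 (hc0 n)), inv_mul_lt_iff₀ (hc0 n)]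
  have e2 : ∀ g : H1, ‖η n (inner ℝ (1 : ℍ[ℝ]) (g : ℍ[ℝ])) * (Θ g - Θ 1)‖
      ≤ η n (inner ℝ (1 : ℍ[ℝ]) (g : ℍ[ℝ])) * (ε / 2) := by
    intro g
    rw [norm_mul, Real.norm_eq_abs, abs_of_nonneg (hη0 n _)]
    by_cases hg : inner ℝ (1 : ℍ[ℝ]) (g : ℍ[ℝ]) ≤ 1 - 1 / ((n : ℝ) + 1)
    · have : η n (inner ℝ (1 : ℍ[ℝ]) (g : ℍ[ℝ])) = 0 :=
        expNegInvGlue.zero_of_nonpos (by linarith)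
      rw [this, zero_mul, zero_mul]
    · refine mul_le_mul_of_nonneg_left ?_ (hη0 n _)
      refine (hδε ?_).le
      rw [Subtype.dist_eq, dist_eq_norm, Metric.unitSphere.coe_one]
      have e3 : ‖(g : ℍ[ℝ]) - 1‖ ^ 2 = 2 - 2 * inner ℝ (1 : ℍ[ℝ]) (g : ℍ[ℝ]) := by
        rw [norm_sub_sq_real, norm_eq_of_mem_sphere, norm_one, real_inner_comm]
        ring
      have e4 : 1 / ((n : ℝ) + 1) ≤ 1 / ((N : ℝ) + 1) := by
        gcongr
      refine lt_of_pow_lt_pow_left₀ 2 hδ.le ?_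
      rw [e3]
      linarith
  calc |∫ g : H1, η n (inner ℝ (1 : ℍ[ℝ]) (g : ℍ[ℝ])) * (Θ g - Θ 1) ∂sigma|
      ≤ ∫ g : H1, η n (inner ℝ (1 : ℍ[ℝ]) (g : ℍ[ℝ])) * (ε / 2) ∂sigma :=
        norm_integral_le_of_norm_le ((hηi n).mul_const _) (ae_of_all _ e2)
    _ = c n * (ε / 2) := integral_mul_const _ _
    _ < c n * ε := by
        have := hc0 n
        gcongr
        linarith

/-- Smooth functions are weakly dense in `H¹`: a continuous linear relation between a function and
its gradient that holds for smooth functions holds on `H¹`. -/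
theorem HasWeakGradient.sum_integral_eq_zero {A : Fin 3 → H1 → ℝ} {B : H1 → ℝ}
    (hA : ∀ a, MemLp (A a) 2 sigma) (hB : MemLp B 2 sigma)
    (h : ∀ φ, SmoothFun φ →
      (∑ a, ∫ q, A a q * frameDeriv a φ q ∂sigma) + ∫ q, B q * φ q ∂sigma = 0)
    {ψ : H1 → ℝ} {G : H1 → ℍ[ℝ]} (hψ : HasWeakGradient ψ G) :
    (∑ a, ∫ q : H1, A a q * inner ℝ (G q) ((q : ℍ[ℝ]) * imUnit a) ∂sigma)
      + ∫ q, B q * ψ q ∂sigma = 0 := by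
  obtain ⟨ρ, hρ, hlim⟩ := exists_mollifier
  have h1 : Tendsto (fun n => (∑ a, ∫ q, A a q * moll (ρ n)
      (fun p => inner ℝ (G p) ((p : ℍ[ℝ]) * imUnit a)) q ∂sigma)
      + ∫ q, B q * moll (ρ n) ψ q ∂sigma) atTop (𝓝 _) :=
    (tendsto_finsetSum _ fun a _ => hlim _ _ (hA a) (memLp_frame hψ.memLp_grad a)).add
      (hlim _ _ hB hψ.memLp)
  refine tendsto_nhds_unique h1 (tendsto_const_nhds.congr fun n => ?_)
  rw [← h _ (smoothFun_moll (hρ n) (hψ.memLp.integrable (by norm_num)))]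
  simp_rw [frameDeriv_moll (hρ n) hψ]

theorem eq_const_of_frameDeriv_eq_zero {f : H1 → ℝ} (hf : SmoothFun f)
    (h : ∀ a q, frameDeriv a f q = 0) (p q : H1) : f p = f q := by
  have h0 : ∀ q : H1, fderiv ℝ (radialExt f) q = 0 := by
    intro q
    obtain ⟨b, hb0, hb1⟩ := exists_orthonormalBasis q
    refine ContinuousLinearMap.coe_injective (b.toBasis.ext fun i => ?_)
    refine Fin.cases ?_ (fun a => ?_) i
    · simp [hb0, fderiv_radialExt_self hf]
    · simp [hb1, ← frameDeriv_eq_fderiv hf, h]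
  have h1 : ∀ x : ℍ[ℝ], x ≠ 0 → fderiv ℝ (radialExt f) x = 0 := by
    intro x hx
    have hx' : 0 < ‖x‖⁻¹ := by positivity
    let q : H1 := ⟨‖x‖⁻¹ • x, by
      rw [mem_sphere_zero_iff_norm, norm_smul, norm_inv, norm_norm,
        inv_mul_cancel₀ (norm_ne_zero_iff.mpr hx)]⟩
    have e1 : HasFDerivAt (radialExt f) (0 : ℍ[ℝ] →L[ℝ] ℝ) (‖x‖⁻¹ • x) := by
      rw [← h0 q]; exact hasFDerivAt_radialExt hf q
    have e2 : HasFDerivAt (fun y : ℍ[ℝ] => radialExt f (‖x‖⁻¹ • y)) _ x :=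
      e1.comp x ((hasFDerivAt_id x).const_smul ‖x‖⁻¹)
    simp_rw [radialExt_smul f hx'] at e2
    rw [e2.fderiv, ContinuousLinearMap.zero_comp]
  have h2 := isOpen_compl_singleton.is_const_of_fderiv_eq_zero (𝕜 := ℝ) (f := radialExt f)
    (s := ({0} : Set ℍ[ℝ])ᶜ)
    (isConnected_compl_singleton_of_one_lt_rank (by
      rw [← Module.finrank_eq_rank, Quaternion.finrank_eq_four]; norm_num) 0).isPreconnected
    (fun x hx => ((contDiffAt_radialExt hf hx).differentiableAt (by simp)).differentiableWithinAt)
    (fun x hx => h1 x hx) (coe_ne_zero p) (coe_ne_zero q)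
  simpa using h2

/-- A function whose weak gradient vanishes is almost everywhere constant. -/
theorem HasWeakGradient.ae_eq_const {ψ : H1 → ℝ} {G : H1 → ℍ[ℝ]} (h : HasWeakGradient ψ G)
    (hG : G =ᵐ[sigma] 0) : ∃ c, ψ =ᵐ[sigma] fun _ => c := by
  obtain ⟨ρ, hρ, hlim⟩ := exists_mollifier
  have hψi : Integrable ψ sigma := h.memLp.integrable (by norm_num)
  have h0 : ∀ n a q, frameDeriv a (moll (ρ n) ψ) q = 0 := by
    intro n a q
    rw [frameDeriv_moll (hρ n) h, moll]
    refine integral_eq_zero_of_ae ?_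
    filter_upwards [hG] with p hp
    simp [hp]
  have hconst : ∀ n q, moll (ρ n) ψ q = moll (ρ n) ψ 1 := fun n q =>
    eq_const_of_frameDeriv_eq_zero (smoothFun_moll (hρ n) hψi) (h0 n) q 1
  have hlim' : ∀ b, MemLp b 2 sigma → Tendsto (fun n => (∫ q, b q ∂sigma) * moll (ρ n) ψ 1) atTop
      (𝓝 (∫ q, b q * ψ q ∂sigma)) := fun b hb => by
    refine (hlim b ψ hb h.memLp).congr fun n => ?_
    simp_rw [hconst n, integral_mul_const]
  have hs : sigma.real univ ≠ 0 := sigma_real_univ_pos.ne'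
  -- The mollifications are constants that converge to the mean `m`, so `∫ b ψ = m ∫ b` for every
  -- square integrable `b`; the choice `b = ψ - m` gives `∫ (ψ - m)² = 0`.
  set m := (∫ q, ψ q ∂sigma) / sigma.real univ with hm
  have h1 : Tendsto (fun n => moll (ρ n) ψ 1) atTop (𝓝 m) := by
    have := (hlim' (fun _ => 1) (memLp_const 1)).div_const (sigma.real univ)
    simp only [integral_const, smul_eq_mul, mul_one, one_mul] at this
    exact this.congr fun n => by field_simp
  have h2 : ∀ b, MemLp b 2 sigma → ∫ q, b q * ψ q ∂sigma = (∫ q, b q ∂sigma) * m := fun b hb =>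
    tendsto_nhds_unique (hlim' b hb) (h1.const_mul _)
  have hb : MemLp (fun q => ψ q - m) 2 sigma := h.memLp.sub (memLp_const m)
  have h3 : ∫ q, (ψ q - m) ^ 2 ∂sigma = 0 := by
    have e : ∀ q, (ψ q - m) ^ 2 = (ψ q - m) * ψ q - (ψ q - m) * m := fun q => by ring
    simp_rw [e]
    rw [integral_sub (integrable_mul_of_memLp hb h.memLp)
      ((hb.integrable (by norm_num)).mul_const m), integral_mul_const, h2 _ hb, sub_self]
  refine ⟨m, ?_⟩
  have h4 := (integral_eq_zero_iff_of_nonneg (fun q => sq_nonneg (ψ q - m)) hb.integrable_sq).1 h3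
  filter_upwards [h4] with q hq
  have : (ψ q - m) ^ 2 = 0 := hq
  linarith [pow_eq_zero_iff (two_ne_zero) |>.1 this]

/-! ### The equilibrium and the collision operator -/

theorem smoothFun_exp (d : ℝ) (qbar : H1) :
    SmoothFun fun q => Real.exp (2 / d * (dot (qbar : ℍ[ℝ]) (q : ℍ[ℝ]) ^ 2 - 1 / 4)) :=
  smoothFun_comp_inner (ρ := fun r => Real.exp (2 / d * (r ^ 2 - 1 / 4))) (by fun_prop) _

theorem partitionZ_pos (d : ℝ) (qbar : H1) : 0 < partitionZ d qbar :=
  (smoothFun_exp d qbar).continuous.integral_pos_of_hasCompactSupport_nonneg_nonzero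
    (HasCompactSupport.of_compactSpace _) (fun _ => (Real.exp_pos _).le) (x := 1)
    (Real.exp_pos _).ne'

theorem vonMises_pos (d : ℝ) (qbar q : H1) : 0 < vonMises d qbar q :=
  div_pos (Real.exp_pos _) (partitionZ_pos d qbar)

theorem smoothFun_vonMises (d : ℝ) (qbar : H1) : SmoothFun (vonMises d qbar) :=
  smoothFun_comp_inner
    (ρ := fun r => Real.exp (2 / d * (r ^ 2 - 1 / 4)) / partitionZ d qbar)
    (ContDiff.div_const (by fun_prop) _) _

theorem smoothFun_div_vonMises {f : H1 → ℝ} (hf : SmoothFun f) (d : ℝ) (qbar : H1) :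
    SmoothFun fun q => f q / vonMises d qbar q :=
  ContMDiff.div₀ hf (smoothFun_vonMises d qbar) fun q => (vonMises_pos d qbar q).ne'

theorem smoothTangentField_vonMises_smul {f : H1 → ℝ} (hf : SmoothFun f) (d : ℝ) (qbar : H1) :
    SmoothTangentField fun q => vonMises d qbar q • sphereGrad f q :=
  ⟨ContMDiff.smul (smoothFun_vonMises d qbar) (contMDiff_sphereGrad hf), fun q => by
    rw [dot, inner_smul_right, inner_sphereGrad_self hf, mul_zero]⟩

/-- The operator `∇ · (M ∇ ·)` in its weak form. -/
theorem HasWeakGradient.integral_sphereDiv_mul {ψ : H1 → ℝ} {G : H1 → ℍ[ℝ]}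
    (h : HasWeakGradient ψ G) {f : H1 → ℝ} (hf : SmoothFun f) (d : ℝ) (qbar : H1) :
    ∫ q, sphereDiv (fun q => vonMises d qbar q • sphereGrad f q) q * ψ q ∂sigma
      = -∫ q, vonMises d qbar q * dot (G q) (sphereGrad f q) ∂sigma := by
  have := h.integral_eq _ (smoothTangentField_vonMises_smul hf d qbar)
  simp_rw [mul_comm _ (ψ _), this, dot, inner_smul_right]

theorem continuous_dot (x : ℍ[ℝ]) : Continuous fun q : H1 => dot x (q : ℍ[ℝ]) := by
  unfold dot; fun_prop

theorem inner_secondMoment {f : H1 → ℝ} (hf : Continuous f) (β x : ℍ[ℝ]) :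
    inner ℝ β (secondMoment f x)
      = ∫ q : H1, dot β (q : ℍ[ℝ]) * dot x (q : ℍ[ℝ]) * f q ∂sigma := by
  have hc : Continuous fun q : H1 =>
      f q • InnerProductSpace.rankOne ℝ (q : ℍ[ℝ]) (q : ℍ[ℝ]) := by
    refine hf.smul ?_
    simp only [InnerProductSpace.rankOne_def]
    fun_prop
  have hi := memLp_one_iff_integrable.1 (memLp_of_continuous hc 1)
  rw [secondMoment, ContinuousLinearMap.integral_apply hi,
    ← integral_inner (hi.apply_continuousLinearMap x)]
  refine integral_congr_ae (ae_of_all _ fun q => ?_)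
  simp [dot, inner_smul_right, real_inner_comm x]
  ring

theorem starProjection_secondMoment_eq_zero_iff {f : H1 → ℝ} (hf : Continuous f) (qbar : H1) :
    (Submodule.span ℝ {(qbar : ℍ[ℝ])})ᗮ.starProjection (secondMoment f (qbar : ℍ[ℝ])) = 0 ↔
      ∀ β ∈ perp (qbar : ℍ[ℝ]),
        ∫ q : H1, dot β (q : ℍ[ℝ]) * dot (qbar : ℍ[ℝ]) (q : ℍ[ℝ]) * f q ∂sigma = 0 := by
  rw [Submodule.starProjection_apply_eq_zero_iff, Submodule.mem_orthogonal]
  simp_rw [inner_secondMoment hf]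
  rfl

/-! ### Generalised collision invariants and the elliptic equation -/

theorem frameDeriv_add {f g : H1 → ℝ} (hf : SmoothFun f) (hg : SmoothFun g) (a : Fin 3) (q : H1) :
    frameDeriv a (fun q => f q + g q) q = frameDeriv a f q + frameDeriv a g q :=
  ((hasDerivAt_frameDeriv hf a q).fun_add (hasDerivAt_frameDeriv hg a q)).deriv

theorem frameDeriv_const_mul {f : H1 → ℝ} (hf : SmoothFun f) (c : ℝ) (a : Fin 3) (q : H1) :
    frameDeriv a (fun q => c * f q) q = c * frameDeriv a f q :=
  ((hasDerivAt_frameDeriv hf a q).const_mul c).deriv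

/-- The Dirichlet form in terms of the frame. -/
theorem HasWeakGradient.integral_mul_dot {ψ φ w : H1 → ℝ} {G G' : H1 → ℍ[ℝ]}
    (h : HasWeakGradient ψ G) (h' : HasWeakGradient φ G') (hw : Continuous w) :
    ∫ q, w q * dot (G q) (G' q) ∂sigma
      = ∑ a, ∫ q : H1, w q * inner ℝ (G q) ((q : ℍ[ℝ]) * imUnit a)
          * inner ℝ (G' q) ((q : ℍ[ℝ]) * imUnit a) ∂sigma := by
  rw [← integral_finsetSum _ fun a _ => integrable_mul_of_memLp
    (memLp_continuous_mul hw (memLp_frame h.memLp_grad a)) (memLp_frame h'.memLp_grad a)]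
  refine integral_congr_ae ?_
  filter_upwards [h.tangent] with q hq
  rw [dot, inner_eq_sum_frame q, real_inner_comm, show inner ℝ (q : ℍ[ℝ]) (G q) = 0 from hq,
    zero_mul, zero_add, Finset.mul_sum]
  exact Finset.sum_congr rfl fun a _ => (mul_assoc _ _ _).symm

theorem memLp_source (d : ℝ) (qbar : H1) (β : ℍ[ℝ]) : MemLp (fun q : H1 =>
    dot β (q : ℍ[ℝ]) * dot (qbar : ℍ[ℝ]) (q : ℍ[ℝ]) * vonMises d qbar q) 2 sigma :=
  memLp_of_continuous (((continuous_dot _).mul (continuous_dot _)).mul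
    (smoothFun_vonMises d qbar).continuous) 2

/-- It suffices to test the elliptic equation against smooth functions. -/
theorem solvesSphereEq_of_smooth {d : ℝ} {qbar : H1} {β : ℍ[ℝ]} {ψ : H1 → ℝ} {G : H1 → ℍ[ℝ]}
    (hψ : HasWeakGradient ψ G)
    (h : ∀ φ, SmoothFun φ → ∫ q, vonMises d qbar q * dot (G q) (sphereGrad φ q) ∂sigma =
      - ∫ q : H1, dot β (q : ℍ[ℝ]) * dot (qbar : ℍ[ℝ]) (q : ℍ[ℝ]) * φ q
          * vonMises d qbar q ∂sigma) : SolvesSphereEq d qbar β ψ := by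
  have hM := (smoothFun_vonMises d qbar).continuous
  refine ⟨G, hψ, fun φ Gφ hφ => ?_⟩
  have h1 := HasWeakGradient.sum_integral_eq_zero
    (fun a => memLp_continuous_mul hM (memLp_frame hψ.memLp_grad a)) (memLp_source d qbar β)
    (fun φ hφ => by
      have e := h φ hφ
      rw [hψ.integral_mul_dot (hasWeakGradient_sphereGrad hφ) hM] at e
      simp_rw [inner_sphereGrad_frame hφ] at e
      rw [e, neg_add_eq_zero]
      exact integral_congr_ae (ae_of_all _ fun q => by ring)) hφ
  rw [← hψ.integral_mul_dot hφ hM] at h1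
  rw [eq_neg_iff_add_eq_zero, ← h1]
  congr 1
  exact integral_congr_ae (ae_of_all _ fun q => by ring)

/-- If a linear functional vanishes where all functionals of a finite-dimensional family do, it
belongs to the family. -/
theorem exists_eq_of_forall_eq_zero {E V : Type} [AddCommGroup E] [Module ℝ E] [AddCommGroup V]
    [Module ℝ V] [FiniteDimensional ℝ V] (T : E →ₗ[ℝ] V →ₗ[ℝ] ℝ) (l : E →ₗ[ℝ] ℝ)
    (h : ∀ x, (∀ v, T x v = 0) → l x = 0) : ∃ v, ∀ x, l x = T x v := by
  have h1 : l ∈ (LinearMap.ker T).dualAnnihilator := by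
    rw [Submodule.mem_dualAnnihilator]
    intro x hx
    exact h x fun v => by rw [LinearMap.mem_ker.1 hx, LinearMap.zero_apply]
  rw [← LinearMap.range_dualMap_eq_dualAnnihilator_ker] at h1
  obtain ⟨m, hm⟩ := h1
  refine ⟨(Module.evalEquiv ℝ V).symm m, fun x => ?_⟩
  rw [Module.apply_evalEquiv_symm_apply, ← hm]
  rfl

theorem isGCI_iff (d : ℝ) (qbar : H1) (ψ : H1 → ℝ) :
    IsGCI d qbar ψ ↔ ∃ β ∈ perp (qbar : ℍ[ℝ]), SolvesSphereEq d qbar β ψ := by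
  have hM := smoothFun_vonMises d qbar
  have hM0 := fun q => (vonMises_pos d qbar q).ne'
  constructor
  · rintro ⟨⟨G, hG⟩, h⟩
    let S : Submodule ℝ (H1 → ℝ) :=
      { carrier := {f | SmoothFun f}
        add_mem' := fun hf hg => ContMDiff.add hf hg
        zero_mem' := contMDiff_const
        smul_mem' := fun c f hf => ContMDiff.mul contMDiff_const hf }
    -- The functional `l φ = ∫ M ∇ψ · ∇φ` vanishes where all `T φ β = ∫ (β · q) (q̄ · q) φ M` do.
    have hAi : ∀ (a : Fin 3) {φ : H1 → ℝ}, SmoothFun φ → Integrable (fun q : H1 =>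
        vonMises d qbar q * inner ℝ (G q) ((q : ℍ[ℝ]) * imUnit a) * frameDeriv a φ q) sigma :=
      fun a φ hφ => integrable_mul_of_memLp
        (memLp_continuous_mul hM.continuous (memLp_frame hG.memLp_grad a))
        (memLp_of_continuous (contMDiff_frameDeriv hφ a).continuous 2)
    let l : S →ₗ[ℝ] ℝ :=
      { toFun := fun φ => ∑ a, ∫ q : H1, vonMises d qbar q *
          inner ℝ (G q) ((q : ℍ[ℝ]) * imUnit a) * frameDeriv a φ.1 q ∂sigma
        map_add' := fun φ φ' => by
          rw [← Finset.sum_add_distrib]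
          refine Finset.sum_congr rfl fun a _ => ?_
          rw [← integral_add (hAi a φ.2) (hAi a φ'.2)]
          refine integral_congr_ae (ae_of_all _ fun q => ?_)
          change _ * frameDeriv a (fun q => φ.1 q + φ'.1 q) q = _
          simp only [frameDeriv_add φ.2 φ'.2]
          ring
        map_smul' := fun c φ => by
          rw [RingHom.id_apply, smul_eq_mul, Finset.mul_sum]
          refine Finset.sum_congr rfl fun a _ => ?_
          rw [← integral_const_mul]
          refine integral_congr_ae (ae_of_all _ fun q => ?_)
          change _ * frameDeriv a (fun q => c * φ.1 q) q = _
          simp only [frameDeriv_const_mul φ.2]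
          ring }
    have hTi : ∀ (β : ℍ[ℝ]) {φ : H1 → ℝ}, SmoothFun φ → Integrable (fun q : H1 =>
        dot β (q : ℍ[ℝ]) * dot (qbar : ℍ[ℝ]) (q : ℍ[ℝ]) * φ q * vonMises d qbar q) sigma :=
      fun β φ hφ => integrable_of_continuous ((((continuous_dot _).mul (continuous_dot _)).mul
        hφ.continuous).mul hM.continuous)
    let T : S →ₗ[ℝ] perp (qbar : ℍ[ℝ]) →ₗ[ℝ] ℝ := LinearMap.mk₂ ℝ
      (fun φ β => ∫ q : H1, dot β (q : ℍ[ℝ]) * dot (qbar : ℍ[ℝ]) (q : ℍ[ℝ]) * φ.1 q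
        * vonMises d qbar q ∂sigma)
      (fun φ φ' β => by
        rw [← integral_add (hTi β φ.2) (hTi β φ'.2)]
        refine integral_congr_ae (ae_of_all _ fun q => ?_)
        simp only [Submodule.coe_add, Pi.add_apply]
        ring)
      (fun c φ β => by
        rw [smul_eq_mul, ← integral_const_mul]
        refine integral_congr_ae (ae_of_all _ fun q => ?_)
        simp only [Submodule.coe_smul, Pi.smul_apply, smul_eq_mul]
        ring)
      (fun φ β β' => by
        rw [← integral_add (hTi β φ.2) (hTi β' φ.2)]
        refine integral_congr_ae (ae_of_all _ fun q => ?_)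
        simp only [Submodule.coe_add, dot, inner_add_left]
        ring)
      (fun c φ β => by
        rw [smul_eq_mul, ← integral_const_mul]
        refine integral_congr_ae (ae_of_all _ fun q => ?_)
        simp only [Submodule.coe_smul, dot, real_inner_smul_left]
        ring)
    have hl : ∀ φ : S, l φ
        = ∫ q, vonMises d qbar q * dot (G q) (sphereGrad φ.1 q) ∂sigma := fun φ => by
      rw [hG.integral_mul_dot (hasWeakGradient_sphereGrad φ.2) hM.continuous]
      simp_rw [inner_sphereGrad_frame φ.2]
      rfl
    obtain ⟨β, hβ⟩ := exists_eq_of_forall_eq_zero T l fun φ hφ => by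
      -- The test function is `f = M φ`.
      have hf := hM.mul φ.2
      have e1 : (fun q => vonMises d qbar q * φ.1 q / vonMises d qbar q) = φ.1 :=
        funext fun q => mul_div_cancel_left₀ _ (hM0 q)
      have e2 := h _ hf ((starProjection_secondMoment_eq_zero_iff hf.continuous qbar).2
        fun β hβ => by
          rw [← hφ ⟨β, hβ⟩]
          exact integral_congr_ae (ae_of_all _ fun q => by ring))
      rw [collisionC, e1, hG.integral_sphereDiv_mul φ.2, neg_eq_zero] at e2
      rw [hl, e2]
    refine ⟨-β, neg_mem β.2, solvesSphereEq_of_smooth hG fun φ hφ => ?_⟩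
    have e := hβ ⟨φ, hφ⟩
    rw [hl] at e
    rw [e, ← integral_neg]
    refine integral_congr_ae (ae_of_all _ fun q => ?_)
    simp only [dot, inner_neg_left]
    ring
  · rintro ⟨β, hβ, G, hG, h⟩
    refine ⟨⟨G, hG⟩, fun f hf hP => ?_⟩
    have hfM := smoothFun_div_vonMises hf d qbar
    rw [collisionC, hG.integral_sphereDiv_mul hfM, h _ _ (hasWeakGradient_sphereGrad hfM), neg_neg,
      ← (starProjection_secondMoment_eq_zero_iff hf.continuous qbar).1 hP β hβ]
    refine integral_congr_ae (ae_of_all _ fun q => ?_)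
    have := hM0 q
    field_simp

/-! ### Separated solutions of the elliptic equation -/

theorem hasDerivAt_inner_rot (x : ℍ[ℝ]) (a : Fin 3) (q : H1) :
    HasDerivAt (fun t => inner ℝ x ((q * rot a t : H1) : ℍ[ℝ])) (inner ℝ x (q * imUnit a)) 0 := by
  have h := hasDerivAt_of_ambient (f := fun p : H1 => inner ℝ x (p : ℍ[ℝ])) (q := q) a (t := 0)
    (innerSL ℝ x).hasFDerivAt fun p => rfl
  rw [rot_zero, mul_one] at h
  exact h

theorem hasDerivAt_inner_rot_mul (x : ℍ[ℝ]) (a : Fin 3) (q : H1) :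
    HasDerivAt (fun t => inner ℝ x ((q * rot a t : H1) * imUnit a)) (-inner ℝ x (q : ℍ[ℝ])) 0 := by
  have h : HasDerivAt (fun t => -inner ℝ (x * imUnit a) ((q * rot a t : H1) : ℍ[ℝ]))
      (-inner ℝ (x * imUnit a) (q * imUnit a)) 0 := (hasDerivAt_inner_rot (x * imUnit a) a q).neg
  simp_rw [inner_mul_imUnit, neg_neg, mul_assoc, imUnit_mul_self] at h
  refine h.congr_deriv ?_
  simp

theorem hasDerivAt_vonMises_rot (d : ℝ) (qbar q : H1) (a : Fin 3) :
    HasDerivAt (fun t => vonMises d qbar (q * rot a t))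
      (4 / d * inner ℝ (qbar : ℍ[ℝ]) (q : ℍ[ℝ]) * inner ℝ (qbar : ℍ[ℝ]) (q * imUnit a)
        * vonMises d qbar q) 0 := by
  have h : HasDerivAt (fun t => vonMises d qbar (q * rot a t)) _ 0 :=
    (((((hasDerivAt_inner_rot qbar a q).pow 2).sub_const (1 / 4)).const_mul (2 / d)).exp).div_const
      (partitionZ d qbar)
  refine h.congr_deriv ?_
  simp only [Pi.pow_apply, rot_zero, mul_one, vonMises, dot]
  ring

theorem dot_mem_Icc (p q : H1) : dot (p : ℍ[ℝ]) (q : ℍ[ℝ]) ∈ Icc (-1 : ℝ) 1 := by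
  have h := abs_real_inner_le_norm (p : ℍ[ℝ]) (q : ℍ[ℝ])
  rw [norm_eq_of_mem_sphere, norm_eq_of_mem_sphere, mul_one] at h
  exact abs_le.1 h

theorem inner_eq_zero_of_mem_perp {qbar : H1} {β : ℍ[ℝ]} (hβ : β ∈ perp (qbar : ℍ[ℝ])) :
    inner ℝ (qbar : ℍ[ℝ]) β = 0 := Submodule.mem_orthogonal_singleton_iff_inner_right.1 hβ

section Separated

variable {h : ℝ → ℝ} {s : Set ℝ}

theorem smoothFun_psiFun (hs : IsOpen s) (hI : Icc (-1) 1 ⊆ s) (hh : ContDiffOn ℝ ∞ h s)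
    (qbar : H1) (β : ℍ[ℝ]) : SmoothFun (psiFun h qbar β) := by
  refine contMDiff_of_ambient (F := fun x => inner ℝ β x * h (inner ℝ x (qbar : ℍ[ℝ]))) fun q => ?_
  have h1 : ContDiffAt ℝ ∞ h (inner ℝ (q : ℍ[ℝ]) (qbar : ℍ[ℝ])) :=
    (hh.contDiffAt (hs.mem_nhds (hI (dot_mem_Icc q qbar))))
  exact (contDiffAt_const.inner ℝ contDiffAt_id).mul
    (h1.comp (q : ℍ[ℝ]) (contDiffAt_id.inner ℝ contDiffAt_const))

theorem hasDerivAt_comp_dot_rot {u : ℝ → ℝ} {u' : ℝ} (qbar q : H1) (a : Fin 3)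
    (hu : HasDerivAt u u' (inner ℝ (qbar : ℍ[ℝ]) (q : ℍ[ℝ]))) :
    HasDerivAt (fun t => u (inner ℝ (qbar : ℍ[ℝ]) ((q * rot a t : H1) : ℍ[ℝ])))
      (u' * inner ℝ (qbar : ℍ[ℝ]) (q * imUnit a)) 0 := by
  refine HasDerivAt.comp (h₂ := u) 0 ?_ (hasDerivAt_inner_rot qbar a q)
  simpa using hu

theorem psiFun_eq (h : ℝ → ℝ) (qbar : H1) (β : ℍ[ℝ]) (q : H1) :
    psiFun h qbar β q = inner ℝ β (q : ℍ[ℝ]) * h (inner ℝ (qbar : ℍ[ℝ]) (q : ℍ[ℝ])) := by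
  rw [psiFun, dot, dot, real_inner_comm (qbar : ℍ[ℝ])]

variable {d ε : ℝ} {h' h'' : ℝ → ℝ}

theorem frameDeriv_psiFun (hI : Icc (-1) 1 ⊆ s) (hs : IsRadialSolution (4 / d) ε s h h' h'')
    (qbar : H1) (β : ℍ[ℝ]) (a : Fin 3) (q : H1) :
    frameDeriv a (psiFun h qbar β) q
      = inner ℝ β (q * imUnit a) * h (inner ℝ (qbar : ℍ[ℝ]) (q : ℍ[ℝ]))
        + inner ℝ β (q : ℍ[ℝ]) * (h' (inner ℝ (qbar : ℍ[ℝ]) (q : ℍ[ℝ]))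
          * inner ℝ (qbar : ℍ[ℝ]) (q * imUnit a)) := by
  have e : HasDerivAt (fun t => inner ℝ β ((q * rot a t : H1) : ℍ[ℝ])
      * h (inner ℝ (qbar : ℍ[ℝ]) ((q * rot a t : H1) : ℍ[ℝ]))) _ 0 :=
    (hasDerivAt_inner_rot β a q).mul (hasDerivAt_comp_dot_rot qbar q a
      (hs.hasDerivAt _ (hI (dot_mem_Icc qbar q))))
  have := e.deriv
  simp only [rot_zero, mul_one] at this
  rw [frameDeriv]
  simp_rw [psiFun_eq]
  exact this

/-- In the variables `r = qbar · q` and `b = β · q` the operator `∇ · (M ∇ ·)` acts on `b h(r)` as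
`M b` times the radial operator applied to `h`. The left-invariant frame `X_a` satisfies
`∑ (X_a r)² = 1 - r²`, `∑ X_a r X_a b = -r b` and `X_a X_a r = -r`, `X_a X_a b = -b`. -/
theorem sphereDiv_psiFun (hso : IsOpen s) (hI : Icc (-1) 1 ⊆ s) (hh : ContDiffOn ℝ ∞ h s)
    (hs : IsRadialSolution (4 / d) ε s h h' h'') (qbar : H1) {β : ℍ[ℝ]}
    (hβ : β ∈ perp (qbar : ℍ[ℝ])) (q : H1) :
    sphereDiv (fun q => vonMises d qbar q • sphereGrad (psiFun h qbar β) q) q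
      = ε * dot β (q : ℍ[ℝ]) * dot (qbar : ℍ[ℝ]) (q : ℍ[ℝ]) * vonMises d qbar q := by
  have hψ := smoothFun_psiFun hso hI hh qbar β
  have hr := hI (dot_mem_Icc qbar q)
  rw [sphereDiv_eq_sum (smoothTangentField_vonMises_smul hψ d qbar)]
  simp_rw [real_inner_smul_left, inner_sphereGrad_frame hψ, frameDeriv_psiFun hI hs]
  unfold dot at hr ⊢
  set r := inner ℝ (qbar : ℍ[ℝ]) (q : ℍ[ℝ]) with hr_def
  set b := inner ℝ β (q : ℍ[ℝ]) with hb_def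
  set M := vonMises d qbar q with hM_def
  have key : ∀ a : Fin 3, frameDeriv a (fun p : H1 => vonMises d qbar p *
      (inner ℝ β (p * imUnit a) * h (inner ℝ (qbar : ℍ[ℝ]) (p : ℍ[ℝ]))
        + inner ℝ β (p : ℍ[ℝ]) * (h' (inner ℝ (qbar : ℍ[ℝ]) (p : ℍ[ℝ]))
          * inner ℝ (qbar : ℍ[ℝ]) (p * imUnit a)))) q
      = M * (4 / d * r * h r + 2 * h' r)
          * (inner ℝ (qbar : ℍ[ℝ]) (q * imUnit a) * inner ℝ β (q * imUnit a))
        + M * b * (4 / d * r * h' r + h'' r)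
          * (inner ℝ (qbar : ℍ[ℝ]) (q * imUnit a) * inner ℝ (qbar : ℍ[ℝ]) (q * imUnit a))
        - M * b * (h r + r * h' r) := fun a => by
    have d1 := hasDerivAt_comp_dot_rot qbar q a (hs.hasDerivAt _ hr)
    have d2 := hasDerivAt_comp_dot_rot qbar q a (hs.hasDerivAt' _ hr)
    have e := (hasDerivAt_vonMises_rot d qbar q a).fun_mul
      (((hasDerivAt_inner_rot_mul β a q).fun_mul d1).fun_add
        ((hasDerivAt_inner_rot β a q).fun_mul (d2.fun_mul (hasDerivAt_inner_rot_mul qbar a q))))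
    refine e.deriv.trans ?_
    simp only [rot_zero, mul_one, ← hr_def, ← hb_def, ← hM_def]
    ring
  simp_rw [key]
  have s1 := inner_eq_sum_frame q qbar β
  have s2 := inner_eq_sum_frame q qbar qbar
  rw [inner_eq_zero_of_mem_perp hβ] at s1
  rw [real_inner_self_eq_norm_sq, norm_eq_of_mem_sphere] at s2
  rw [Finset.sum_sub_distrib, Finset.sum_add_distrib, ← Finset.mul_sum, ← Finset.mul_sum]
  simp only [Finset.sum_const, Finset.card_univ, Fintype.card_fin, nsmul_eq_mul, Nat.cast_ofNat]
  have ode := hs.eq r hr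
  rw [← hr_def, ← hb_def] at s1
  rw [← hr_def] at s2
  linear_combination M * b * ode - M * (4 / d * r * h r + 2 * h' r) * s1
    - M * b * (4 / d * r * h' r + h'' r) * s2

theorem solvesSphereEq_psiFun (hso : IsOpen s) (hI : Icc (-1) 1 ⊆ s) (hh : ContDiffOn ℝ ∞ h s)
    (hs : IsRadialSolution (4 / d) 1 s h h' h'') (qbar : H1) {β : ℍ[ℝ]}
    (hβ : β ∈ perp (qbar : ℍ[ℝ])) : SolvesSphereEq d qbar β (psiFun h qbar β) := by
  have hψ := smoothFun_psiFun hso hI hh qbar β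
  refine ⟨_, hasWeakGradient_sphereGrad hψ, fun φ Gφ hφ => ?_⟩
  have e := hφ.integral_sphereDiv_mul hψ d qbar
  simp_rw [sphereDiv_psiFun hso hI hh hs qbar hβ, one_mul] at e
  rw [eq_neg_iff_add_eq_zero, add_comm, ← eq_neg_iff_add_eq_zero]
  refine Eq.trans ?_ (e.trans ?_)
  · exact integral_congr_ae (ae_of_all _ fun q => by ring)
  · simp_rw [dot, real_inner_comm (Gφ _)]

end Separated

/-! ### Uniqueness for the elliptic equation -/

theorem SolvesSphereEq.ae_eq_add_const {d : ℝ} {qbar : H1} {β : ℍ[ℝ]} {ψ ψ' : H1 → ℝ}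
    (h : SolvesSphereEq d qbar β ψ) (h' : SolvesSphereEq d qbar β ψ') :
    ∃ c : ℝ, ψ' =ᵐ[sigma] fun q => ψ q + c := by
  obtain ⟨G, hG, hw⟩ := h
  obtain ⟨G', hG', hw'⟩ := h'
  have hD := hG'.add_const_mul hG (-1)
  set D : H1 → ℍ[ℝ] := fun q => G' q + (-1 : ℝ) • G q with hDdef
  have hMc := (smoothFun_vonMises d qbar).continuous
  have hint : ∀ {X : H1 → ℍ[ℝ]}, MemLp X 2 sigma →
      Integrable (fun q => vonMises d qbar q * dot (X q) (D q)) sigma := fun {X} hX => by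
    obtain ⟨C, hC⟩ := (isCompact_range hMc).isBounded.exists_norm_le
    have h1 : Integrable (fun q => dot (X q) (D q)) sigma := by
      have := L2.integrable_inner (𝕜 := ℝ) (hX.toLp X) (hD.memLp_grad.toLp D)
      refine this.congr ?_
      filter_upwards [hX.coeFn_toLp, hD.memLp_grad.coeFn_toLp] with q e1 e2
      rw [e1, e2, dot]
    exact h1.bdd_mul (c := C) hMc.aestronglyMeasurable (ae_of_all _ fun q => hC _ ⟨q, rfl⟩)
  have h0 : ∫ q, vonMises d qbar q * dot (D q) (D q) ∂sigma = 0 := by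
    have e : ∀ q, vonMises d qbar q * dot (D q) (D q)
        = vonMises d qbar q * dot (G' q) (D q) - vonMises d qbar q * dot (G q) (D q) := fun q => by
      simp only [hDdef, dot, inner_add_left, real_inner_smul_left]
      ring
    simp_rw [e]
    rw [integral_sub (hint hG'.memLp_grad) (hint hG.memLp_grad), hw' _ _ hD, hw _ _ hD, sub_self]
  have hnn : ∀ q, 0 ≤ vonMises d qbar q * dot (D q) (D q) := fun q =>
    mul_nonneg (vonMises_pos d qbar q).le real_inner_self_nonneg
  have h1 : D =ᵐ[sigma] 0 := by
    filter_upwards [(integral_eq_zero_iff_of_nonneg hnn (hint hD.memLp_grad)).1 h0] with q hq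
    exact inner_self_eq_zero.1 ((mul_eq_zero.1 hq).resolve_left (vonMises_pos d qbar q).ne')
  obtain ⟨c, hc⟩ := hD.ae_eq_const h1
  refine ⟨c, ?_⟩
  filter_upwards [hc] with q hq
  linarith

theorem SolvesSphereEq.add_const {d : ℝ} {qbar : H1} {β : ℍ[ℝ]} {ψ ψ' : H1 → ℝ}
    (h : SolvesSphereEq d qbar β ψ) (c : ℝ) (he : ψ' =ᵐ[sigma] fun q => ψ q + c) :
    SolvesSphereEq d qbar β ψ' := by
  obtain ⟨G, hG, hw⟩ := h
  have h1 : sphereGrad (fun _ : H1 => (1 : ℝ)) = 0 := by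
    ext1 q
    have e : SmoothFun fun _ : H1 => (1 : ℝ) := contMDiff_const
    refine ext_inner_right ℝ fun v => ?_
    rw [inner_eq_sum_frame q, real_inner_comm, inner_sphereGrad_self e]
    simp [inner_sphereGrad_frame e, frameDeriv]
  have h2 := hG.add_const_mul (hasWeakGradient_sphereGrad (f := fun _ => (1 : ℝ)) contMDiff_const) c
  rw [h1] at h2
  simp only [mul_one, Pi.zero_apply, smul_zero, add_zero] at h2
  exact ⟨G, h2.congr_ae he, hw⟩

/-! ### Radial profiles and functions on the sphere -/

theorem psiFun_add (h : ℝ → ℝ) (qbar : H1) (β β' : ℍ[ℝ]) :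
    psiFun h qbar (β + β') = psiFun h qbar β + psiFun h qbar β' := by
  ext q
  simp only [psiFun, dot, inner_add_left, Pi.add_apply, add_mul]

theorem psiFun_smul (h : ℝ → ℝ) (qbar : H1) (c : ℝ) (β : ℍ[ℝ]) :
    psiFun h qbar (c • β) = c • psiFun h qbar β := by
  ext q
  simp only [psiFun, dot, real_inner_smul_left, Pi.smul_apply, smul_eq_mul, mul_assoc]

/-- The reflection `β ↦ -β` fixes `qbar` and changes the sign of `(β · q) k(q · qbar)`. -/
theorem integral_psiFun (k : ℝ → ℝ) {qbar : H1} {β : ℍ[ℝ]} (hβ : β ∈ perp (qbar : ℍ[ℝ])) :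
    ∫ q, psiFun k qbar β q ∂sigma = 0 := by
  let L : ℍ[ℝ] ≃ₗᵢ[ℝ] ℍ[ℝ] := (Submodule.span ℝ {β})ᗮ.reflection
  have hL : ∀ x y : ℍ[ℝ], inner ℝ x (L y) = inner ℝ (L x) y := fun x y => by
    rw [← L.inner_map_map x, Submodule.reflection_reflection]
  have hLβ : L β = -β := Submodule.reflection_orthogonalComplement_singleton_eq_neg β
  have hLq : L qbar = qbar := Submodule.reflection_mem_subspace_eq_self
    (Submodule.mem_orthogonal_singleton_iff_inner_left.2 (inner_eq_zero_of_mem_perp hβ))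
  have hLL : ∀ q, sphereMap L (sphereMap L q) = q := fun q =>
    Subtype.ext (Submodule.reflection_reflection _ _)
  have hc : Continuous (sphereMap L) :=
    (L.continuous.comp continuous_subtype_val).subtype_mk _
  have he : MeasurableEmbedding (sphereMap L) :=
    (hc.isClosedEmbedding (Function.Involutive.injective hLL)).measurableEmbedding
  have h := (measurePreserving_sphereMap L).integral_comp he (psiFun k qbar β)
  have e : ∀ q, psiFun k qbar β (sphereMap L q) = -psiFun k qbar β q := fun q => by
    have : ((sphereMap L q : H1) : ℍ[ℝ]) = L q := rfl
    rw [psiFun_eq, psiFun_eq, this, hL, hL, hLβ, hLq, inner_neg_left, neg_mul]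
  simp_rw [e, integral_neg] at h
  linarith

theorem psiFun_congr {h k : ℝ → ℝ} (e : EqOn k h (Ioo (-1) 1)) {qbar : H1} {β : ℍ[ℝ]}
    (hβ : β ∈ perp (qbar : ℍ[ℝ])) : psiFun k qbar β = psiFun h qbar β := by
  ext q
  rw [psiFun_eq, psiFun_eq]
  have hI := dot_mem_Icc qbar q
  unfold dot at hI
  set r := inner ℝ (qbar : ℍ[ℝ]) (q : ℍ[ℝ]) with hr
  by_cases hr' : r ∈ Ioo (-1 : ℝ) 1
  · rw [e hr']
  · -- at the poles `q = ± qbar` the factor `β · q` vanishes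
    have h1 : r ^ 2 = 1 := by
      rcases eq_or_lt_of_le hI.1 with h | h
      · rw [← h]; norm_num
      rcases eq_or_lt_of_le hI.2 with h' | h'
      · rw [h']; norm_num
      exact absurd ⟨h, h'⟩ hr'
    have h2 : ‖(q : ℍ[ℝ]) - r • (qbar : ℍ[ℝ])‖ ^ 2 = 0 := by
      rw [norm_sub_sq_real, norm_smul, mul_pow, norm_eq_of_mem_sphere, norm_eq_of_mem_sphere,
        Real.norm_eq_abs, sq_abs, inner_smul_right, real_inner_comm, ← hr]
      linear_combination -h1
    have h3 : (q : ℍ[ℝ]) = r • (qbar : ℍ[ℝ]) := by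
      rwa [sq_eq_zero_iff, norm_eq_zero, sub_eq_zero] at h2
    rw [h3, inner_smul_right, real_inner_comm, inner_eq_zero_of_mem_perp hβ]
    simp

/-- Every `r ∈ (-1, 1)` is attained by `qbar · q` at a point with `β · q ≠ 0`. -/
theorem exists_inner_eq {qbar : H1} {β : ℍ[ℝ]} (hβ : β ∈ perp (qbar : ℍ[ℝ])) (hβ0 : β ≠ 0)
    {r : ℝ} (hr : r ∈ Ioo (-1 : ℝ) 1) :
    ∃ q : H1, inner ℝ (qbar : ℍ[ℝ]) (q : ℍ[ℝ]) = r ∧ inner ℝ β (q : ℍ[ℝ]) ≠ 0 := by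
  have h0 := inner_eq_zero_of_mem_perp hβ
  have hn : ‖β‖ ≠ 0 := norm_ne_zero_iff.2 hβ0
  have hs := Real.sqrt_pos.2 (one_sub_sq_pos hr)
  have hq : ‖r • (qbar : ℍ[ℝ]) + (√(1 - r ^ 2) * ‖β‖⁻¹) • β‖ ^ 2 = 1 := by
    rw [norm_add_sq_real, norm_smul, norm_smul, real_inner_smul_left, inner_smul_right, h0,
      norm_eq_of_mem_sphere, mul_pow, mul_pow, Real.norm_eq_abs, Real.norm_eq_abs, sq_abs, sq_abs,
      mul_pow, Real.sq_sqrt (one_sub_sq_pos hr).le]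
    field_simp
    ring
  refine ⟨⟨_, mem_sphere_zero_iff_norm.2 ((pow_eq_one_iff_of_nonneg
    (norm_nonneg _) two_ne_zero).1 hq)⟩, ?_, ?_⟩
  · simp only [inner_add_right, inner_smul_right, h0, real_inner_self_eq_norm_sq,
      norm_eq_of_mem_sphere]
    ring
  · simp only [inner_add_right, inner_smul_right, real_inner_comm (qbar : ℍ[ℝ]) β, h0,
      real_inner_self_eq_norm_sq]
    have : r * 0 + √(1 - r ^ 2) * ‖β‖⁻¹ * ‖β‖ ^ 2 = √(1 - r ^ 2) * ‖β‖ := by field_simp; ring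
    rw [this]
    positivity

theorem eqOn_of_psiFun_ae_eq {h k : ℝ → ℝ} (hh : ContinuousOn h (Ioo (-1) 1))
    (hk : ContinuousOn k (Ioo (-1) 1)) {qbar : H1} {β : ℍ[ℝ]} (hβ : β ∈ perp (qbar : ℍ[ℝ]))
    (hβ0 : β ≠ 0) (e : psiFun k qbar β =ᵐ[sigma] psiFun h qbar β) : EqOn k h (Ioo (-1) 1) := by
  set U : Set H1 := (fun q : H1 => inner ℝ (qbar : ℍ[ℝ]) (q : ℍ[ℝ])) ⁻¹' Ioo (-1) 1 with hU
  have hUo : IsOpen U := isOpen_Ioo.preimage (continuous_dot qbar)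
  have hcont : ∀ {u : ℝ → ℝ}, ContinuousOn u (Ioo (-1) 1) → ContinuousOn (psiFun u qbar β) U :=
    fun {u} hu => by
      have h1 : ContinuousOn (fun q : H1 => inner ℝ β (q : ℍ[ℝ])
          * u (inner ℝ (qbar : ℍ[ℝ]) (q : ℍ[ℝ]))) U :=
        (continuous_dot β).continuousOn.mul
          (hu.comp (continuous_dot qbar).continuousOn fun q hq => hq)
      exact h1.congr fun q _ => psiFun_eq u qbar β q
  have h1 := Measure.eqOn_open_of_ae_eq (ae_restrict_of_ae (s := U) e) hUo (hcont hk) (hcont hh)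
  intro r hr
  obtain ⟨q, hq, hq'⟩ := exists_inner_eq hβ hβ0 hr
  have h2 := h1 (show q ∈ U by rw [hU, mem_preimage, hq]; exact hr)
  rw [psiFun_eq, psiFun_eq, hq] at h2
  exact mul_left_cancel₀ hq' h2

/-- Two separated functions that differ by a constant are equal, since both have mean zero. -/
theorem eq_zero_of_psiFun_ae_eq_add_const {h k : ℝ → ℝ} {qbar : H1} {β β' : ℍ[ℝ]}
    (hβ : β ∈ perp (qbar : ℍ[ℝ])) (hβ' : β' ∈ perp (qbar : ℍ[ℝ]))
    (hi : Integrable (psiFun h qbar β) sigma) {c : ℝ}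
    (e : psiFun k qbar β' =ᵐ[sigma] fun q => psiFun h qbar β q + c) : c = 0 := by
  have h1 := integral_congr_ae e
  rw [integral_psiFun k hβ', integral_add hi (integrable_const c), integral_psiFun h hβ,
    integral_const, zero_add, smul_eq_mul] at h1
  exact (mul_eq_zero.1 h1.symm).resolve_left sigma_real_univ_pos.ne'

end GCIQuat

theorem proposition4p5 (d : ℝ) (hd : 0 < d) :
    ∃ h : ℝ → ℝ,
      -- `h` is the unique solution of the equation in the weighted space, and it is classical
      IsODESolution d h ∧ IsWeakODESolution d h ∧
      (∀ k : ℝ → ℝ, IsWeakODESolution d k → k =ᵐ[volume.restrict (Ioo (-1 : ℝ) 1)] h) ∧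
      -- `h` is odd, and nonpositive for nonnegative arguments
      (∀ r ∈ Ioo (-1 : ℝ) 1, h (-r) = - h r) ∧
      (∀ r ∈ Ico (0 : ℝ) 1, h r ≤ 0) ∧
      ∀ qbar : H1,
        -- characterisation of the generalised collision invariants by an elliptic equation
        (∀ ψ : H1 → ℝ, IsGCI d qbar ψ ↔
          ∃ β ∈ perp (qbar : ℍ[ℝ]), SolvesSphereEq d qbar β ψ) ∧
        -- existence of solutions in `H¹`, and uniqueness up to an additive constant
        (∀ β ∈ perp (qbar : ℍ[ℝ]), ∃ ψ : H1 → ℝ, ∀ ψ' : H1 → ℝ,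
          SolvesSphereEq d qbar β ψ' ↔ ∃ c : ℝ, ψ' =ᵐ[sigma] fun q => ψ q + c) ∧
        -- solutions of the form `(β · q) k(q · qbar)` with zero mean
        (∀ β ∈ perp (qbar : ℍ[ℝ]), β ≠ 0 → ∀ k : ℝ → ℝ, ContDiffOn ℝ 2 k (Ioo (-1) 1) →
          ((SolvesSphereEq d qbar β (psiFun k qbar β) ∧ ∫ q, psiFun k qbar β q ∂sigma = 0) ↔
            IsODESolution d k)) ∧
        -- description of the set of generalised collision invariants
        ∃ hL : ∀ β : perp (qbar : ℍ[ℝ]), MemLp (psiFun h qbar (β : ℍ[ℝ])) 2 sigma,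
          GCI d qbar = (Submodule.span ℝ
            (insert ((memLp_const (1 : ℝ)).toLp (fun _ : H1 => (1 : ℝ)))
              (range fun β : perp (qbar : ℍ[ℝ]) =>
                (hL β).toLp (psiFun h qbar (β : ℍ[ℝ])))) : Set (Lp ℝ 2 sigma)) ∧
          finrank ℝ (Submodule.span ℝ
            (insert ((memLp_const (1 : ℝ)).toLp (fun _ : H1 => (1 : ℝ)))
              (range fun β : perp (qbar : ℍ[ℝ]) =>
                (hL β).toLp (psiFun h qbar (β : ℍ[ℝ])))) : Submodule ℝ (Lp ℝ 2 sigma)) = 4 := by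
  obtain ⟨h, hsm, hs, hodd, hneg⟩ := exists_odd_isRadialSolution (κ := 4 / d) (by positivity)
  have hI := Icc_subset_Ioo_nine_fourths
  have hode := isODESolution_of_isRadialSolution hs hsm
  have hc : ContinuousOn h (Ioo (-1) 1) := hode.1.continuousOn
  have huniq : ∀ k, IsWeakODESolution d k → k =ᵐ[volume.restrict (Ioo (-1 : ℝ) 1)] h :=
    fun k hk => hode.isWeakODESolution.ae_eq hd hk
  refine ⟨h, hode, hode.isWeakODESolution, huniq, fun r _ => hodd r,
    fun r hr => hneg r (Ico_subset_Icc_self hr), fun qbar => ?_⟩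
  have hcont : ∀ β : ℍ[ℝ], Continuous (psiFun h qbar β) := fun β =>
    (smoothFun_psiFun isOpen_Ioo hI hsm qbar β).continuous
  have hsol : ∀ β ∈ perp (qbar : ℍ[ℝ]), ∀ ψ', SolvesSphereEq d qbar β ψ' ↔
      ∃ c : ℝ, ψ' =ᵐ[sigma] fun q => psiFun h qbar β q + c := fun β hβ ψ' =>
    have h1 := solvesSphereEq_psiFun isOpen_Ioo hI hsm hs qbar hβ
    ⟨h1.ae_eq_add_const, fun ⟨c, e⟩ => h1.add_const c e⟩
  refine ⟨isGCI_iff d qbar, fun β hβ => ⟨_, hsol β hβ⟩, fun β hβ hβ0 k hk => ⟨?_, fun hk' => ?_⟩,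
    fun β => memLp_of_continuous (hcont β) 2, ?_⟩
  · rintro ⟨h1, -⟩
    obtain ⟨c, e⟩ := (hsol β hβ _).1 h1
    rw [eq_zero_of_psiFun_ae_eq_add_const hβ hβ (integrable_of_continuous (hcont β)) e] at e
    simp only [add_zero] at e
    exact hode.congr (eqOn_of_psiFun_ae_eq hc hk.continuousOn hβ hβ0 e)
  · have e := Measure.eqOn_open_of_ae_eq (huniq k hk'.isWeakODESolution) isOpen_Ioo
      hk.continuousOn hc
    rw [psiFun_congr e hβ]
    exact ⟨solvesSphereEq_psiFun isOpen_Ioo hI hsm hs qbar hβ, integral_psiFun h hβ⟩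
  · set hL : ∀ β : perp (qbar : ℍ[ℝ]), MemLp (psiFun h qbar (β : ℍ[ℝ])) 2 sigma :=
      fun β => memLp_of_continuous (hcont β) 2
    set one : Lp ℝ 2 sigma := (memLp_const (1 : ℝ)).toLp (fun _ : H1 => (1 : ℝ)) with hone
    let Ψ : perp (qbar : ℍ[ℝ]) →ₗ[ℝ] Lp ℝ 2 sigma :=
      { toFun := fun β => (hL β).toLp (psiFun h qbar (β : ℍ[ℝ]))
        map_add' := fun β β' => by
          rw [← MemLp.toLp_add]
          exact MemLp.toLp_congr _ _ (by rw [Submodule.coe_add, psiFun_add])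
        map_smul' := fun c β => by
          rw [RingHom.id_apply, ← MemLp.toLp_const_smul]
          exact MemLp.toLp_congr _ _ (by rw [Submodule.coe_smul, psiFun_smul]) }
    let Φ : ℝ × perp (qbar : ℍ[ℝ]) →ₗ[ℝ] Lp ℝ 2 sigma :=
      (LinearMap.toSpanSingleton ℝ _ one).coprod Ψ
    have hΦ : ∀ c β, (Φ (c, β) : H1 → ℝ) =ᵐ[sigma] fun q => psiFun h qbar β q + c := fun c β => by
      have e : Φ (c, β) = ((memLp_const c).add (hL β)).toLp
          ((fun _ => c) + psiFun h qbar (β : ℍ[ℝ])) := by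
        rw [MemLp.toLp_add (memLp_const c) (hL β)]
        refine congrArg (· + Ψ β) ?_
        change c • one = _
        rw [hone, ← MemLp.toLp_const_smul]
        exact MemLp.toLp_congr _ _ (ae_of_all _ fun q => by simp)
      rw [e]
      filter_upwards [((memLp_const c).add (hL β)).coeFn_toLp] with q hq
      rw [hq, Pi.add_apply, add_comm]
    have hspan : Submodule.span ℝ (insert one (range fun β => (hL β).toLp (psiFun h qbar β)))
        = LinearMap.range Φ := by
      rw [LinearMap.range_coprod, LinearMap.range_toSpanSingleton, Submodule.span_insert]
      congr 1
      exact Submodule.span_eq (LinearMap.range Ψ)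
    rw [hspan]
    constructor
    · ext u
      change IsGCI d qbar u ↔ u ∈ LinearMap.range Φ
      rw [isGCI_iff, LinearMap.mem_range]
      constructor
      · rintro ⟨β, hβ, hu⟩
        obtain ⟨c, e⟩ := (hsol β hβ _).1 hu
        exact ⟨(c, ⟨β, hβ⟩), Lp.ext ((hΦ c ⟨β, hβ⟩).trans e.symm)⟩
      · rintro ⟨⟨c, β⟩, rfl⟩
        exact ⟨β, β.2, (hsol β β.2 _).2 ⟨c, hΦ c β⟩⟩
    · have hinj : Function.Injective Φ := by
        rw [injective_iff_map_eq_zero]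
        rintro ⟨c, β⟩ h0
        have e : psiFun h qbar 0 =ᵐ[sigma] fun q => psiFun h qbar β q + c := by
          filter_upwards [hΦ c β, Lp.coeFn_zero ℝ 2 sigma] with q h1 h2
          rw [← h1, h0, h2]
          simp [psiFun, dot]
        have hc0 := eq_zero_of_psiFun_ae_eq_add_const β.2 (zero_mem _)
          (integrable_of_continuous (hcont β)) e
        have hβ0 : (β : ℍ[ℝ]) = 0 := by
          by_contra hβ
          refine hode.not_eqOn_zero (eqOn_of_psiFun_ae_eq hc continuousOn_const β.2 hβ ?_)
          filter_upwards [e] with q hq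
          rw [hc0, add_zero] at hq
          rw [← hq]
          simp [psiFun, dot]
        rw [hc0, Prod.mk_eq_zero]
        exact ⟨rfl, Subtype.ext hβ0⟩
      rw [LinearMap.finrank_range_of_inj hinj, Module.finrank_prod, Module.finrank_self]
      have : finrank ℝ (perp (qbar : ℍ[ℝ])) = 3 :=
        Submodule.finrank_orthogonal_span_singleton (coe_ne_zero qbar)
      rw [this]
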